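/- **Setting.** Let $\mathcal C,\mathcal D$ be small categories and $p:\mathcal E\to\mathcal C$ a homotopical $\Delta$-opfibration, in the following sense. * $p$ is a Grothendieck opfibration. Its *transpose fibration* $p^\top:\mathcal E^\top\to\mathcal C^{op}$ has the objects of $\mathcal E$; a morphism $x\to z$ is an isomorphism class of cospans $x\to y\leftarrow z$ with $x\to y$ fibrewise and $z\to y$ opCartesian. * There is a class $\mathcal W$ of fibrewise morphisms of $\mathcal E$ (weak equivalences) which contains the fibrewise isomorphisms, has the two-out-of-three property, and is such that in a commutative square with opCartesian rows over the same map of $\mathcal C$ and fibrewise columns $f,f'$, $f\in\mathcal W$ implies $f'\in\mathcal W$. * There is a $\Delta$-structure on $\mathcal E^\top$ over $\mathcal C^{op}$: a functor $\otimes:\Delta\times\mathcal E^\top\to\mathcal E^\top$ over $\mathcal C^{op}$, with fibrewise natural maps $\Delta^n\otimes x\to\Delta^n\otimes(\Delta^n\otimes x)$ (coassociative) and a fibrewise natural isomorphism $\Delta^0\otimes x\cong x$, which is a counit for them. * Each fibre $\mathcal E(c)$, with the induced data, is a homotopical $\Delta$-category: it is cocomplete; each $\Delta^n\otimes-$ preserves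 small colimits; $\mathcal W$ contains the isomorphisms, satisfies two-out-of-three and two-out-of-six and is closed under small coproducts; the extension of $\otimes$ to simplicial sets, $S\otimes x=\operatorname{colim}_{\Delta^n\to S}\Delta^n\otimes x$, sends weak homotopy equivalences in $S$ and weak equivalences in $x$ to weak equivalences; the action maps $(S\times T)\otimes x\to S\otimes(T\otimes x)$ are weak equivalences; the realisation $|X|=\int^{[n]}\Delta^n\otimes X_n$ preserves pointwise weak equivalences; and for every bisimplicial object $X$ the map $|\operatorname{diag}X|\to\int^{[n],[m]}\Delta^n\otimes(\Delta^m\otimes X_{nm})$ induced by the diagonals is a weak equivalence. Let $\mathbb C$ be the simplicial replacement of $\mathcal C$: its objects are the chains $\mathbf c=(c_0\to\dots\to c_n)$, and a morphism $\mathbf c_{[n]}\to\mathbf c'_{[m]}$ is a map $a:[m]\to[n]$ of $\Delta$ with $\mathbf c'=a^*\mathbf c$; it is an *anchor map* if $a(i)=i$ for all $i$. Let $t:\mathbb C\to\mathcal C^{op}$, $\mathbf c\mapsto c_n$, and let $\mathbf E\to\mathbb C$ be the pullback of $\mathcal E^\top$ along $t$. $\mathrm{PSect}(\mathcal C,\mathcal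 E)$ is the category of sections of $\mathbf E\to\mathbb C$ (presections), with pointwise weak equivalences, and $\mathrm{Ho}\,\mathrm{PSect}(\mathcal C,\mathcal E)$ is its localisation at them. A *derived section* is a presection sending anchor maps to weakly Cartesian maps (a weak equivalence followed by a Cartesian map). A functor $F:\mathcal D\to\mathcal C$ induces $\mathbb F:\mathbb D\to\mathbb C$, and $\mathbb F^*:\mathrm{PSect}(\mathcal C,\mathcal E)\to\mathrm{PSect}(\mathcal D,F^*\mathcal E)$, where the latter is the category of sections over $\mathbb D$ of $\mathbb F^*\mathbf E$. For presections $S$ over $\mathbb D$ and $A$ over $\mathbb C$, and $\mathbf c=(c_0\to\dots\to c_m)\in\mathbb C$, put $$(\mathbb F_!S)(\mathbf c)=\Bigl|\,[n]\mapsto\coprod_{\mathbf d_{[n]},\ \alpha:F(d_n)\to c_0}(F(d_n)\to c_0\to c_m)_!\,S(\mathbf d)\Bigr|,$$ $$A^{\mathbb F}(\mathbf c)=\Bigl|\,[n]\mapsto\coprod_{\mathbf d_{[n]},\ \alpha:F(d_n)\to c_0}A(\mathbb F\mathbf d*^\alpha\mathbf c)\Bigr|,$$ where $\mathbb F\mathbf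 d*^\alpha\mathbf c=(F(d_0)\to\dots\to F(d_n)\xrightarrow{\alpha}c_0\to\dots\to c_m)$. There is a natural *counit span* $$\mathbb F_!\mathbb F^*A\leftarrow A^{\mathbb F}\to A$$ in $\mathrm{PSect}(\mathcal C,\mathcal E)$. Its left map is induced by the action of $A$ on the anchor maps $\mathbb F\mathbf d*^\alpha\mathbf c\to\mathbb F\mathbf d$. Its right map is induced by the action of $A$ on the maps $\mathbb F\mathbf d*^\alpha\mathbf c\to\mathbf c$, followed by the folding maps $\coprod A(\mathbf c)\to A(\mathbf c)$ and the map $|A|\to A$ from the realisation of the constant simplicial object. When the left map is a weak equivalence, the *counit* $\epsilon_A:\mathbb F_!\mathbb F^*A\to A$ in $\mathrm{Ho}\,\mathrm{PSect}(\mathcal C,\mathcal E)$ is the inverse of the left map followed by the right map. **Proposition.** Suppose that $F:\mathcal D\to\mathcal C$ is a resolution, that is, an opfibration such that the nerve of every fibre $\mathcal D(c)$ is weakly contractible. Then for every derived section $A\in\mathrm{PSect}(\mathcal C,\mathcal E)$ both maps of the counit span $\mathbb F_!\mathbb F^*A\leftarrow A^{\mathbb F}\to A$ are weak equivalences, and the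 counit $\epsilon_A:\mathbb F_!\mathbb F^*A\to A$ is an isomorphism in $\mathrm{Ho}\,\mathrm{PSect}(\mathcal C,\mathcal E)$. -/

import Mathlib

open CategoryTheory CategoryTheory.Limits Opposite
open scoped Simplicial

universe w v u v₁ u₁ v₂ u₂ v₃ u₃

namespace DerSect

section Opfibrations

variable {C : Type u₁} [Category.{v₁} C] {E : Type u} [Category.{v} E]

/-- A functor `p` is an opfibration if every morphism out of `p.obj a` has an opCartesian lift
with source `a`, and opCartesian morphisms compose. -/
class IsOpfibration (p : E ⥤ C) : Prop where
  exists_isCocartesian {a : E} {S : C} (f : p.obj a ⟶ S) :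
    ∃ (b : E) (φ : a ⟶ b), p.IsCocartesian f φ
  comp {R S T : C} (f : R ⟶ S) (g : S ⟶ T) {a b c : E} (φ : a ⟶ b) (ψ : b ⟶ c)
    [p.IsCocartesian f φ] [p.IsCocartesian g ψ] : p.IsCocartesian (f ≫ g) (φ ≫ ψ)

theorem IsOpfibration.exists_lift (p : E ⥤ C) [IsOpfibration p] {a : E} {R S : C}
    (ha : p.obj a = R) (f : R ⟶ S) : ∃ (b : E) (φ : a ⟶ b), p.IsCocartesian f φ := by
  subst ha; exact IsOpfibration.exists_isCocartesian f

instance (p : E ⥤ C) [IsOpfibration p] {R S T : C} (f : R ⟶ S) (g : S ⟶ T) {a b c : E}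
    (φ : a ⟶ b) (ψ : b ⟶ c) [p.IsCocartesian f φ] [p.IsCocartesian g ψ] :
    p.IsCocartesian (f ≫ g) (φ ≫ ψ) :=
  IsOpfibration.comp f g φ ψ

theorem IsOpfibration.isStronglyCocartesian (p : E ⥤ C) [IsOpfibration p] {R S : C} (f : R ⟶ S)
    {a b : E} (φ : a ⟶ b) [p.IsCocartesian f φ] : p.IsStronglyCocartesian f φ where
  universal_property' {b'} g φ' hφ' := by
    obtain ⟨c, ψ, hψ⟩ := IsOpfibration.exists_lift p (IsHomLift.codomain_eq p f φ) g
    let τ := Functor.IsCocartesian.map p (f ≫ g) (φ ≫ ψ) φ'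
    refine ⟨ψ ≫ τ, ⟨inferInstance, by
      rw [← Category.assoc]; exact Functor.IsCocartesian.fac p (f ≫ g) (φ ≫ ψ) φ'⟩, ?_⟩
    rintro π ⟨hπ, hπ'⟩
    rw [← Functor.IsCocartesian.fac p g ψ π]
    congr 1
    apply Functor.IsCocartesian.map_uniq
    rw [Category.assoc, Functor.IsCocartesian.fac, hπ']

end Opfibrations

section Transpose

variable {C : Type u₁} [Category.{v₁} C] {E : Type u} [Category.{v} E]

/-- A cospan `x ⟶ apex ⟵ z` whose left leg is fibrewise and whose right leg is opCartesian. -/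
structure Cospan (p : E ⥤ C) (x z : E) where
  /-- the image of the right leg in the base -/
  base : p.obj z ⟶ p.obj x
  apex : E
  left : x ⟶ apex
  right : z ⟶ apex
  left_fiberwise : p.IsHomLift (𝟙 (p.obj x)) left
  right_cocartesian : p.IsCocartesian base right

attribute [instance] Cospan.left_fiberwise Cospan.right_cocartesian

/-- Isomorphism of cospans. -/
def Cospan.Rel {p : E ⥤ C} {x z : E} (s t : Cospan p x z) : Prop :=
  ∃ e : s.apex ≅ t.apex, s.left ≫ e.hom = t.left ∧ s.right ≫ e.hom = t.right

instance Cospan.setoid (p : E ⥤ C) (x z : E) : Setoid (Cospan p x z) where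
  r := Cospan.Rel
  iseqv :=
    { refl := fun s => ⟨Iso.refl _, by simp, by simp⟩
      symm := by
        rintro s t ⟨e, h₁, h₂⟩
        exact ⟨e.symm, by simp [← h₁], by simp [← h₂]⟩
      trans := by
        rintro s t r ⟨e, h₁, h₂⟩ ⟨e', h₁', h₂'⟩
        exact ⟨e ≪≫ e', by simp [← h₁', ← h₁], by simp [← h₂', ← h₂]⟩ }

theorem isHomLift_id_of_comp (p : E ⥤ C) {R : C} {x y z : E} (f : x ⟶ y) (e : y ⟶ z)
    [p.IsHomLift (𝟙 R) f] (h : p.IsHomLift (𝟙 R) (f ≫ e)) : p.IsHomLift (𝟙 R) e := by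
  have h1 := IsHomLift.fac' p (𝟙 R) (f ≫ e)
  have h2 := IsHomLift.fac' p (𝟙 R) f
  rw [p.map_comp, h2] at h1
  refine IsHomLift.of_fac' p _ _ (IsHomLift.codomain_eq p (𝟙 R) f)
    (IsHomLift.codomain_eq p (𝟙 R) (f ≫ e)) ?_
  simp only [Category.id_comp, eqToHom_trans] at h1 ⊢
  rw [← cancel_epi (eqToHom ((IsHomLift.domain_eq p (𝟙 R) f).trans
    (IsHomLift.codomain_eq p (𝟙 R) f).symm)), h1]
  simp

theorem Cospan.Rel.apex_lift {p : E ⥤ C} {x z : E} {s t : Cospan p x z}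
    (e : s.apex ⟶ t.apex) (h : s.left ≫ e = t.left) : p.IsHomLift (𝟙 (p.obj x)) e :=
  isHomLift_id_of_comp p s.left e (h ▸ inferInstance)

theorem Cospan.Rel.base_eq {p : E ⥤ C} {x z : E} {s t : Cospan p x z} (h : s.Rel t) :
    s.base = t.base := by
  obtain ⟨e, h₁, h₂⟩ := h
  have := Cospan.Rel.apex_lift e.hom h₁
  have h3 : p.IsHomLift s.base t.right := h₂ ▸ inferInstance
  rw [IsHomLift.fac p s.base t.right, IsHomLift.fac p t.base t.right]

/-- Cospans over the same base map are isomorphic as soon as there is a map between them. -/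
theorem Cospan.rel_of_hom {p : E ⥤ C} {x z : E} {s t : Cospan p x z} (hb : s.base = t.base)
    (e : s.apex ⟶ t.apex) (h₁ : s.left ≫ e = t.left) (h₂ : s.right ≫ e = t.right) : s.Rel t := by
  have he := Cospan.Rel.apex_lift e h₁
  have : p.IsCocartesian s.base t.right := hb ▸ inferInstance
  have h : e = (Functor.IsCocartesian.codomainUniqueUpToIso p s.base s.right t.right).hom :=
    Functor.IsCocartesian.map_uniq p s.base s.right t.right e h₂
  exact ⟨Functor.IsCocartesian.codomainUniqueUpToIso p s.base s.right t.right,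
    by rw [← h, h₁], by rw [← h, h₂]⟩

/-- The total category of the transpose fibration of `p`: it has the objects of `E`. -/
structure Transpose (p : E ⥤ C) where
  obj : E

namespace Transpose

variable {p : E ⥤ C}

/-- A morphism `x ⟶ z` of the transpose is an isomorphism class of cospans. -/
def Hom (x z : Transpose p) : Type (max u v v₁) := Quotient (Cospan.setoid p x.obj z.obj)

/-- The image in `C` of a morphism `x ⟶ z` of the transpose. -/
def Hom.base {x z : Transpose p} (φ : Hom x z) : p.obj z.obj ⟶ p.obj x.obj :=
  Quotient.lift (fun s : Cospan p x.obj z.obj => s.base) (fun _ _ h => Cospan.Rel.base_eq h) φ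

/-- The identity cospan. -/
def idCospan (p : E ⥤ C) (x : E) : Cospan p x x where
  base := 𝟙 _
  apex := x
  left := 𝟙 x
  right := 𝟙 x
  left_fiberwise := inferInstance
  right_cocartesian := inferInstance

/-- A completion of two composable cospans `x ⟶ y ⟵ z` and `z ⟶ w ⟵ v`
by an opCartesian map `w ⟶ apex` and a fibrewise map `y ⟶ apex`. -/
structure Completion {x z v : E} (s : Cospan p x z) (t : Cospan p z v) where
  apex : E
  push : t.apex ⟶ apex
  fill : s.apex ⟶ apex
  push_cocartesian : p.IsCocartesian s.base push
  fill_fiberwise : p.IsHomLift (𝟙 (p.obj x)) fill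
  comm : s.right ≫ fill = t.left ≫ push

attribute [instance] Completion.push_cocartesian Completion.fill_fiberwise

variable [IsOpfibration p]

instance {x z v : E} (s : Cospan p x z) (t : Cospan p z v) : Nonempty (Completion s t) := by
  obtain ⟨b, φ, hφ⟩ := IsOpfibration.exists_lift p
    (IsHomLift.codomain_eq p (𝟙 (p.obj z)) t.left) s.base
  exact ⟨{ apex := b, push := φ, push_cocartesian := hφ
           fill := Functor.IsCocartesian.map p s.base s.right (t.left ≫ φ)
           fill_fiberwise := inferInstance
           comm := Functor.IsCocartesian.fac _ _ _ _ }⟩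

/-- The composite cospan obtained from a completion. -/
def Completion.cospan {x z v : E} {s : Cospan p x z} {t : Cospan p z v} (k : Completion s t) :
    Cospan p x v where
  base := t.base ≫ s.base
  apex := k.apex
  left := s.left ≫ k.fill
  right := t.right ≫ k.push
  left_fiberwise := inferInstance
  right_cocartesian := inferInstance

theorem Completion.rel {x z v : E} {s s' : Cospan p x z} {t t' : Cospan p z v} (hs : s.Rel s')
    (ht : t.Rel t') (k : Completion s t) (k' : Completion s' t') : k.cospan.Rel k'.cospan := by
  have hsb := hs.base_eq
  have htb := ht.base_eq
  obtain ⟨e, he₁, he₂⟩ := hs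
  obtain ⟨d, hd₁, hd₂⟩ := ht
  have hd := Cospan.Rel.apex_lift d.hom hd₁
  have he := Cospan.Rel.apex_lift e.hom he₁
  have h1 : p.IsHomLift s.base (d.hom ≫ k'.push) := by rw [hsb]; infer_instance
  let g : k.apex ⟶ k'.apex := Functor.IsCocartesian.map p s.base k.push (d.hom ≫ k'.push)
  have hg : k.push ≫ g = d.hom ≫ k'.push := Functor.IsCocartesian.fac _ _ _ _
  have hg' : k.fill ≫ g = e.hom ≫ k'.fill := by
    apply Functor.IsCocartesian.ext p s.base s.right
    rw [← Category.assoc, k.comm, Category.assoc, hg, reassoc_of% hd₁, reassoc_of% he₂, k'.comm]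
  refine Cospan.rel_of_hom (by simp [cospan, hsb, htb]) g ?_ ?_
  · simp [cospan, hg', reassoc_of% he₁]
  · simp [cospan, hg, reassoc_of% hd₂]

/-- Composition in the transpose. -/
noncomputable def Hom.comp {x z v : Transpose p} (φ : Hom x z) (ψ : Hom z v) : Hom x v :=
  Quotient.lift₂ (fun s t => Quotient.mk _ (Classical.arbitrary (Completion s t)).cospan)
    (fun _ _ _ _ hs ht => Quotient.sound (Completion.rel hs ht _ _)) φ ψ

theorem Hom.comp_mk {x z v : Transpose p} {s : Cospan p x.obj z.obj} {t : Cospan p z.obj v.obj}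
    (k : Completion s t) :
    Hom.comp (Quotient.mk _ s : Hom x z) (Quotient.mk _ t : Hom z v) = Quotient.mk _ k.cospan :=
  Quotient.sound (Completion.rel (Setoid.refl s) (Setoid.refl t) _ _)

noncomputable instance : Category.{max u v v₁} (Transpose p) where
  Hom := Hom
  id x := Quotient.mk _ (idCospan p x.obj)
  comp := Hom.comp
  id_comp {x z} φ := by
    induction φ using Quotient.inductionOn with
    | h t =>
      rw [Hom.comp_mk (s := idCospan p x.obj) (t := t)
        { apex := t.apex, push := 𝟙 _, fill := t.left
          push_cocartesian := by
            have : p.IsHomLift (𝟙 (p.obj x.obj)) (𝟙 t.apex) :=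
              IsHomLift.id (IsHomLift.codomain_eq p (𝟙 (p.obj x.obj)) t.left)
            exact inferInstanceAs (p.IsCocartesian (𝟙 (p.obj x.obj)) (𝟙 t.apex))
          fill_fiberwise := t.left_fiberwise
          comm := by simp [idCospan] }]
      exact Quotient.sound (Cospan.rel_of_hom (by simp [Completion.cospan, idCospan]) (𝟙 _)
        (by simp [Completion.cospan, idCospan]) (by simp [Completion.cospan, idCospan]))
  comp_id {x z} φ := by
    induction φ using Quotient.inductionOn with
    | h s =>
      rw [Hom.comp_mk (s := s) (t := idCospan p z.obj)
        { apex := s.apex, push := s.right, fill := 𝟙 _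
          push_cocartesian := s.right_cocartesian
          fill_fiberwise := IsHomLift.id (IsHomLift.codomain_eq p (𝟙 (p.obj x.obj)) s.left)
          comm := by simp [idCospan] }]
      exact Quotient.sound (Cospan.rel_of_hom (by simp [Completion.cospan, idCospan]) (𝟙 _)
        (by simp [Completion.cospan, idCospan]) (by simp [Completion.cospan, idCospan]))
  assoc {x y z v} φ ψ χ := by
    induction φ using Quotient.inductionOn with | h s => ?_
    induction ψ using Quotient.inductionOn with | h t => ?_
    induction χ using Quotient.inductionOn with | h r => ?_
    let k : Completion s t := Classical.arbitrary _
    let l : Completion t r := Classical.arbitrary _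
    obtain ⟨b, π, hπ⟩ := IsOpfibration.exists_lift p
      (IsHomLift.codomain_eq p (𝟙 (p.obj y.obj)) l.fill) s.base
    have h0 : p.IsHomLift s.base (l.fill ≫ π) := inferInstance
    let κ : k.apex ⟶ b := Functor.IsCocartesian.map p s.base k.push (l.fill ≫ π)
    have hκ : k.push ≫ κ = l.fill ≫ π := Functor.IsCocartesian.fac _ _ _ _
    let m₁ : Completion k.cospan r :=
      { apex := b, push := l.push ≫ π, fill := κ
        push_cocartesian := inferInstanceAs (p.IsCocartesian (t.base ≫ s.base) (l.push ≫ π))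
        fill_fiberwise := inferInstanceAs (p.IsHomLift (𝟙 (p.obj x.obj)) κ)
        comm := by
          simp only [Completion.cospan, Category.assoc, hκ]
          rw [← Category.assoc, l.comm, Category.assoc] }
    let m₂ : Completion s l.cospan :=
      { apex := b, push := π, fill := k.fill ≫ κ
        push_cocartesian := hπ
        fill_fiberwise := inferInstance
        comm := by
          simp only [Completion.cospan, Category.assoc]
          rw [← Category.assoc, k.comm, Category.assoc, hκ] }
    rw [Hom.comp_mk k, Hom.comp_mk l]
    refine (Hom.comp_mk m₁).trans (Eq.trans ?_ (Hom.comp_mk m₂).symm)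
    exact Quotient.sound (Cospan.rel_of_hom (by simp [Completion.cospan]) (𝟙 _)
      (by simp [Completion.cospan, m₁, m₂]) (by simp [Completion.cospan, m₁, m₂]))

/-- The morphism of the transpose represented by a cospan. -/
def homMk {x z : Transpose p} (s : Cospan p x.obj z.obj) : x ⟶ z := Quotient.mk _ s

theorem homMk_comp {x z v : Transpose p} {s : Cospan p x.obj z.obj} {t : Cospan p z.obj v.obj}
    (k : Completion s t) : (homMk s : x ⟶ z) ≫ (homMk t : z ⟶ v) = homMk k.cospan :=
  Hom.comp_mk k

theorem exists_homMk {x z : Transpose p} (φ : x ⟶ z) : ∃ s, φ = homMk s :=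
  ⟨Quotient.out φ, (Quotient.out_eq φ).symm⟩

theorem homMk_eq {x z : Transpose p} {s t : Cospan p x.obj z.obj} (hb : s.base = t.base)
    (e : s.apex ⟶ t.apex) (h₁ : s.left ≫ e = t.left) (h₂ : s.right ≫ e = t.right) :
    (homMk s : x ⟶ z) = homMk t :=
  Quotient.sound (Cospan.rel_of_hom hb e h₁ h₂)

variable (p) in
/-- The transpose fibration `Transpose p ⥤ Cᵒᵖ`. -/
noncomputable def proj : Transpose p ⥤ Cᵒᵖ where
  obj x := op (p.obj x.obj)
  map φ := (Hom.base φ).op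
  map_id _ := rfl
  map_comp {x y z} φ ψ := by
    obtain ⟨s, rfl⟩ := exists_homMk φ
    obtain ⟨t, rfl⟩ := exists_homMk ψ
    rw [homMk_comp (Classical.arbitrary (Completion s t))]
    rfl

@[simp] theorem proj_obj (x : Transpose p) : (proj p).obj x = op (p.obj x.obj) := rfl

@[simp] theorem proj_map_homMk {x z : Transpose p} (s : Cospan p x.obj z.obj) :
    (proj p).map (homMk s : x ⟶ z) = s.base.op := rfl

/-- The cospan `y = y ⟵ a` given by an opCartesian morphism `a ⟶ y`. -/
def cartCospan {a y : E} (φ : a ⟶ y) (hφ : p.IsCocartesian (p.map φ) φ) : Cospan p y a where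
  base := p.map φ
  apex := y
  left := 𝟙 y
  right := φ
  left_fiberwise := inferInstance
  right_cocartesian := hφ

theorem isStronglyCartesian_cartCospan {a y : E} (φ : a ⟶ y)
    (hφ : p.IsCocartesian (p.map φ) φ) :
    (proj p).IsStronglyCartesian (p.map φ).op
      (homMk (cartCospan φ hφ) : (⟨y⟩ : Transpose p) ⟶ ⟨a⟩) where
  toIsHomLift := IsHomLift.map (proj p) (homMk (cartCospan φ hφ) : (⟨y⟩ : Transpose p) ⟶ ⟨a⟩)
  universal_property' {x} g φ' hφ' := by
    have hφs := IsOpfibration.isStronglyCocartesian p (p.map φ) φ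
    have key : ∀ r : Cospan p x.obj y,
        (homMk r : x ⟶ ⟨y⟩) ≫ (homMk (cartCospan φ hφ) : (⟨y⟩ : Transpose p) ⟶ ⟨a⟩) =
        homMk { base := p.map φ ≫ r.base, apex := r.apex, left := r.left, right := φ ≫ r.right
                left_fiberwise := inferInstance, right_cocartesian := inferInstance } := by
      intro r
      rw [homMk_comp (s := r) (t := cartCospan φ hφ)
        { apex := r.apex, push := r.right, fill := 𝟙 _
          push_cocartesian := r.right_cocartesian
          fill_fiberwise := IsHomLift.id (IsHomLift.codomain_eq p (𝟙 (p.obj x.obj)) r.left)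
          comm := by simp [cartCospan] }]
      exact homMk_eq rfl (𝟙 _) (by simp [Completion.cospan]) (by
        simp [Completion.cospan, cartCospan])
    obtain ⟨s, rfl⟩ := exists_homMk φ'
    have hs : p.map φ ≫ g.unop = s.base :=
      congrArg Quiver.Hom.unop (@IsHomLift.eq_of_isHomLift _ _ _ _ (proj p) _ _ _ _ hφ')
    have hsl : p.IsCocartesian (p.map φ ≫ g.unop) s.right := hs ▸ s.right_cocartesian
    have hss := IsOpfibration.isStronglyCocartesian p (p.map φ ≫ g.unop) s.right
    let ψ : y ⟶ s.apex :=
      Functor.IsStronglyCocartesian.map p (p.map φ) φ (g := g.unop) rfl s.right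
    have hψ : φ ≫ ψ = s.right := Functor.IsStronglyCocartesian.fac _ _ _ _ _
    have hψs : p.IsStronglyCocartesian g.unop ψ := by
      have : p.IsStronglyCocartesian (p.map φ ≫ g.unop) (φ ≫ ψ) := hψ.symm ▸ hss
      exact Functor.IsStronglyCocartesian.of_comp p (f := p.map φ) (φ := φ)
    let r : Cospan p x.obj y :=
      { base := g.unop, apex := s.apex, left := s.left, right := ψ
        left_fiberwise := inferInstance
        right_cocartesian :=
          @Functor.IsStronglyCocartesian.isCocartesian_of_isStronglyCocartesian
            _ _ _ _ p _ _ _ _ g.unop ψ hψs }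
    refine ⟨homMk r, ⟨IsHomLift.map (proj p) (homMk r : x ⟶ ⟨y⟩), ?_⟩, ?_⟩
    · refine (key r).trans (homMk_eq hs (𝟙 _) ?_ ?_)
      · simp [r]
      · simp [r, hψ]
    · rintro χ ⟨h₁, h₂⟩
      obtain ⟨t, rfl⟩ := exists_homMk χ
      have ht : g.unop = t.base :=
        congrArg Quiver.Hom.unop (@IsHomLift.eq_of_isHomLift _ _ _ _ (proj p) _ _ _ _ h₁)
      rw [key t] at h₂
      obtain ⟨e, he₁, he₂⟩ := Quotient.exact h₂
      have hel := Cospan.Rel.apex_lift e.hom he₁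
      refine homMk_eq ht.symm e.hom he₁ ?_
      have htl : p.IsHomLift g.unop (t.right ≫ e.hom) := by
        rw [ht]
        exact IsHomLift.comp_lift_id_right p t.base t.right e.hom
      refine Functor.IsStronglyCocartesian.ext p (p.map φ) φ g.unop ?_
      rw [← Category.assoc]
      exact he₂.trans hψ.symm

instance : (proj p).IsFibered :=
  Functor.IsFibered.of_exists_isStronglyCartesian (by
    rintro a ⟨R⟩ f
    obtain ⟨y, φ, hφ⟩ := IsOpfibration.exists_isCocartesian (p := p) (a := a.obj) f.unop
    have hl := hφ.toIsHomLift
    obtain rfl : p.obj y = R := @IsHomLift.codomain_eq _ _ _ _ p _ _ _ _ f.unop φ hl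
    obtain rfl : f = (p.map φ).op :=
      congrArg Quiver.Hom.op (@IsHomLift.eq_of_isHomLift _ _ _ _ p _ _ _ _ hl)
    exact ⟨⟨y⟩, _, isStronglyCartesian_cartCospan φ hφ⟩)

/-- A fibrewise morphism of `E`, as a fibrewise morphism of the transpose: `x ⟶ z = z`. -/
def ofFiberwise {x z : E} (f : x ⟶ z) (hf : p.IsHomLift (𝟙 (p.obj x)) f) :
    (⟨x⟩ : Transpose p) ⟶ ⟨z⟩ :=
  homMk
    { base := eqToHom (IsHomLift.codomain_eq p (𝟙 (p.obj x)) f)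
      apex := z
      left := f
      right := 𝟙 z
      left_fiberwise := hf
      right_cocartesian := by
        have := IsHomLift.id_lift_eqToHom_domain (p := p)
          (IsHomLift.codomain_eq p (𝟙 (p.obj x)) f) (a := z) rfl
        infer_instance }

end Transpose
end Transpose

section SimplicialSets

open MonoidalCategory in
/-- There is a simplicial homotopy `X × Δ[1] ⟶ K` from `f` to `g`. -/
def SimplicialHomotopic {X K : SSet.{w}} (f g : X ⟶ K) : Prop :=
  ∃ H : X ⊗ Δ[1] ⟶ K, SSet.ι₀ ≫ H = f ∧ SSet.ι₁ ≫ H = g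

/-- Homotopy classes of maps: two maps of simplicial sets are identified if they are connected
by a zigzag of simplicial homotopies. -/
def HomotopyClasses (X K : SSet.{w}) : Type w :=
  Quot (SimplicialHomotopic (X := X) (K := K))

open MonoidalCategory in
/-- The action of a map `f : X ⟶ Y` on homotopy classes of maps into `K`. -/
def HomotopyClasses.precomp {X Y : SSet.{w}} (f : X ⟶ Y) (K : SSet.{w}) :
    HomotopyClasses Y K → HomotopyClasses X K :=
  Quot.map (fun g => f ≫ g) (by
    rintro g g' ⟨H, rfl, rfl⟩
    exact ⟨f ▷ _ ≫ H, by simp, by simp⟩)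

/-- A map of simplicial sets is a weak homotopy equivalence if it induces a bijection on
homotopy classes of maps into every Kan complex. -/
def IsWeakHomotopyEquivalence {X Y : SSet.{w}} (f : X ⟶ Y) : Prop :=
  ∀ (K : SSet.{w}) [SSet.KanComplex K], Function.Bijective (HomotopyClasses.precomp f K)

/-- A simplicial set is contractible if the map to the point is a weak homotopy equivalence. -/
def IsContractible (X : SSet.{w}) : Prop :=
  IsWeakHomotopyEquivalence (terminal.from X)

end SimplicialSets

section DeltaStructure

variable {M : Type u} [Category.{v} M]

/-- A `Δ`-structure: a functor `⊗ : Δ × M ⥤ M`, with a natural diagonal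
`Δ^n ⊗ x ⟶ Δ^n ⊗ (Δ^n ⊗ x)` and a natural isomorphism `Δ^0 ⊗ x ≅ x`,
satisfying coassociativity and counitality. -/
structure DeltaStructure (M : Type u) [Category.{v} M] where
  tensor : SimplexCategory ⥤ M ⥤ M
  diag (n : SimplexCategory) : tensor.obj n ⟶ tensor.obj n ⋙ tensor.obj n
  diag_naturality {m n : SimplexCategory} (a : m ⟶ n) :
    tensor.map a ≫ diag n = diag m ≫ (tensor.map a ◫ tensor.map a)
  unit : tensor.obj ⦋0⦌ ≅ 𝟭 M
  coassoc (n : SimplexCategory) (x : M) :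
    (diag n).app x ≫ (diag n).app ((tensor.obj n).obj x) =
      (diag n).app x ≫ (tensor.obj n).map ((diag n).app x)
  counit_left (n : SimplexCategory) (x : M) :
    (diag n).app x ≫ (tensor.map (SimplexCategory.const n ⦋0⦌ 0)).app ((tensor.obj n).obj x) ≫
      unit.hom.app ((tensor.obj n).obj x) = 𝟙 _
  counit_right (n : SimplexCategory) (x : M) :
    (diag n).app x ≫ (tensor.obj n).map
      ((tensor.map (SimplexCategory.const n ⦋0⦌ 0)).app x ≫ unit.hom.app x) = 𝟙 _

/-- The Yoneda functor `[n] ↦ Δ^n`. -/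
abbrev simplex : SimplexCategory ⥤ SSet.{w} := SSet.stdSimplex

/-- The two-out-of-six property. -/
def TwoOutOfSix (W : MorphismProperty M) : Prop :=
  ∀ ⦃a b c d : M⦄ (f : a ⟶ b) (g : b ⟶ c) (h : c ⟶ d), W (f ≫ g) → W (g ≫ h) →
    W f ∧ W g ∧ W h ∧ W (f ≫ g ≫ h)

theorem hasColimitsOfShape_of_small [HasColimitsOfSize.{w, w} M] (J : Type w)
    [Category.{0} J] : HasColimitsOfShape J M :=
  have : HasColimitsOfSize.{0, w} M := hasColimitsOfSizeOfUnivLE.{w, w} M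
  inferInstance

theorem hasColimitsOfShape_of_small₀ [HasColimitsOfSize.{w, w} M] (J : Type)
    [Category.{0} J] : HasColimitsOfShape J M :=
  have : HasColimitsOfSize.{0, 0} M := hasColimitsOfSizeOfUnivLE.{w, w} M
  inferInstance

namespace DeltaStructure

variable (D : DeltaStructure M)

/-- The diagram of the `Δ^n ⊗ x` over the simplices of `S`. -/
abbrev simplexDiagram (S : SSet.{w}) (x : M) :
    CostructuredArrow simplex.{w} S ⥤ M :=
  CostructuredArrow.proj simplex S ⋙ D.tensor.flip.obj x

section

variable [HasColimitsOfSize.{w, w} M]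

instance (S : SSet.{w}) (x : M) : HasColimit (D.simplexDiagram S x) :=
  have := hasColimitsOfShape_of_small.{w} (M := M) (CostructuredArrow simplex.{w} S)
  inferInstance

/-- `S ⊗ x`, the colimit of the `Δ^n ⊗ x` over the simplices `Δ^n ⟶ S` of `S`. -/
noncomputable def tensorSSet (S : SSet.{w}) (x : M) : M := colimit (D.simplexDiagram S x)

/-- The map `Δ^n ⊗ x ⟶ S ⊗ x` given by a simplex of `S`. -/
noncomputable def tensorι {S : SSet.{w}} {n : SimplexCategory} (s : simplex.obj n ⟶ S)
    (x : M) : (D.tensor.obj n).obj x ⟶ D.tensorSSet S x :=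
  colimit.ι (D.simplexDiagram S x) (CostructuredArrow.mk s)

theorem tensorι_naturality {S : SSet.{w}} {m n : SimplexCategory} (a : m ⟶ n)
    (s : simplex.obj n ⟶ S) (x : M) :
    (D.tensor.map a).app x ≫ D.tensorι s x = D.tensorι (simplex.map a ≫ s) x :=
  colimit.w (D.simplexDiagram S x)
    (CostructuredArrow.homMk a rfl :
      CostructuredArrow.mk (simplex.map a ≫ s) ⟶ CostructuredArrow.mk s)

/-- The universal property of `S ⊗ x`. -/
noncomputable def tensorDesc {S : SSet.{w}} {x y : M}
    (φ : ∀ (n : SimplexCategory) (_ : simplex.obj n ⟶ S), (D.tensor.obj n).obj x ⟶ y)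
    (hφ : ∀ {m n : SimplexCategory} (a : m ⟶ n) (s : simplex.obj n ⟶ S),
      (D.tensor.map a).app x ≫ φ n s = φ m (simplex.map a ≫ s)) :
    D.tensorSSet S x ⟶ y :=
  colimit.desc (D.simplexDiagram S x)
    { pt := y
      ι :=
        { app := fun j => φ j.left j.hom
          naturality := by
            intro i j f
            have h := hφ f.left j.hom
            rw [CostructuredArrow.w f] at h
            exact h.trans (Category.comp_id _).symm } }

/-- Functoriality of `S ⊗ x` in `S`. -/
noncomputable def tensorSSetMap {S T : SSet.{w}} (f : S ⟶ T) (x : M) :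
    D.tensorSSet S x ⟶ D.tensorSSet T x :=
  D.tensorDesc (fun _ s => D.tensorι (s ≫ f) x) (fun a s => by
    rw [tensorι_naturality, Category.assoc])

/-- Functoriality of `S ⊗ x` in `x`. -/
noncomputable def tensorSSetMapRight (S : SSet.{w}) {x y : M} (f : x ⟶ y) :
    D.tensorSSet S x ⟶ D.tensorSSet S y :=
  D.tensorDesc (fun n s => (D.tensor.obj n).map f ≫ D.tensorι s y) (fun a s => by
    rw [← D.tensorι_naturality a s, ← Category.assoc, ← Category.assoc, NatTrans.naturality])

open MonoidalCategory CartesianMonoidalCategory in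
/-- The action map `(S × T) ⊗ x ⟶ S ⊗ (T ⊗ x)`; on the simplex `(s, t)` it is the diagonal
`Δ^n ⊗ x ⟶ Δ^n ⊗ (Δ^n ⊗ x)` followed by the maps given by `s` and `t`. -/
noncomputable def actionMap (S T : SSet.{w}) (x : M) :
    D.tensorSSet (S ⊗ T) x ⟶ D.tensorSSet S (D.tensorSSet T x) :=
  D.tensorDesc (fun n s => (D.diag n).app x ≫
      (D.tensor.obj n).map (D.tensorι (s ≫ snd S T) x) ≫
        D.tensorι (s ≫ fst S T) (D.tensorSSet T x)) (by
    intro m n a s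
    have h := congrArg (fun t => t.app x) (D.diag_naturality a)
    simp only [NatTrans.comp_app, NatTrans.hcomp_app] at h
    rw [reassoc_of% h]
    simp only [Category.assoc]
    congr 1
    rw [← D.tensorι_naturality a (s ≫ fst S T), ← D.tensorι_naturality a (s ≫ snd S T)]
    simp only [Functor.map_comp, Category.assoc, NatTrans.naturality_assoc])

end

/-- The integrand `Δ^• ⊗ X` of the geometric realisation of `X`. -/
abbrev integrand (X : SimplexCategoryᵒᵖ ⥤ M) : SimplexCategoryᵒᵖᵒᵖ ⥤ SimplexCategoryᵒᵖ ⥤ M :=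
  unopUnop SimplexCategory ⋙ D.tensor ⋙ (Functor.whiskeringLeft _ _ _).obj X

/-- The integrand `Δ^• ⊗ (Δ^• ⊗ X)` for a bisimplicial object `X`. -/
def biIntegrand (X : SimplexCategoryᵒᵖ × SimplexCategoryᵒᵖ ⥤ M) :
    (SimplexCategoryᵒᵖ × SimplexCategoryᵒᵖ)ᵒᵖ ⥤ SimplexCategoryᵒᵖ × SimplexCategoryᵒᵖ ⥤ M where
  obj k := X ⋙ D.tensor.obj k.unop.2.unop ⋙ D.tensor.obj k.unop.1.unop
  map a := Functor.whiskerLeft X (D.tensor.map a.unop.2.unop ◫ D.tensor.map a.unop.1.unop)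
  map_id k := by ext; simp
  map_comp a b := by ext; simp

section

variable [HasColimitsOfSize.{w, w} M]

theorem hasCoend_of_small {J : Type} [SmallCategory J] (G : Jᵒᵖ ⥤ J ⥤ M) : HasCoend G := by
  have : HasColimitsOfShape (WalkingMultispan (multispanShapeCoend J)) M :=
    hasColimitsOfShape_of_small₀.{w} _
  unfold HasCoend HasMulticoequalizer
  infer_instance

instance (X : SimplexCategoryᵒᵖ ⥤ M) : HasCoend (D.integrand X) := hasCoend_of_small.{w} _

instance (X : SimplexCategoryᵒᵖ × SimplexCategoryᵒᵖ ⥤ M) : HasCoend (D.biIntegrand X) :=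
  hasCoend_of_small.{w} _

end

section

variable [∀ X : SimplexCategoryᵒᵖ ⥤ M, HasCoend (D.integrand X)]

/-- The geometric realisation `|X|`, the coend of `Δ^• ⊗ X`. -/
noncomputable def realization (X : SimplexCategoryᵒᵖ ⥤ M) : M := coend (D.integrand X)

/-- Functoriality of the integrand. -/
abbrev integrandMap {X Y : SimplexCategoryᵒᵖ ⥤ M} (f : X ⟶ Y) : D.integrand X ⟶ D.integrand Y :=
  Functor.whiskerLeft (unopUnop SimplexCategory)
    (Functor.whiskerLeft D.tensor ((Functor.whiskeringLeft _ _ _).map f))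

/-- Functoriality of the geometric realisation. -/
noncomputable def realizationMap {X Y : SimplexCategoryᵒᵖ ⥤ M} (f : X ⟶ Y) :
    D.realization X ⟶ D.realization Y :=
  coend.map (D.integrandMap f)

theorem ι_realizationMap {X Y : SimplexCategoryᵒᵖ ⥤ M} (f : X ⟶ Y) (n : SimplexCategoryᵒᵖ) :
    coend.ι (D.integrand X) n ≫ D.realizationMap f =
      (D.tensor.obj n.unop).map (f.app n) ≫ coend.ι (D.integrand Y) n :=
  coend.ι_map (D.integrandMap f) n

/-- The comparison of the realisation of the diagonal of a bisimplicial object `X` with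
`∫ Δ^• ⊗ (Δ^• ⊗ X)`, induced by the diagonals `Δ^n ⊗ X_{nn} ⟶ Δ^n ⊗ (Δ^n ⊗ X_{nn})`. -/
noncomputable def diagonalComparison (X : SimplexCategoryᵒᵖ × SimplexCategoryᵒᵖ ⥤ M)
    [HasCoend (D.biIntegrand X)] :
    D.realization (Functor.diag SimplexCategoryᵒᵖ ⋙ X) ⟶ coend (D.biIntegrand X) :=
  coend.desc
    (fun j => (D.diag j.unop).app (X.obj (j, j)) ≫ coend.ι (D.biIntegrand X) (j, j)) (by
    intro i j g
    have h := congrArg (fun t => t.app (X.obj (i, i))) (D.diag_naturality g.unop)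
    have h' := coend.condition (D.biIntegrand X) (i := (i, i)) (j := (j, j)) (g, g)
    simp only [NatTrans.comp_app] at h
    have h'' := (D.diag j.unop).naturality (X.map ((g, g) : (i, i) ⟶ (j, j)))
    change (D.tensor.map g.unop).app (X.obj (i, i)) ≫ _ =
      (D.tensor.obj j.unop).map (X.map ((g, g) : (i, i) ⟶ (j, j))) ≫ _
    erw [reassoc_of% h, reassoc_of% h'']
    exact congrArg (fun t => (D.diag j.unop).app (X.obj (i, i)) ≫ t) h')

end

/-- The conditions making a category with weak equivalences `W` and a `Δ`-structure into a
homotopical `Δ`-category, relative to the universe `w` of small sets. -/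
structure IsHomotopical (W : MorphismProperty M) [HasColimitsOfSize.{w, w} M] : Prop where
  of_isIso {x y : M} (f : x ⟶ y) [IsIso f] : W f
  twoOutOfThree : W.HasTwoOutOfThreeProperty
  twoOutOfSix : TwoOutOfSix W
  preservesColimits (n : SimplexCategory) : PreservesColimitsOfSize.{w, w} (D.tensor.obj n)
  coproduct {J : Type w} (x y : J → M) (f : ∀ j, x j ⟶ y j) (hf : ∀ j, W (f j)) :
    W (Limits.Sigma.map f)
  tensor_right (S : SSet.{w}) {x y : M} (f : x ⟶ y) (hf : W f) : W (D.tensorSSetMapRight S f)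
  tensor_left {S T : SSet.{w}} (f : S ⟶ T) (hf : IsWeakHomotopyEquivalence f) (x : M) :
    W (D.tensorSSetMap f x)
  actionMap (S T : SSet.{w}) (x : M) : W (D.actionMap S T x)
  realization {X Y : SimplexCategoryᵒᵖ ⥤ M} (f : X ⟶ Y) (hf : ∀ n, W (f.app n)) :
    W (D.realizationMap f)
  diagonal (X : SimplexCategoryᵒᵖ × SimplexCategoryᵒᵖ ⥤ M) : W (D.diagonalComparison X)

end DeltaStructure

end DeltaStructure

section Fibrations

variable {B : Type u₁} [Category.{v₁} B] {F : Type u} [Category.{v} F]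

/-- A `Δ`-structure over the base of `q : F ⥤ B`: the functor `⊗ : Δ × F ⥤ F` commutes with the
projections to `B`, and the diagonal and the unit are fibrewise. (For a fibration `q` it follows
from naturality that the transition functors between the fibres, with the comparison maps induced
by `⊗`, are `Δ`-functors.) -/
structure DeltaStructure.IsOver (D : DeltaStructure F) (q : F ⥤ B) : Prop where
  tensor_comp (n : SimplexCategory) : D.tensor.obj n ⋙ q = q
  tensor_map {m n : SimplexCategory} (a : m ⟶ n) (x : F) :
    q.IsHomLift (𝟙 (q.obj x)) ((D.tensor.map a).app x)
  diag (n : SimplexCategory) (x : F) : q.IsHomLift (𝟙 (q.obj x)) ((D.diag n).app x)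
  unit (x : F) : q.IsHomLift (𝟙 (q.obj x)) (D.unit.hom.app x)

namespace DeltaStructure.IsOver

variable {D : DeltaStructure F} {q : F ⥤ B}

theorem tensor_obj (hD : D.IsOver q) (n : SimplexCategory) {b : B} {x : F} (hx : q.obj x = b) :
    q.obj ((D.tensor.obj n).obj x) = b :=
  (Functor.congr_obj (hD.tensor_comp n) x).trans hx

end DeltaStructure.IsOver

end Fibrations

section FiberDelta

variable {B : Type u₁} [Category.{v₁} B] {F : Type u} [Category.{v} F]
  {D : DeltaStructure F} {q : F ⥤ B}

theorem DeltaStructure.IsOver.tensor_isHomLift (hD : D.IsOver q) (n : SimplexCategory)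
    {b b' : B} (f : b ⟶ b') {x y : F} (φ : x ⟶ y) [hφ : q.IsHomLift f φ] :
    q.IsHomLift f ((D.tensor.obj n).map φ) := by
  have h : (D.tensor.obj n ⋙ q).IsHomLift f φ := (hD.tensor_comp n).symm ▸ hφ
  subst_hom_lift (D.tensor.obj n ⋙ q) f φ
  exact inferInstanceAs (q.IsHomLift (q.map ((D.tensor.obj n).map φ)) ((D.tensor.obj n).map φ))

theorem isHomLift_id_of_eq {q : F ⥤ B} {b : B} {x y : F} (hx : q.obj x = b) {φ : x ⟶ y}
    (h : q.IsHomLift (𝟙 (q.obj x)) φ) : q.IsHomLift (𝟙 b) φ := by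
  subst hx; exact h

/-- The functor `Δ^n ⊗ -` on the fibre over `b`. -/
def DeltaStructure.IsOver.fiberTensor (hD : D.IsOver q) (b : B) (n : SimplexCategory) :
    Functor.Fiber q b ⥤ Functor.Fiber q b where
  obj a := ⟨(D.tensor.obj n).obj a.1, hD.tensor_obj n a.2⟩
  map φ := ⟨(D.tensor.obj n).map φ.1, have := φ.2; hD.tensor_isHomLift n (𝟙 b) φ.1⟩
  map_id a := Subtype.ext ((D.tensor.obj n).map_id a.1)
  map_comp φ ψ := Subtype.ext ((D.tensor.obj n).map_comp φ.1 ψ.1)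

/-- The `Δ`-structure induced on the fibre over `b`. -/
def DeltaStructure.IsOver.fiber (hD : D.IsOver q) (b : B) :
    DeltaStructure (Functor.Fiber q b) where
  tensor :=
    { obj n := hD.fiberTensor b n
      map a :=
        { app x := ⟨(D.tensor.map a).app x.1,
            isHomLift_id_of_eq (hD.tensor_obj _ x.2) (by
              have h := hD.tensor_map a x.1
              rwa [hD.tensor_obj _ rfl])⟩
          naturality x y φ := Subtype.ext ((D.tensor.map a).naturality φ.1) }
      map_id n := by
        ext x
        exact congrArg (fun t => t.app x.1) (D.tensor.map_id n)
      map_comp a a' := by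
        ext x
        exact congrArg (fun t => t.app x.1) (D.tensor.map_comp a a') }
  diag n :=
    { app x := ⟨(D.diag n).app x.1, isHomLift_id_of_eq (hD.tensor_obj _ x.2) (by
              have h := hD.diag n x.1
              rwa [hD.tensor_obj _ rfl])⟩
      naturality x y φ := Subtype.ext ((D.diag n).naturality φ.1) }
  diag_naturality a := by
    ext x
    exact congrArg (fun t => t.app x.1) (D.diag_naturality a)
  unit := NatIso.ofComponents (fun x =>
    { hom := ⟨D.unit.hom.app x.1, isHomLift_id_of_eq (hD.tensor_obj _ x.2) (by
              have h := hD.unit x.1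
              rwa [hD.tensor_obj _ rfl])⟩
      inv := ⟨D.unit.inv.app x.1, by
        have h : q.IsHomLift (𝟙 b) (D.unit.app x.1).hom :=
          isHomLift_id_of_eq (hD.tensor_obj _ x.2) (by
            have h := hD.unit x.1
            rwa [hD.tensor_obj _ rfl])
        exact IsHomLift.lift_id_inv q b (D.unit.app x.1)⟩
      hom_inv_id := Subtype.ext (D.unit.hom_inv_id_app x.1)
      inv_hom_id := Subtype.ext (D.unit.inv_hom_id_app x.1) })
    (fun φ => Subtype.ext (D.unit.hom.naturality φ.1))
  coassoc n x := Subtype.ext (D.coassoc n x.1)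
  counit_left n x := Subtype.ext (D.counit_left n x.1)
  counit_right n x := Subtype.ext (D.counit_right n x.1)

end FiberDelta

section FiberPullback

open Functor.IsPreFibered

variable {B : Type u₁} [Category.{v₁} B] {F : Type u} [Category.{v} F]
  {q : F ⥤ B} [q.IsFibered]

/-- The pullback of `z` along `f`, as an object of the fibre. -/
noncomputable abbrev pull {b s : B} {z : F} (hz : q.obj z = s) (f : b ⟶ s) :
    Functor.Fiber q b :=
  ⟨pullbackObj hz f, pullbackObj_proj hz f⟩

/-- The factorisation of a morphism over `f` through the chosen Cartesian morphism. -/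
noncomputable def toPull {b s : B} {z : F} (hz : q.obj z = s) (f : b ⟶ s)
    {x : Functor.Fiber q b} (φ : x.1 ⟶ z) (_ : q.IsHomLift f φ) : x ⟶ pull hz f :=
  ⟨Functor.IsCartesian.map q f (pullbackMap hz f) φ, inferInstance⟩

theorem toPull_fac {b s : B} {z : F} (hz : q.obj z = s) (f : b ⟶ s)
    {x : Functor.Fiber q b} (φ : x.1 ⟶ z) (hφ : q.IsHomLift f φ) :
    (toPull hz f φ hφ).1 ≫ pullbackMap hz f = φ :=
  Functor.IsCartesian.fac q f (pullbackMap hz f) φ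

theorem pull_hom_ext {b s : B} {z : F} (hz : q.obj z = s) (f : b ⟶ s)
    {x : Functor.Fiber q b} {φ ψ : x ⟶ pull hz f}
    (h : φ.1 ≫ pullbackMap hz f = ψ.1 ≫ pullbackMap hz f) : φ = ψ := by
  have := φ.2
  have := ψ.2
  exact Subtype.ext (Functor.IsCartesian.ext q f (pullbackMap hz f) φ.1 ψ.1 h)

/-- A morphism over `f` out of a coproduct in a fibre. -/
noncomputable def sigmaDesc {b s : B} {J : Type w} {x : J → Functor.Fiber q b} [HasCoproduct x]
    {z : F} (f : b ⟶ s) (hz : q.obj z = s) (φ : ∀ j, (x j).1 ⟶ z)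
    (hφ : ∀ j, q.IsHomLift f (φ j)) : (∐ x).1 ⟶ z :=
  (Limits.Sigma.desc fun j => toPull hz f (φ j) (hφ j)).1 ≫ pullbackMap hz f

section

variable {b s : B} {J : Type w} {x : J → Functor.Fiber q b} [HasCoproduct x]

instance sigmaDesc_isHomLift {z : F} (f : b ⟶ s) (hz : q.obj z = s) (φ : ∀ j, (x j).1 ⟶ z)
    (hφ : ∀ j, q.IsHomLift f (φ j)) : q.IsHomLift f (sigmaDesc f hz φ hφ) := by
  have := (Limits.Sigma.desc fun j => toPull hz f (φ j) (hφ j)).2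
  exact IsHomLift.comp_lift_id_left' q b _ f (pullbackMap hz f)

theorem ι_sigmaDesc {z : F} (f : b ⟶ s) (hz : q.obj z = s) (φ : ∀ j, (x j).1 ⟶ z)
    (hφ : ∀ j, q.IsHomLift f (φ j)) (j : J) :
    (Limits.Sigma.ι x j).1 ≫ sigmaDesc f hz φ hφ = φ j := by
  have h := congrArg Subtype.val
    (Limits.Sigma.ι_desc (fun j => toPull hz f (φ j) (hφ j)) j)
  rw [← toPull_fac hz f (φ j) (hφ j), ← h]
  exact (Category.assoc _ _ _).symm

theorem sigma_hom_ext_over {z : F} (f : b ⟶ s) {φ ψ : (∐ x).1 ⟶ z}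
    (hφ : q.IsHomLift f φ) (hψ : q.IsHomLift f ψ)
    (h : ∀ j, (Limits.Sigma.ι x j).1 ≫ φ = (Limits.Sigma.ι x j).1 ≫ ψ) : φ = ψ := by
  have hz := IsHomLift.codomain_eq q f φ
  rw [← toPull_fac hz f φ hφ, ← toPull_fac hz f ψ hψ]
  suffices toPull hz f φ hφ = toPull hz f ψ hψ by rw [this]
  apply Limits.Sigma.hom_ext
  intro j
  apply pull_hom_ext
  have := h j
  rw [← toPull_fac hz f φ hφ, ← toPull_fac hz f ψ hψ] at this
  exact (Category.assoc _ _ _).trans (this.trans (Category.assoc _ _ _).symm)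

end

section

variable {b s : B} {J : Type u₂} [Category.{v₂} J] {G : Jᵒᵖ ⥤ J ⥤ Functor.Fiber q b} [HasCoend G]

/-- A morphism over `f` out of a coend in a fibre. -/
noncomputable def coendDesc {z : F} (f : b ⟶ s) (hz : q.obj z = s)
    (φ : ∀ j, ((G.obj (op j)).obj j).1 ⟶ z) (hφ : ∀ j, q.IsHomLift f (φ j))
    (h : ∀ ⦃i j : J⦄ (g : i ⟶ j),
      ((G.map g.op).app i).1 ≫ φ i = ((G.obj (op j)).map g).1 ≫ φ j) : (coend G).1 ⟶ z :=
  (coend.desc (fun j => toPull hz f (φ j) (hφ j)) (by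
    intro i j g
    apply pull_hom_ext
    refine (Category.assoc _ _ _).trans (Eq.trans ?_ (Category.assoc _ _ _).symm)
    rw [toPull_fac, toPull_fac, h])).1 ≫ pullbackMap hz f

instance coendDesc_isHomLift {z : F} (f : b ⟶ s) (hz : q.obj z = s)
    (φ : ∀ j, ((G.obj (op j)).obj j).1 ⟶ z) (hφ : ∀ j, q.IsHomLift f (φ j))
    (h : ∀ ⦃i j : J⦄ (g : i ⟶ j),
      ((G.map g.op).app i).1 ≫ φ i = ((G.obj (op j)).map g).1 ≫ φ j) :
    q.IsHomLift f (coendDesc f hz φ hφ h) := by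
  unfold coendDesc
  generalize coend.desc (F := G) _ _ = χ
  have := χ.2
  exact IsHomLift.comp_lift_id_left' q b χ.1 f (pullbackMap hz f)

theorem ι_coendDesc {z : F} (f : b ⟶ s) (hz : q.obj z = s)
    (φ : ∀ j, ((G.obj (op j)).obj j).1 ⟶ z) (hφ : ∀ j, q.IsHomLift f (φ j))
    (h : ∀ ⦃i j : J⦄ (g : i ⟶ j),
      ((G.map g.op).app i).1 ≫ φ i = ((G.obj (op j)).map g).1 ≫ φ j) (j : J) :
    (coend.ι G j).1 ≫ coendDesc f hz φ hφ h = φ j := by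
  have e := congrArg Subtype.val
    (coend.ι_desc (F := G) (fun j => toPull hz f (φ j) (hφ j)) (by
      intro i j g
      apply pull_hom_ext
      refine (Category.assoc _ _ _).trans (Eq.trans ?_ (Category.assoc _ _ _).symm)
      rw [toPull_fac, toPull_fac, h]) j)
  rw [← toPull_fac hz f (φ j) (hφ j), ← e]
  exact (Category.assoc _ _ _).symm

theorem coend_hom_ext_over {z : F} (f : b ⟶ s) {φ ψ : (coend G).1 ⟶ z}
    (hφ : q.IsHomLift f φ) (hψ : q.IsHomLift f ψ)
    (h : ∀ j, (coend.ι G j).1 ≫ φ = (coend.ι G j).1 ≫ ψ) : φ = ψ := by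
  have hz := IsHomLift.codomain_eq q f φ
  rw [← toPull_fac hz f φ hφ, ← toPull_fac hz f ψ hψ]
  suffices toPull hz f φ hφ = toPull hz f ψ hψ by rw [this]
  apply coend.hom_ext
  intro j
  apply pull_hom_ext
  have := h j
  rw [← toPull_fac hz f φ hφ, ← toPull_fac hz f ψ hψ] at this
  exact (Category.assoc _ _ _).trans (this.trans (Category.assoc _ _ _).symm)

end

end FiberPullback

section HomotopicalOpfibrations

variable {C : Type u₁} [Category.{v₁} C] {E : Type u} [Category.{v} E]

/-- A homotopical structure on an opfibration `p`: a class `W` of fibrewise morphisms, containing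
the fibrewise isomorphisms, with the two-out-of-three property, and such that in a commutative
square with opCartesian rows `α`, `α'` and fibrewise columns `f`, `f'`, if `f` is in `W` then so
is `f'`. -/
structure HomotopicalStructure (p : E ⥤ C) where
  W : MorphismProperty E
  fiberwise {x y : E} (f : x ⟶ y) (hf : W f) : p.IsHomLift (𝟙 (p.obj x)) f
  of_isIso {x y : E} (f : x ⟶ y) [IsIso f] (hf : p.IsHomLift (𝟙 (p.obj x)) f) : W f
  twoOutOfThree : W.HasTwoOutOfThreeProperty
  pushforward {b c : C} (g : b ⟶ c) {x y x' y' : E} (α : x ⟶ y) (α' : x' ⟶ y')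
    (hα : p.IsCocartesian g α) (hα' : p.IsCocartesian g α') (f : x ⟶ x') (f' : y ⟶ y')
    (hf' : p.IsHomLift (𝟙 c) f') (comm : α ≫ f' = f ≫ α') (hf : W f) : W f'

/-- A class of fibrewise morphisms of `E`, viewed as a class of morphisms of the transpose. -/
def transposeW {p : E ⥤ C} [IsOpfibration p] (W : MorphismProperty E) :
    MorphismProperty (Transpose p) :=
  fun x z φ => ∃ (f : x.obj ⟶ z.obj) (hf : p.IsHomLift (𝟙 (p.obj x.obj)) f),
    W f ∧ φ = Transpose.ofFiberwise f hf

/-- A homotopical `Δ`-opfibration: an opfibration with a homotopical structure and a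
`Δ`-structure on its transpose fibration, such that the fibres (of the transpose, which are those
of `p`) are cocomplete and form homotopical `Δ`-categories. -/
structure HomotopicalDeltaOpfibration (p : E ⥤ C) [IsOpfibration p]
    extends HomotopicalStructure p where
  delta : DeltaStructure (Transpose p)
  isOver : delta.IsOver (Transpose.proj p)
  cocomplete (c : Cᵒᵖ) : HasColimitsOfSize.{w, w} (Functor.Fiber (Transpose.proj p) c)
  homotopical (c : Cᵒᵖ) : (isOver.fiber c).IsHomotopical.{w}
    ((transposeW W).inverseImage Functor.Fiber.fiberInclusion)

end HomotopicalOpfibrations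

section Sections

variable {B : Type u₁} [Category.{v₁} B] {F : Type u} [Category.{v} F]
  {K : Type u₂} [Category.{v₂} K] {L : Type u₃} [Category.{v₃} L]

/-- The sections over `K` of the pullback of `q : F ⥤ B` along `k : K ⥤ B`, i.e. the functors
`K ⥤ F` which lift `k`. -/
structure Sect (q : F ⥤ B) (k : K ⥤ B) where
  functor : K ⥤ F
  isHomLift {x y : K} (f : x ⟶ y) : q.IsHomLift (k.map f) (functor.map f)

namespace Sect

variable {q : F ⥤ B} {k : K ⥤ B}

theorem proj (A : Sect q k) (y : K) : q.obj (A.functor.obj y) = k.obj y :=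
  have := A.isHomLift (𝟙 y)
  IsHomLift.domain_eq q (k.map (𝟙 y)) (A.functor.map (𝟙 y))

/-- The value of a section, as an object of the fibre. -/
def fib (A : Sect q k) (y : K) : Functor.Fiber q (k.obj y) := ⟨A.functor.obj y, A.proj y⟩

/-- A morphism of sections is a natural transformation with fibrewise components. -/
@[ext]
structure Hom (A A' : Sect q k) where
  app : A.functor ⟶ A'.functor
  fiberwise (y : K) : q.IsHomLift (𝟙 (k.obj y)) (app.app y)

instance : Category (Sect q k) where
  Hom := Hom
  id A := ⟨𝟙 _, fun y => IsHomLift.id (A.proj y)⟩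
  comp f g := ⟨f.app ≫ g.app, fun y =>
    have := f.fiberwise y
    have := g.fiberwise y
    inferInstanceAs (q.IsHomLift (𝟙 (k.obj y)) (f.app.app y ≫ g.app.app y))⟩
  id_comp f := Hom.ext (Category.id_comp f.app)
  comp_id f := Hom.ext (Category.comp_id f.app)
  assoc f g h := Hom.ext (Category.assoc f.app g.app h.app)

theorem hom_ext {A A' : Sect q k} {f g : A ⟶ A'} (h : ∀ y, f.app.app y = g.app.app y) : f = g :=
  Hom.ext (NatTrans.ext (funext h))

/-- A natural transformation between sections all of whose components lift identities. -/
def mkHom {A A' : Sect q k} (τ : A.functor ⟶ A'.functor)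
    (h : ∀ y, q.IsHomLift (𝟙 (k.obj y)) (τ.app y)) : A ⟶ A' := ⟨τ, h⟩

/-- The weak equivalences of sections are the pointwise ones. -/
def weakEquivalences (W : MorphismProperty F) : MorphismProperty (Sect q k) :=
  fun _ _ f => ∀ y, W (f.app.app y)

/-- Pullback of sections along `G : L ⥤ K`. -/
def precomp (q : F ⥤ B) (k : K ⥤ B) (G : L ⥤ K) : Sect q k ⥤ Sect q (G ⋙ k) where
  obj A := ⟨G ⋙ A.functor, fun f => A.isHomLift (G.map f)⟩
  map τ := ⟨Functor.whiskerLeft G τ.app, fun y => τ.fiberwise (G.obj y)⟩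

/-- Sections along equal functors to the base coincide. -/
def congr (q : F ⥤ B) {k k' : K ⥤ B} (h : k = k') : Sect q k ⥤ Sect q k' where
  obj A := ⟨A.functor, h ▸ A.isHomLift⟩
  map τ := ⟨τ.app, h ▸ τ.fiberwise⟩

section Restrict

open Functor.IsPreFibered

variable [q.IsFibered] {k₁ k₂ : K ⥤ B}

theorem restrict_lift (α : k₁ ⟶ k₂) (A : Sect q k₂) {x y : K} (f : x ⟶ y) :
    q.IsHomLift (k₁.map f ≫ α.app y) (pullbackMap (A.proj x) (α.app x) ≫ A.functor.map f) := by
  have := A.isHomLift f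
  rw [α.naturality]
  infer_instance

theorem restrict_lift' (α : k₁ ⟶ k₂) {A A' : Sect q k₂} (τ : A ⟶ A') (y : K) :
    q.IsHomLift (α.app y) (pullbackMap (A.proj y) (α.app y) ≫ τ.app.app y) := by
  have := τ.fiberwise y
  infer_instance

/-- The map `α_x^* A(x) ⟶ α_y^* A(y)` over `k₁.map f`. -/
noncomputable def restrictMap (α : k₁ ⟶ k₂) (A : Sect q k₂) {x y : K} (f : x ⟶ y) :
    pullbackObj (A.proj x) (α.app x) ⟶ pullbackObj (A.proj y) (α.app y) :=
  have := restrict_lift α A f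
  Functor.IsStronglyCartesian.map q (α.app y) (pullbackMap (A.proj y) (α.app y))
    (g := k₁.map f) rfl (pullbackMap (A.proj x) (α.app x) ≫ A.functor.map f)

instance (α : k₁ ⟶ k₂) (A : Sect q k₂) {x y : K} (f : x ⟶ y) :
    q.IsHomLift (k₁.map f) (restrictMap α A f) := by
  have := restrict_lift α A f
  unfold restrictMap
  infer_instance

theorem restrictMap_fac (α : k₁ ⟶ k₂) (A : Sect q k₂) {x y : K} (f : x ⟶ y) :
    restrictMap α A f ≫ pullbackMap (A.proj y) (α.app y) =
      pullbackMap (A.proj x) (α.app x) ≫ A.functor.map f := by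
  have := restrict_lift α A f
  exact Functor.IsStronglyCartesian.fac q (α.app y) (pullbackMap (A.proj y) (α.app y))
    (g := k₁.map f) rfl (pullbackMap (A.proj x) (α.app x) ≫ A.functor.map f)

/-- The restriction functor `A ↦ (y ↦ α_y^* A(y))` along `α : k₁ ⟶ k₂`. -/
noncomputable def restrict (q : F ⥤ B) [q.IsFibered] (α : k₁ ⟶ k₂) : Sect q k₂ ⥤ Sect q k₁ where
  obj A :=
    { functor :=
        { obj y := pullbackObj (A.proj y) (α.app y)
          map f := restrictMap α A f
          map_id y := by
            have h : q.IsHomLift (k₁.map (𝟙 y)) (𝟙 (pullbackObj (A.proj y) (α.app y))) := by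
              rw [k₁.map_id]; exact IsHomLift.id (pullbackObj_proj _ _)
            refine Functor.IsStronglyCartesian.ext q (α.app y)
              (pullbackMap (A.proj y) (α.app y)) (k₁.map (𝟙 y)) ?_
            rw [restrictMap_fac]; simp
          map_comp {x y z} f g := by
            have h : q.IsHomLift (k₁.map (f ≫ g)) (restrictMap α A f ≫ restrictMap α A g) := by
              rw [k₁.map_comp]; infer_instance
            refine Functor.IsStronglyCartesian.ext q (α.app z)
              (pullbackMap (A.proj z) (α.app z)) (k₁.map (f ≫ g)) ?_
            rw [restrictMap_fac, Category.assoc, restrictMap_fac, ← Category.assoc,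
              restrictMap_fac]
            simp }
      isHomLift {x y} f := (inferInstance : q.IsHomLift (k₁.map f) (restrictMap α A f)) }
  map {A A'} τ :=
    { app :=
        { app y :=
            have := restrict_lift' α τ y
            Functor.IsCartesian.map q (α.app y) (pullbackMap (A'.proj y) (α.app y))
              (pullbackMap (A.proj y) (α.app y) ≫ τ.app.app y)
          naturality x y f := by
            have h1 := restrict_lift' α τ x
            have h2 := restrict_lift' α τ y
            refine Functor.IsStronglyCartesian.ext q (α.app y)
              (pullbackMap (A'.proj y) (α.app y)) (k₁.map f) ?_
            simp only [Category.assoc, restrictMap_fac, Functor.IsCartesian.fac,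
              Functor.IsCartesian.fac_assoc]
            rw [← Category.assoc, restrictMap_fac]
            simp }
      fiberwise y :=
        have := restrict_lift' α τ y
        inferInstance }
  map_id A := by
    apply hom_ext
    intro y
    have := restrict_lift' α (𝟙 A) y
    have h : q.IsHomLift (𝟙 (k₁.obj y)) (𝟙 (pullbackObj (A.proj y) (α.app y))) :=
      IsHomLift.id (pullbackObj_proj _ _)
    exact (Functor.IsCartesian.map_uniq q (α.app y) (pullbackMap (A.proj y) (α.app y))
      (pullbackMap (A.proj y) (α.app y) ≫ (𝟙 A : A ⟶ A).app.app y) (𝟙 _)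
      ((Category.id_comp _).trans (Category.comp_id _).symm)).symm
  map_comp {A A' A''} τ σ := by
    apply hom_ext
    intro y
    have h1 := restrict_lift' α τ y
    have h2 := restrict_lift' α σ y
    have h3 := restrict_lift' α (τ ≫ σ) y
    refine (Functor.IsCartesian.map_uniq q (α.app y) (pullbackMap (A''.proj y) (α.app y))
      (pullbackMap (A.proj y) (α.app y) ≫ (τ ≫ σ).app.app y)
      (Functor.IsCartesian.map q (α.app y) (pullbackMap (A'.proj y) (α.app y))
          (pullbackMap (A.proj y) (α.app y) ≫ τ.app.app y) ≫
        Functor.IsCartesian.map q (α.app y) (pullbackMap (A''.proj y) (α.app y))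
          (pullbackMap (A'.proj y) (α.app y) ≫ σ.app.app y)) ?_).symm
    rw [Category.assoc, Functor.IsCartesian.fac, Functor.IsCartesian.fac_assoc, Category.assoc]
    rfl

end Restrict

end Sect
end Sections

section SectionConstructions

variable {B : Type u₁} [Category.{v₁} B] {F : Type u} [Category.{v} F]
  {K : Type u₂} [Category.{v₂} K]

/-- A morphism of a fibre. -/
def fiberHom {q : F ⥤ B} {b : B} {x y : Functor.Fiber q b} (φ : x.1 ⟶ y.1)
    (h : q.IsHomLift (𝟙 b) φ) : x ⟶ y := ⟨φ, h⟩

theorem lift_comp_id {q : F ⥤ B} {b c : B} {f : b ⟶ c} {x y z : F} {φ : x ⟶ y} {ψ : y ⟶ z}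
    (hφ : q.IsHomLift f φ) (hψ : q.IsHomLift (𝟙 c) ψ) : q.IsHomLift f (φ ≫ ψ) :=
  IsHomLift.comp_lift_id_right' q f φ c ψ

theorem lift_id_comp {q : F ⥤ B} {b c : B} {f : b ⟶ c} {x y z : F} {φ : x ⟶ y} {ψ : y ⟶ z}
    (hφ : q.IsHomLift (𝟙 b) φ) (hψ : q.IsHomLift f ψ) : q.IsHomLift f (φ ≫ ψ) :=
  IsHomLift.comp_lift_id_left' q b φ f ψ

theorem pullback_hom_ext {q : F ⥤ B} [q.IsFibered] {a b c : B} {z : F} (hz : q.obj z = c)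
    (f : b ⟶ c) (g : a ⟶ b) {x : F} {φ ψ : x ⟶ Functor.IsPreFibered.pullbackObj hz f}
    (hφ : q.IsHomLift g φ) (hψ : q.IsHomLift g ψ)
    (h : φ ≫ Functor.IsPreFibered.pullbackMap hz f = ψ ≫ Functor.IsPreFibered.pullbackMap hz f) :
    φ = ψ :=
  Functor.IsStronglyCartesian.ext q f (Functor.IsPreFibered.pullbackMap hz f) g h

/-- The map `Δ^n ⊗ x ⟶ Δ^0 ⊗ x ≅ x`. -/
def DeltaStructure.collapse (D : DeltaStructure F) (n : SimplexCategory) (x : F) :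
    (D.tensor.obj n).obj x ⟶ x :=
  (D.tensor.map (SimplexCategory.const n ⦋0⦌ 0)).app x ≫ D.unit.hom.app x

theorem DeltaStructure.collapse_naturality (D : DeltaStructure F) (n : SimplexCategory)
    {x y : F} (f : x ⟶ y) :
    (D.tensor.obj n).map f ≫ D.collapse n y = D.collapse n x ≫ f := by
  simp [collapse]

theorem DeltaStructure.tensor_map_collapse (D : DeltaStructure F) {m n : SimplexCategory}
    (a : m ⟶ n) (x : F) : (D.tensor.map a).app x ≫ D.collapse n x = D.collapse m x := by
  unfold collapse
  rw [← Category.assoc, ← NatTrans.comp_app, ← D.tensor.map_comp]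
  congr 3

theorem DeltaStructure.IsOver.collapse_isHomLift {D : DeltaStructure F} {q : F ⥤ B}
    (hD : D.IsOver q) (n : SimplexCategory) {b : B} {x : F} (hx : q.obj x = b) :
    q.IsHomLift (𝟙 b) (D.collapse n x) := by
  subst hx
  have h1 := hD.tensor_map (SimplexCategory.const n ⦋0⦌ 0) x
  have h2 := hD.unit x
  unfold DeltaStructure.collapse
  infer_instance

namespace Sect

open Functor.IsPreFibered

/-- A natural transformation `X ⟶ A` over `α : k₁ ⟶ k₂` factors through `α^* A`. -/
noncomputable def toRestrict {q : F ⥤ B} [q.IsFibered] {k₁ k₂ : K ⥤ B} (α : k₁ ⟶ k₂)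
    {X : Sect q k₁} {A : Sect q k₂} (τ : X.functor ⟶ A.functor)
    (hτ : ∀ y, q.IsHomLift (α.app y) (τ.app y)) : X ⟶ (restrict q α).obj A :=
  mkHom
    { app y := Functor.IsCartesian.map q (α.app y) (pullbackMap (A.proj y) (α.app y)) (τ.app y)
      naturality x y f := by
        have h3 := X.isHomLift f
        have h4 : q.IsHomLift (k₁.map f) (((restrict q α).obj A).functor.map f) :=
          ((restrict q α).obj A).isHomLift f
        have h5 := restrictMap_fac α A f
        have h8 (y : K) : q.IsHomLift (𝟙 (k₁.obj y)) (Functor.IsCartesian.map q (α.app y)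
            (pullbackMap (A.proj y) (α.app y)) (τ.app y)) :=
          Functor.IsCartesian.map_isHomLift q (α.app y) (pullbackMap (A.proj y) (α.app y)) (τ.app y)
        have h6 := lift_comp_id h3 (h8 y)
        have h7 := lift_id_comp (h8 x) h4
        refine pullback_hom_ext (A.proj y) (α.app y) (k₁.map f) h6 h7 ?_
        refine (Category.assoc _ _ _).trans
          (Eq.trans ?_ (Category.assoc _ (restrictMap α A f) _).symm)
        rw [h5, Functor.IsCartesian.fac,
          Functor.IsCartesian.fac_assoc, τ.naturality] }
    (fun y => Functor.IsCartesian.map_isHomLift q (α.app y) (pullbackMap (A.proj y) (α.app y))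
      (τ.app y))

section Coproduct

variable {J : K ⥤ Type w} {q : F ⥤ B} {k : K ⥤ B}

/-- The value of `X` at the element `j` of `J.obj y`, in the fibre over `k.obj y`. -/
abbrev family (X : Sect q (CategoryOfElements.π J ⋙ k)) (y : K) (j : J.obj y) :
    Functor.Fiber q (k.obj y) := X.fib (J.elementsMk y j)

variable [∀ (b : B) (T : Type w) (x : T → Functor.Fiber q b), HasCoproduct x]

/-- The inclusion of a summand into the fibrewise coproduct. -/
noncomputable abbrev coprodι (X : Sect q (CategoryOfElements.π J ⋙ k)) (y : K) (j : J.obj y) :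
    (X.family y j).1 ⟶ (∐ X.family y).1 :=
  (Limits.Sigma.ι (X.family y) j).1

theorem coprodι_isHomLift (X : Sect q (CategoryOfElements.π J ⋙ k)) (y : K) (j : J.obj y) :
    q.IsHomLift (𝟙 (k.obj y)) (X.coprodι y j) :=
  (Limits.Sigma.ι (X.family y) j).2

/-- The morphism `j ⟶ J.map f j` of the category of elements. -/
abbrev elementsHom (J : K ⥤ Type w) {x y : K} (f : x ⟶ y) (j : J.obj x) :
    J.elementsMk x j ⟶ J.elementsMk y (J.map f j) := ⟨f, rfl⟩

theorem coprodMap_lift (X : Sect q (CategoryOfElements.π J ⋙ k)) {x y : K} (f : x ⟶ y)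
    (j : J.obj x) : q.IsHomLift (k.map f)
      (X.functor.map (elementsHom J f j) ≫ X.coprodι y (J.map f j)) := by
  have h1 : q.IsHomLift (k.map f) (X.functor.map (elementsHom J f j)) :=
    X.isHomLift (elementsHom J f j)
  have h2 := X.coprodι_isHomLift y (J.map f j)
  exact lift_comp_id h1 h2

/-- The map of coproducts induced by `f`. -/
noncomputable def coprodMap [q.IsFibered] (X : Sect q (CategoryOfElements.π J ⋙ k)) {x y : K}
    (f : x ⟶ y) : (∐ X.family x).1 ⟶ (∐ X.family y).1 :=
  sigmaDesc (k.map f) (∐ X.family y).2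
    (fun j => X.functor.map (elementsHom J f j) ≫ X.coprodι y (J.map f j))
    (X.coprodMap_lift f)

theorem coprodMap_isHomLift [q.IsFibered] (X : Sect q (CategoryOfElements.π J ⋙ k)) {x y : K}
    (f : x ⟶ y) : q.IsHomLift (k.map f) (X.coprodMap f) :=
  sigmaDesc_isHomLift _ _ _ _

theorem ι_coprodMap [q.IsFibered] (X : Sect q (CategoryOfElements.π J ⋙ k)) {x y : K}
    (f : x ⟶ y) (j : J.obj x) : X.coprodι x j ≫ X.coprodMap f =
      X.functor.map (elementsHom J f j) ≫ X.coprodι y (J.map f j) :=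
  ι_sigmaDesc _ _ _ _ j

theorem map_coprodι (X : Sect q (CategoryOfElements.π J ⋙ k)) {x y : K} {j : J.obj x}
    {j' : J.obj y} (f : x ⟶ y) (hf : J.map f j = j') :
    X.functor.map (⟨f, hf⟩ : J.elementsMk x j ⟶ J.elementsMk y j') ≫ X.coprodι y j' =
      X.functor.map (elementsHom J f j) ≫ X.coprodι y (J.map f j) := by
  subst hf
  rfl

/-- The map of coproducts induced by a morphism of sections. -/
noncomputable def coprodFibMap {X X' : Sect q (CategoryOfElements.π J ⋙ k)} (τ : X ⟶ X') (y : K) :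
    (∐ X.family y) ⟶ (∐ X'.family y) :=
  Limits.Sigma.map (f := X.family y) (g := X'.family y)
    fun j => fiberHom (τ.app.app (J.elementsMk y j)) (τ.fiberwise (J.elementsMk y j))

theorem ι_coprodFibMap {X X' : Sect q (CategoryOfElements.π J ⋙ k)} (τ : X ⟶ X') (y : K)
    (j : J.obj y) : X.coprodι y j ≫ (coprodFibMap τ y).1 =
      τ.app.app (J.elementsMk y j) ≫ X'.coprodι y j :=
  congrArg Subtype.val (Limits.Sigma.ι_map (f := X.family y) (g := X'.family y)
    (fun j => fiberHom (τ.app.app (J.elementsMk y j)) (τ.fiberwise (J.elementsMk y j))) j)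

/-- The fibrewise coproduct along the discrete opfibration `J.Elements ⥤ K`:
`y ↦ ∐_{j : J.obj y} X(y, j)`. -/
noncomputable def coprod (q : F ⥤ B) [q.IsFibered]
    [∀ (b : B) (T : Type w) (x : T → Functor.Fiber q b), HasCoproduct x]
    (J : K ⥤ Type w) (k : K ⥤ B) :
    Sect q (CategoryOfElements.π J ⋙ k) ⥤ Sect q k where
  obj X :=
    { functor :=
        { obj y := (∐ X.family y).1
          map f := X.coprodMap f
          map_id y := by
            refine sigma_hom_ext_over (k.map (𝟙 y)) (X.coprodMap_isHomLift _) ?_ ?_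
            · rw [k.map_id]; exact IsHomLift.id (∐ X.family y).2
            · intro j
              refine (X.ι_coprodMap (𝟙 y) j).trans ?_
              refine (X.map_coprodι (𝟙 y) (𝟙 (J.elementsMk y j) :
                J.elementsMk y j ⟶ J.elementsMk y j).2).symm.trans ?_
              refine (congrArg (· ≫ X.coprodι y j)
                (X.functor.map_id (J.elementsMk y j))).trans ?_
              exact (Category.id_comp _).trans (Category.comp_id _).symm
          map_comp {x y z} f g := by
            have h1 := X.coprodMap_isHomLift f
            have h2 := X.coprodMap_isHomLift g
            refine sigma_hom_ext_over (k.map (f ≫ g)) (X.coprodMap_isHomLift _) ?_ ?_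
            · rw [k.map_comp]; infer_instance
            · intro j
              refine (X.ι_coprodMap (f ≫ g) j).trans ?_
              refine Eq.trans ?_ (Category.assoc _ _ _)
              have e1 := X.ι_coprodMap f j
              have e2 := X.ι_coprodMap g (J.map f j)
              refine Eq.trans ?_ (congrArg (· ≫ X.coprodMap g) e1.symm)
              refine Eq.trans ?_ (Category.assoc _ _ _).symm
              refine Eq.trans ?_ (congrArg (X.functor.map (elementsHom J f j) ≫ ·) e2.symm)
              refine Eq.trans ?_ (Category.assoc _ _ _)
              refine Eq.trans ?_ (congrArg (· ≫ X.coprodι z _) (X.functor.map_comp _ _))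
              exact (X.map_coprodι (f ≫ g)
                (elementsHom J f j ≫ elementsHom J g (J.map f j)).2).symm }
      isHomLift f := X.coprodMap_isHomLift f }
  map {X X'} τ := mkHom
    { app y := (coprodFibMap τ y).1
      naturality x y f := by
        have h1 := X.coprodMap_isHomLift f
        have h2 := X'.coprodMap_isHomLift f
        have h3 := (coprodFibMap τ x).2
        have h4 := (coprodFibMap τ y).2
        refine sigma_hom_ext_over (k.map f)
          (lift_comp_id h1 h4) (lift_id_comp h3 h2) ?_
        intro j
        refine (Category.assoc _ _ _).symm.trans (Eq.trans ?_ (Category.assoc _ _ _))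
        refine (congrArg (· ≫ (coprodFibMap τ y).1) (X.ι_coprodMap f j)).trans ?_
        refine Eq.trans ?_ (congrArg (· ≫ X'.coprodMap f) (ι_coprodFibMap τ x j)).symm
        refine (Category.assoc _ _ _).trans (Eq.trans ?_ (Category.assoc _ _ _).symm)
        refine (congrArg (X.functor.map (elementsHom J f j) ≫ ·)
          (ι_coprodFibMap τ y (J.map f j))).trans ?_
        refine Eq.trans ?_ (congrArg (τ.app.app (J.elementsMk x j) ≫ ·)
          (X'.ι_coprodMap f j)).symm
        refine (Category.assoc _ _ _).symm.trans (Eq.trans ?_ (Category.assoc _ _ _))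
        exact congrArg (· ≫ X'.coprodι y (J.map f j)) (τ.app.naturality (elementsHom J f j)) }
    (fun y => (coprodFibMap τ y).2)
  map_id X := by
    apply hom_ext
    intro y
    refine congrArg Subtype.val (?_ : coprodFibMap (𝟙 X) y = 𝟙 _)
    apply Limits.Sigma.hom_ext
    intro j
    apply Subtype.ext
    refine (ι_coprodFibMap (𝟙 X) y j).trans ?_
    exact (Category.id_comp _).trans (Category.comp_id _).symm
  map_comp {X X' X''} τ σ := by
    apply hom_ext
    intro y
    refine congrArg Subtype.val (?_ : coprodFibMap (τ ≫ σ) y =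
      coprodFibMap τ y ≫ coprodFibMap σ y)
    apply Limits.Sigma.hom_ext
    intro j
    apply Subtype.ext
    refine (ι_coprodFibMap (τ ≫ σ) y j).trans ?_
    refine Eq.trans ?_ (Category.assoc _ _ _)
    refine Eq.trans ?_ (congrArg (· ≫ (coprodFibMap σ y).1) (ι_coprodFibMap τ y j)).symm
    refine Eq.trans ?_ (Category.assoc _ _ _).symm
    refine Eq.trans ?_ (congrArg (τ.app.app (J.elementsMk y j) ≫ ·)
      (ι_coprodFibMap σ y j)).symm
    exact Category.assoc _ _ _

end Coproduct

section Realization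

variable {q : F ⥤ B} {k : K ⥤ B}

variable (K) in
/-- The projection `Δᵒᵖ × K ⥤ K`; sections along `forgetDegree K ⋙ k` are simplicial objects
in sections along `k`. -/
abbrev forgetDegree : SimplexCategoryᵒᵖ × K ⥤ K := CategoryTheory.Prod.snd SimplexCategoryᵒᵖ K

/-- The simplicial object `X(-, y)` of the fibre over `k.obj y`. -/
def slice (X : Sect q (forgetDegree K ⋙ k)) (y : K) :
    SimplexCategoryᵒᵖ ⥤ Functor.Fiber q (k.obj y) where
  obj n := X.fib (n, y)
  map {m n} a := fiberHom (X.functor.map ((a, 𝟙 y) : (m, y) ⟶ (n, y))) (by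
    have h := X.isHomLift ((a, 𝟙 y) : (m, y) ⟶ (n, y))
    exact k.map_id y ▸ h)
  map_id n := Subtype.ext (X.functor.map_id (n, y))
  map_comp {l m n} a a' := Subtype.ext (by
    have h := X.functor.map_comp ((a, 𝟙 y) : (l, y) ⟶ (m, y)) ((a', 𝟙 y) : (m, y) ⟶ (n, y))
    refine Eq.trans (congrArg X.functor.map ?_) h
    exact Prod.ext rfl (Category.id_comp (𝟙 y)).symm)

variable {D : DeltaStructure F} (hD : D.IsOver q)
  [∀ (b : B) (X : SimplexCategoryᵒᵖ ⥤ Functor.Fiber q b), HasCoend ((hD.fiber b).integrand X)]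

/-- The canonical map `Δ^n ⊗ X(n, y) ⟶ |X(-, y)|`. -/
noncomputable def realι (X : Sect q (forgetDegree K ⋙ k)) (y : K)
    (n : SimplexCategoryᵒᵖ) : (D.tensor.obj n.unop).obj (X.functor.obj (n, y)) ⟶
      ((hD.fiber (k.obj y)).realization (X.slice y)).1 :=
  (coend.ι ((hD.fiber (k.obj y)).integrand (X.slice y)) n).1

theorem realι_isHomLift (X : Sect q (forgetDegree K ⋙ k)) (y : K)
    (n : SimplexCategoryᵒᵖ) : q.IsHomLift (𝟙 (k.obj y)) (realι hD X y n) :=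
  (coend.ι ((hD.fiber (k.obj y)).integrand (X.slice y)) n).2

theorem realι_condition (X : Sect q (forgetDegree K ⋙ k)) (y : K)
    {m n : SimplexCategoryᵒᵖ} (a : m ⟶ n) :
    (D.tensor.map a.unop).app (X.functor.obj (m, y)) ≫ realι hD X y m =
      (D.tensor.obj n.unop).map (X.functor.map ((a, 𝟙 y) : (m, y) ⟶ (n, y))) ≫
        realι hD X y n :=
  congrArg Subtype.val (coend.condition ((hD.fiber (k.obj y)).integrand (X.slice y)) a)

/-- A morphism over `f : k.obj y ⟶ s` out of a realisation. -/
noncomputable def realDesc [q.IsFibered] (X : Sect q (forgetDegree K ⋙ k)) (y : K) {s : B} {z : F}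
    (f : k.obj y ⟶ s) (hz : q.obj z = s)
    (φ : ∀ n : SimplexCategoryᵒᵖ, (D.tensor.obj n.unop).obj (X.functor.obj (n, y)) ⟶ z)
    (hφ : ∀ n, q.IsHomLift f (φ n))
    (h : ∀ ⦃m n : SimplexCategoryᵒᵖ⦄ (a : m ⟶ n),
      (D.tensor.map a.unop).app (X.functor.obj (m, y)) ≫ φ m =
        (D.tensor.obj n.unop).map (X.functor.map ((a, 𝟙 y) : (m, y) ⟶ (n, y))) ≫ φ n) :
    ((hD.fiber (k.obj y)).realization (X.slice y)).1 ⟶ z :=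
  coendDesc (G := (hD.fiber (k.obj y)).integrand (X.slice y)) f hz φ hφ h

theorem realDesc_isHomLift [q.IsFibered] (X : Sect q (forgetDegree K ⋙ k)) (y : K) {s : B} {z : F}
    (f : k.obj y ⟶ s) (hz : q.obj z = s)
    (φ : ∀ n : SimplexCategoryᵒᵖ, (D.tensor.obj n.unop).obj (X.functor.obj (n, y)) ⟶ z)
    (hφ : ∀ n, q.IsHomLift f (φ n))
    (h : ∀ ⦃m n : SimplexCategoryᵒᵖ⦄ (a : m ⟶ n),
      (D.tensor.map a.unop).app (X.functor.obj (m, y)) ≫ φ m =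
        (D.tensor.obj n.unop).map (X.functor.map ((a, 𝟙 y) : (m, y) ⟶ (n, y))) ≫ φ n) :
    q.IsHomLift f (realDesc hD X y f hz φ hφ h) :=
  coendDesc_isHomLift (G := (hD.fiber (k.obj y)).integrand (X.slice y)) f hz φ hφ h

theorem ι_realDesc [q.IsFibered] (X : Sect q (forgetDegree K ⋙ k)) (y : K) {s : B} {z : F}
    (f : k.obj y ⟶ s) (hz : q.obj z = s)
    (φ : ∀ n : SimplexCategoryᵒᵖ, (D.tensor.obj n.unop).obj (X.functor.obj (n, y)) ⟶ z)
    (hφ : ∀ n, q.IsHomLift f (φ n))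
    (h : ∀ ⦃m n : SimplexCategoryᵒᵖ⦄ (a : m ⟶ n),
      (D.tensor.map a.unop).app (X.functor.obj (m, y)) ≫ φ m =
        (D.tensor.obj n.unop).map (X.functor.map ((a, 𝟙 y) : (m, y) ⟶ (n, y))) ≫ φ n)
    (n : SimplexCategoryᵒᵖ) : realι hD X y n ≫ realDesc hD X y f hz φ hφ h = φ n :=
  ι_coendDesc (G := (hD.fiber (k.obj y)).integrand (X.slice y)) f hz φ hφ h n

theorem real_hom_ext [q.IsFibered] (X : Sect q (forgetDegree K ⋙ k)) (y : K) {s : B} {z : F}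
    (f : k.obj y ⟶ s) {φ ψ : ((hD.fiber (k.obj y)).realization (X.slice y)).1 ⟶ z}
    (hφ : q.IsHomLift f φ) (hψ : q.IsHomLift f ψ)
    (h : ∀ n, realι hD X y n ≫ φ = realι hD X y n ≫ ψ) : φ = ψ :=
  coend_hom_ext_over (G := (hD.fiber (k.obj y)).integrand (X.slice y)) f hφ hψ h

/-- The component `Δ^n ⊗ X(n, x) ⟶ Δ^n ⊗ X(n, y) ⟶ |X(-, y)|` of the action of `f : x ⟶ y`. -/
noncomputable abbrev realComponent (X : Sect q (forgetDegree K ⋙ k)) {x y : K}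
    (f : x ⟶ y) (n : SimplexCategoryᵒᵖ) : (D.tensor.obj n.unop).obj (X.functor.obj (n, x)) ⟶
      ((hD.fiber (k.obj y)).realization (X.slice y)).1 :=
  (D.tensor.obj n.unop).map (X.functor.map ((𝟙 n, f) : (n, x) ⟶ (n, y))) ≫ realι hD X y n

theorem realComponent_isHomLift (X : Sect q (forgetDegree K ⋙ k)) {x y : K}
    (f : x ⟶ y) (n : SimplexCategoryᵒᵖ) : q.IsHomLift (k.map f) (realComponent hD X f n) := by
  have h1 : q.IsHomLift (k.map f) (X.functor.map ((𝟙 n, f) : (n, x) ⟶ (n, y))) :=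
    X.isHomLift ((𝟙 n, f) : (n, x) ⟶ (n, y))
  exact lift_comp_id (hD.tensor_isHomLift n.unop (k.map f) _) (realι_isHomLift hD X y n)

theorem realComponent_condition (X : Sect q (forgetDegree K ⋙ k)) {x y : K}
    (f : x ⟶ y) {m n : SimplexCategoryᵒᵖ} (a : m ⟶ n) :
    (D.tensor.map a.unop).app (X.functor.obj (m, x)) ≫ realComponent hD X f m =
      (D.tensor.obj n.unop).map (X.functor.map ((a, 𝟙 x) : (m, x) ⟶ (n, x))) ≫
        realComponent hD X f n := by
  have h : X.functor.map ((𝟙 m, f) : (m, x) ⟶ (m, y)) ≫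
      X.functor.map ((a, 𝟙 y) : (m, y) ⟶ (n, y)) =
      X.functor.map ((a, 𝟙 x) : (m, x) ⟶ (n, x)) ≫
        X.functor.map ((𝟙 n, f) : (n, x) ⟶ (n, y)) := by
    rw [← X.functor.map_comp, ← X.functor.map_comp]
    exact congrArg X.functor.map (Prod.ext ((Category.id_comp a).trans (Category.comp_id a).symm)
      ((Category.comp_id f).trans (Category.id_comp f).symm))
  rw [← NatTrans.naturality_assoc, realι_condition, ← Category.assoc, ← Functor.map_comp, h,
    Functor.map_comp, Category.assoc]

/-- The map `|X(-, x)| ⟶ |X(-, y)|` over `k.map f`. -/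
noncomputable def realMap [q.IsFibered] (X : Sect q (forgetDegree K ⋙ k)) {x y : K}
    (f : x ⟶ y) : ((hD.fiber (k.obj x)).realization (X.slice x)).1 ⟶
      ((hD.fiber (k.obj y)).realization (X.slice y)).1 :=
  realDesc hD X x (k.map f) ((hD.fiber (k.obj y)).realization (X.slice y)).2
    (realComponent hD X f) (realComponent_isHomLift hD X f)
    (fun _ _ => realComponent_condition hD X f)

theorem realMap_isHomLift [q.IsFibered] (X : Sect q (forgetDegree K ⋙ k)) {x y : K}
    (f : x ⟶ y) : q.IsHomLift (k.map f) (realMap hD X f) :=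
  realDesc_isHomLift hD X x (k.map f) _ _ _ _

theorem ι_realMap [q.IsFibered] (X : Sect q (forgetDegree K ⋙ k)) {x y : K}
    (f : x ⟶ y) (n : SimplexCategoryᵒᵖ) : realι hD X x n ≫ realMap hD X f =
      (D.tensor.obj n.unop).map (X.functor.map ((𝟙 n, f) : (n, x) ⟶ (n, y))) ≫ realι hD X y n :=
  ι_realDesc hD X x (k.map f) _ _ _ _ n

/-- The map of simplicial objects induced by a morphism of sections. -/
def sliceMap {X X' : Sect q (forgetDegree K ⋙ k)} (τ : X ⟶ X') (y : K) :
    X.slice y ⟶ X'.slice y where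
  app n := fiberHom (τ.app.app (n, y)) (τ.fiberwise (n, y))
  naturality m n a := Subtype.ext (τ.app.naturality ((a, 𝟙 y) : (m, y) ⟶ (n, y)))

theorem ι_realizationMap {X X' : Sect q (forgetDegree K ⋙ k)} (τ : X ⟶ X') (y : K)
    (n : SimplexCategoryᵒᵖ) :
    realι hD X y n ≫ ((hD.fiber (k.obj y)).realizationMap (sliceMap τ y)).1 =
      (D.tensor.obj n.unop).map (τ.app.app (n, y)) ≫ realι hD X' y n :=
  congrArg Subtype.val ((hD.fiber (k.obj y)).ι_realizationMap (sliceMap τ y) n)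

/-- The fibrewise realisation of a simplicial section: `y ↦ |X(-, y)|`. -/
noncomputable def realize [q.IsFibered] (k : K ⥤ B) :
    Sect q (forgetDegree K ⋙ k) ⥤ Sect q k where
  obj X :=
    { functor :=
        { obj y := ((hD.fiber (k.obj y)).realization (X.slice y)).1
          map f := realMap hD X f
          map_id y := by
            refine real_hom_ext hD X y (k.map (𝟙 y)) (realMap_isHomLift hD X _) ?_ ?_
            · rw [k.map_id]
              exact IsHomLift.id ((hD.fiber (k.obj y)).realization (X.slice y)).2
            · intro n
              refine (ι_realMap hD X (𝟙 y) n).trans ?_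
              have h : X.functor.map ((𝟙 n, 𝟙 y) : (n, y) ⟶ (n, y)) = 𝟙 _ :=
                X.functor.map_id (n, y)
              rw [h, CategoryTheory.Functor.map_id]
              exact (Category.id_comp _).trans (Category.comp_id _).symm
          map_comp {x y z} f g := by
            refine real_hom_ext hD X x (k.map (f ≫ g)) (realMap_isHomLift hD X _) ?_ ?_
            · have h1 := realMap_isHomLift hD X f
              have h2 := realMap_isHomLift hD X g
              rw [k.map_comp]
              infer_instance
            · intro n
              have h : X.functor.map ((𝟙 n, f ≫ g) : (n, x) ⟶ (n, z)) =
                  X.functor.map ((𝟙 n, f) : (n, x) ⟶ (n, y)) ≫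
                    X.functor.map ((𝟙 n, g) : (n, y) ⟶ (n, z)) := by
                rw [← X.functor.map_comp]
                exact congrArg X.functor.map (Prod.ext (Category.id_comp _).symm rfl)
              rw [ι_realMap, ← Category.assoc, ι_realMap, Category.assoc, ι_realMap, h,
                Functor.map_comp, Category.assoc] }
      isHomLift f := realMap_isHomLift hD X f }
  map {X X'} τ := mkHom
    { app y := ((hD.fiber (k.obj y)).realizationMap (sliceMap τ y)).1
      naturality x y f := by
        have h1 := realMap_isHomLift hD X f
        have h2 := realMap_isHomLift hD X' f
        have h3 := ((hD.fiber (k.obj x)).realizationMap (sliceMap τ x)).2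
        have h4 := ((hD.fiber (k.obj y)).realizationMap (sliceMap τ y)).2
        refine real_hom_ext hD X x (k.map f) (lift_comp_id h1 h4) (lift_id_comp h3 h2) ?_
        intro n
        have h : X.functor.map ((𝟙 n, f) : (n, x) ⟶ (n, y)) ≫ τ.app.app (n, y) =
            τ.app.app (n, x) ≫ X'.functor.map ((𝟙 n, f) : (n, x) ⟶ (n, y)) :=
          τ.app.naturality ((𝟙 n, f) : (n, x) ⟶ (n, y))
        refine (Category.assoc _ _ _).symm.trans (Eq.trans ?_ (Category.assoc _ _ _))
        refine (congrArg (· ≫ ((hD.fiber (k.obj y)).realizationMap (sliceMap τ y)).1)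
          (ι_realMap hD X f n)).trans ?_
        refine Eq.trans ?_ (congrArg (· ≫ realMap hD X' f) (ι_realizationMap hD τ x n)).symm
        refine (Category.assoc _ _ _).trans (Eq.trans ?_ (Category.assoc _ _ _).symm)
        refine (congrArg ((D.tensor.obj n.unop).map (X.functor.map _) ≫ ·)
          (ι_realizationMap hD τ y n)).trans ?_
        refine Eq.trans ?_ (congrArg ((D.tensor.obj n.unop).map (τ.app.app (n, x)) ≫ ·)
          (ι_realMap hD X' f n)).symm
        refine (Category.assoc _ _ _).symm.trans (Eq.trans ?_ (Category.assoc _ _ _))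
        refine congrArg (· ≫ realι hD X' y n) ?_
        refine ((D.tensor.obj n.unop).map_comp _ _).symm.trans
          (Eq.trans ?_ ((D.tensor.obj n.unop).map_comp _ _))
        exact congrArg (D.tensor.obj n.unop).map h }
    (fun y => ((hD.fiber (k.obj y)).realizationMap (sliceMap τ y)).2)
  map_id X := by
    apply hom_ext
    intro y
    refine congrArg Subtype.val (?_ : (hD.fiber (k.obj y)).realizationMap (sliceMap (𝟙 X) y) = 𝟙 _)
    refine coend.hom_ext fun n => Subtype.ext ?_
    refine (ι_realizationMap hD (𝟙 X) y n).trans ?_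
    refine (congrArg (· ≫ realι hD X y n) ((D.tensor.obj n.unop).map_id _)).trans ?_
    exact (Category.id_comp _).trans (Category.comp_id _).symm
  map_comp {X X' X''} τ σ := by
    apply hom_ext
    intro y
    refine congrArg Subtype.val (?_ : (hD.fiber (k.obj y)).realizationMap (sliceMap (τ ≫ σ) y) =
      (hD.fiber (k.obj y)).realizationMap (sliceMap τ y) ≫
        (hD.fiber (k.obj y)).realizationMap (sliceMap σ y))
    refine coend.hom_ext fun n => Subtype.ext ?_
    refine (ι_realizationMap hD (τ ≫ σ) y n).trans ?_
    refine Eq.trans ?_ (Category.assoc _ _ _)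
    refine Eq.trans ?_ (congrArg (· ≫ ((hD.fiber (k.obj y)).realizationMap (sliceMap σ y)).1)
      (ι_realizationMap hD τ y n)).symm
    refine Eq.trans ?_ (Category.assoc _ _ _).symm
    refine Eq.trans ?_ (congrArg ((D.tensor.obj n.unop).map (τ.app.app (n, y)) ≫ ·)
      (ι_realizationMap hD σ y n)).symm
    refine Eq.trans ?_ (Category.assoc _ _ _)
    exact congrArg (· ≫ realι hD X'' y n)
      ((D.tensor.obj n.unop).map_comp (τ.app.app (n, y)) (σ.app.app (n, y)))

/-- The component at `y` of the map from the realisation of a constant simplicial section. -/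
noncomputable def constMap [q.IsFibered] (A : Sect q k) (y : K) :
    ((hD.fiber (k.obj y)).realization
      (((precomp q k (forgetDegree K)).obj A).slice y)).1 ⟶
        A.functor.obj y :=
  realDesc hD ((precomp q k (forgetDegree K)).obj A) y (𝟙 (k.obj y))
    (A.proj y) (fun n => D.collapse n.unop (A.functor.obj y))
    (fun n => hD.collapse_isHomLift n.unop (A.proj y))
    (fun m n a => by
      have h : ((precomp q k (forgetDegree K)).obj A).functor.map
          ((a, 𝟙 y) : (m, y) ⟶ (n, y)) = 𝟙 (A.functor.obj y) := A.functor.map_id y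
      refine (D.tensor_map_collapse a.unop (A.functor.obj y)).trans ?_
      refine Eq.trans ?_ (congrArg (fun t => (D.tensor.obj n.unop).map t ≫ D.collapse n.unop _)
        h.symm)
      refine Eq.trans ?_ (congrArg (· ≫ D.collapse n.unop (A.functor.obj y))
        ((D.tensor.obj n.unop).map_id (A.functor.obj y)).symm)
      exact (Category.id_comp _).symm)

theorem constMap_isHomLift [q.IsFibered] (A : Sect q k) (y : K) :
    q.IsHomLift (𝟙 (k.obj y)) (constMap hD A y) :=
  realDesc_isHomLift hD _ y _ _ _ _ _

theorem ι_constMap [q.IsFibered] (A : Sect q k) (y : K) (n : SimplexCategoryᵒᵖ) :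
    realι hD ((precomp q k (forgetDegree K)).obj A) y n ≫
      constMap hD A y = D.collapse n.unop (A.functor.obj y) :=
  ι_realDesc hD ((precomp q k (forgetDegree K)).obj A) y
    _ _ _ _ _ n

/-- The map `|A| ⟶ A` from the realisation of the constant simplicial section on `A`, given by
the maps `Δ^n ⊗ A(y) ⟶ Δ^0 ⊗ A(y) ≅ A(y)`. -/
noncomputable def realizeConst [q.IsFibered] (k : K ⥤ B) :
    precomp q k (forgetDegree K) ⋙ realize hD k ⟶ 𝟭 (Sect q k) where
  app A := mkHom
    { app y := constMap hD A y
      naturality x y f := by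
        have h1 := A.isHomLift f
        have h2 := realMap_isHomLift hD ((precomp q k (forgetDegree K)).obj A) f
        refine real_hom_ext hD ((precomp q k (forgetDegree K)).obj A) x (k.map f)
          (lift_comp_id h2 (constMap_isHomLift hD A y))
          (lift_id_comp (constMap_isHomLift hD A x) h1) ?_
        intro n
        have e := ι_realMap hD ((precomp q k (forgetDegree K)).obj A) f n
        refine (Category.assoc _ _ _).symm.trans (Eq.trans ?_ (Category.assoc _ _ _))
        refine (congrArg (· ≫ constMap hD A y) e).trans ?_
        refine Eq.trans ?_ (congrArg (· ≫ A.functor.map f) (ι_constMap hD A x n)).symm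
        refine (Category.assoc _ _ _).trans ?_
        refine (congrArg ((D.tensor.obj n.unop).map (A.functor.map f) ≫ ·)
          (ι_constMap hD A y n)).trans ?_
        exact D.collapse_naturality n.unop (A.functor.map f) }
    (constMap_isHomLift hD A)
  naturality A A' τ := by
    apply hom_ext
    intro y
    refine real_hom_ext hD ((precomp q k (forgetDegree K)).obj A) y (𝟙 (k.obj y))
      (lift_comp_id ((hD.fiber (k.obj y)).realizationMap (sliceMap
        ((precomp q k (forgetDegree K)).map τ) y)).2
        (constMap_isHomLift hD A' y))
      (lift_comp_id (constMap_isHomLift hD A y) (τ.fiberwise y)) ?_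
    intro n
    have e := ι_realizationMap hD
      ((precomp q k (forgetDegree K)).map τ) y n
    refine (Category.assoc _ _ _).symm.trans (Eq.trans ?_ (Category.assoc _ _ _))
    refine (congrArg (· ≫ constMap hD A' y) e).trans ?_
    refine Eq.trans ?_ (congrArg (· ≫ τ.app.app y) (ι_constMap hD A y n)).symm
    refine (Category.assoc _ _ _).trans ?_
    refine (congrArg ((D.tensor.obj n.unop).map (τ.app.app y) ≫ ·)
      (ι_constMap hD A' y n)).trans ?_
    exact D.collapse_naturality n.unop (τ.app.app y)

end Realization

end Sect
end SectionConstructions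

section Fold

variable {B : Type u₁} [Category.{v₁} B] {F : Type u} [Category.{v} F]
  {K : Type u₂} [Category.{v₂} K]

namespace Sect

variable {J : K ⥤ Type w} {q : F ⥤ B} {k : K ⥤ B} [q.IsFibered]

theorem toRestrict_fac {k₁ k₂ : K ⥤ B} (α : k₁ ⟶ k₂)
    {X : Sect q k₁} {A : Sect q k₂} (τ : X.functor ⟶ A.functor)
    (hτ : ∀ y, q.IsHomLift (α.app y) (τ.app y)) (y : K) :
    (toRestrict α τ hτ).app.app y ≫ Functor.IsPreFibered.pullbackMap (A.proj y) (α.app y) =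
      τ.app y :=
  have := hτ y
  Functor.IsCartesian.fac q (α.app y) (Functor.IsPreFibered.pullbackMap (A.proj y) (α.app y))
    (τ.app y)

theorem restrict_map_fac {k₁ k₂ : K ⥤ B} (α : k₁ ⟶ k₂) {A A' : Sect q k₂} (τ : A ⟶ A') (y : K) :
    ((restrict q α).map τ).app.app y ≫
        Functor.IsPreFibered.pullbackMap (A'.proj y) (α.app y) =
      Functor.IsPreFibered.pullbackMap (A.proj y) (α.app y) ≫ τ.app.app y :=
  have := restrict_lift' α τ y
  Functor.IsCartesian.fac q (α.app y) (Functor.IsPreFibered.pullbackMap (A'.proj y) (α.app y))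
    (Functor.IsPreFibered.pullbackMap (A.proj y) (α.app y) ≫ τ.app.app y)

/-- Naturality of the factorisation through `α^*`. -/
theorem toRestrict_naturality {k₁ k₂ : K ⥤ B} (α : k₁ ⟶ k₂) {X X' : Sect q k₁} {A A' : Sect q k₂}
    (τ : X.functor ⟶ A.functor) (hτ : ∀ y, q.IsHomLift (α.app y) (τ.app y))
    (τ' : X'.functor ⟶ A'.functor) (hτ' : ∀ y, q.IsHomLift (α.app y) (τ'.app y))
    (σ : X ⟶ X') (ρ : A ⟶ A') (h : ∀ y, σ.app.app y ≫ τ'.app y = τ.app y ≫ ρ.app.app y) :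
    σ ≫ toRestrict α τ' hτ' = toRestrict α τ hτ ≫ (restrict q α).map ρ := by
  apply hom_ext
  intro y
  refine pullback_hom_ext (A'.proj y) (α.app y) (𝟙 _)
    (lift_comp_id (σ.fiberwise y) ((toRestrict α τ' hτ').fiberwise y))
    (lift_comp_id ((toRestrict α τ hτ).fiberwise y) (((restrict q α).map ρ).fiberwise y)) ?_
  refine (Category.assoc _ _ _).trans (Eq.trans ?_ (Category.assoc _ _ _).symm)
  refine (congrArg (σ.app.app y ≫ ·) (toRestrict_fac α τ' hτ' y)).trans ?_
  refine Eq.trans ?_ (congrArg ((toRestrict α τ hτ).app.app y ≫ ·) (restrict_map_fac α ρ y)).symm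
  refine Eq.trans ?_ (Category.assoc _ _ _)
  exact (h y).trans (congrArg (· ≫ ρ.app.app y) (toRestrict_fac α τ hτ y)).symm

variable [∀ (b : B) (T : Type w) (x : T → Functor.Fiber q b), HasCoproduct x]

/-- The component at `y` of the folding map: the identity on every summand. -/
noncomputable def foldMap (J : K ⥤ Type w) (A : Sect q k) (y : K) :
    (∐ ((precomp q k (CategoryOfElements.π J)).obj A).family y).1 ⟶ A.functor.obj y :=
  sigmaDesc (𝟙 (k.obj y)) (A.proj y) (fun _ => 𝟙 (A.functor.obj y))
    (fun _ => IsHomLift.id (A.proj y))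

theorem foldMap_isHomLift (A : Sect q k) (y : K) : q.IsHomLift (𝟙 (k.obj y)) (foldMap J A y) :=
  sigmaDesc_isHomLift _ _ _ _

theorem ι_foldMap (A : Sect q k) (y : K) (j : J.obj y) :
    ((precomp q k (CategoryOfElements.π J)).obj A).coprodι y j ≫ foldMap J A y = 𝟙 _ :=
  ι_sigmaDesc _ _ _ _ j

variable (q) in
/-- The folding map `∐_{j : J.obj y} A(y) ⟶ A(y)`. -/
noncomputable def fold (J : K ⥤ Type w) (k : K ⥤ B) :
    precomp q k (CategoryOfElements.π J) ⋙ coprod q J k ⟶ 𝟭 (Sect q k) where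
  app A := mkHom
    { app y := foldMap J A y
      naturality x y f := by
        have h1 := A.isHomLift f
        have h2 := ((precomp q k (CategoryOfElements.π J)).obj A).coprodMap_isHomLift f
        refine sigma_hom_ext_over (k.map f) (lift_comp_id h2 (foldMap_isHomLift A y))
          (lift_id_comp (foldMap_isHomLift A x) h1) ?_
        intro j
        refine (Category.assoc _ _ _).symm.trans (Eq.trans ?_ (Category.assoc _ _ _))
        refine (congrArg (· ≫ foldMap J A y)
          (((precomp q k (CategoryOfElements.π J)).obj A).ι_coprodMap f j)).trans ?_
        refine Eq.trans ?_ (congrArg (· ≫ A.functor.map f) (ι_foldMap A x j)).symm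
        refine (Category.assoc _ _ _).trans ?_
        refine (congrArg (A.functor.map f ≫ ·) (ι_foldMap A y (J.map f j))).trans ?_
        exact (Category.comp_id _).trans (Category.id_comp _).symm }
    (foldMap_isHomLift A)
  naturality A A' τ := by
    apply hom_ext
    intro y
    refine sigma_hom_ext_over (𝟙 (k.obj y))
      (lift_comp_id (coprodFibMap ((precomp q k (CategoryOfElements.π J)).map τ) y).2
        (foldMap_isHomLift A' y))
      (lift_comp_id (foldMap_isHomLift A y) (τ.fiberwise y)) ?_
    intro j
    refine (Category.assoc _ _ _).symm.trans (Eq.trans ?_ (Category.assoc _ _ _))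
    refine (congrArg (· ≫ foldMap J A' y)
      (ι_coprodFibMap ((precomp q k (CategoryOfElements.π J)).map τ) y j)).trans ?_
    refine Eq.trans ?_ (congrArg (· ≫ τ.app.app y) (ι_foldMap A y j)).symm
    refine (Category.assoc _ _ _).trans ?_
    refine (congrArg (τ.app.app y ≫ ·) (ι_foldMap A' y j)).trans ?_
    exact (Category.comp_id _).trans (Category.id_comp _).symm

end Sect
end Fold

section SimplicialReplacement

/-- The simplicial replacement `ℂ` of `C`: the opposite of the category of simplices of the nerve.
An object is a chain `c₀ ⟶ ⋯ ⟶ cₙ`; a morphism from it to `c₀' ⟶ ⋯ ⟶ cₘ'` is a map `[m] ⟶ [n]`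
which pulls back the first chain to the second one. -/
abbrev Replacement (C : Type u) [Category.{v} C] := (nerve C).Elements

variable {C D : Type u} [Category.{v} C] [Category.{v} D]

namespace Replacement

/-- The chain underlying an object of the simplicial replacement. -/
abbrev chain (x : Replacement C) : ComposableArrows C x.1.unop.len := x.2

/-- The map of `Δ` underlying a morphism, as a monotone map. -/
abbrev under {x y : Replacement C} (f : x ⟶ y) :
    Fin (y.1.unop.len + 1) →o Fin (x.1.unop.len + 1) := f.1.unop.toOrderHom

theorem obj_under {x y : Replacement C} (f : x ⟶ y) (i : Fin (y.1.unop.len + 1)) :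
    x.chain.obj (under f i) = y.chain.obj i :=
  Functor.congr_obj f.2 i

/-- The first object `c₀` of a chain. -/
abbrev first (x : Replacement C) : C := x.chain.obj 0

/-- The last object `cₙ` of a chain. -/
abbrev last (x : Replacement C) : C := x.chain.obj (Fin.last _)

/-- The map `c₀ ⟶ c_{a(0)} = c₀'`. -/
def firstMap {x y : Replacement C} (f : x ⟶ y) : x.first ⟶ y.first :=
  x.chain.map (homOfLE (Fin.zero_le (under f 0))) ≫ eqToHom (obj_under f 0)

/-- The map `cₘ' = c_{a(m)} ⟶ cₙ`. -/
def lastMap {x y : Replacement C} (f : x ⟶ y) : y.last ⟶ x.last :=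
  eqToHom (obj_under f (Fin.last _)).symm ≫
    x.chain.map (homOfLE (Fin.le_last (under f (Fin.last _))))

variable (C) in
/-- The functor sending a chain to its first object. -/
def head : Replacement C ⥤ C where
  obj x := x.first
  map f := firstMap f
  map_id x := by
    refine (Category.comp_id _).trans ?_
    exact x.chain.map_id 0
  map_comp {x y z} f g := by
    obtain ⟨n, x⟩ := x
    obtain ⟨m, y⟩ := y
    obtain ⟨l, z⟩ := z
    obtain ⟨(a : n ⟶ m), hf⟩ := f
    obtain ⟨(b : m ⟶ l), hg⟩ := g
    change (nerve C).map a x = y at hf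
    change (nerve C).map b y = z at hg
    subst hf hg
    unfold firstMap
    refine (Category.comp_id _).trans (Eq.trans ?_
      (congrArg₂ (· ≫ ·) (Category.comp_id _) (Category.comp_id _)).symm)
    exact (congrArg (x : ComposableArrows C n.unop.len).map (Subsingleton.elim _ _)).trans
      ((x : ComposableArrows C n.unop.len).map_comp _ _)

variable (C) in
/-- The functor sending a chain to its last object. -/
def tail : Replacement C ⥤ Cᵒᵖ where
  obj x := op x.last
  map f := (lastMap f).op
  map_id x := by
    refine congrArg Quiver.Hom.op ?_
    refine (Category.id_comp _).trans ?_
    exact x.chain.map_id _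
  map_comp {x y z} f g := by
    refine congrArg Quiver.Hom.op (?_ : lastMap (f ≫ g) = lastMap g ≫ lastMap f)
    obtain ⟨n, x⟩ := x
    obtain ⟨m, y⟩ := y
    obtain ⟨l, z⟩ := z
    obtain ⟨(a : n ⟶ m), hf⟩ := f
    obtain ⟨(b : m ⟶ l), hg⟩ := g
    change (nerve C).map a x = y at hf
    change (nerve C).map b y = z at hg
    subst hf hg
    unfold lastMap
    refine (Category.id_comp _).trans (Eq.trans ?_
      (congrArg₂ (· ≫ ·) (Category.id_comp _) (Category.id_comp _)).symm)
    exact (congrArg (x : ComposableArrows C n.unop.len).map (Subsingleton.elim _ _)).trans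
      ((x : ComposableArrows C n.unop.len).map_comp _ _)

theorem lastMap_eq {x y : Replacement C} (f : x ⟶ y) (h : under f (Fin.last _) = Fin.last _) :
    lastMap f = eqToHom ((obj_under f (Fin.last _)).symm.trans (congrArg x.chain.obj h)) := by
  have e : homOfLE (Fin.le_last (under f (Fin.last _))) = eqToHom h := Subsingleton.elim _ _
  unfold lastMap
  rw [e, eqToHom_map, eqToHom_trans]

/-- Anchor maps: the underlying map `[m] ⟶ [n]` is the inclusion of an initial segment. -/
def IsAnchor {x y : Replacement C} (f : x ⟶ y) : Prop :=
  ∀ i : Fin (y.1.unop.len + 1), (under f i : ℕ) = i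

/-- The functor `𝔽` induced on simplicial replacements by `F`. -/
abbrev map (F : D ⥤ C) : Replacement D ⥤ Replacement C := NatTrans.mapElements (nerveMap F)

end Replacement
end SimplicialReplacement

section Concatenation

instance {X Y : Type} [Preorder X] [Preorder Y] : Quiver.IsThin (Join X Y) := by
  intro x y
  refine ⟨fun f g => ?_⟩
  cases x <;> cases y
  · exact ((Join.inclLeftFullyFaithful X Y).homEquiv).symm.injective (Subsingleton.elim _ _)
  · exact Subsingleton.elim (α := PUnit) f g
  · exact (Join.false_of_right_to_left f).elim
  · exact ((Join.inclRightFullyFaithful X Y).homEquiv).symm.injective (Subsingleton.elim _ _)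

/-- The concatenation `[n] * [m] = [n + m + 1]`. -/
abbrev con (n m : SimplexCategory) : SimplexCategory := ⦋n.len + 1 + m.len⦌

/-- The concatenation of maps. -/
def conMap {n m n' m' : SimplexCategory} (a : n ⟶ n') (b : m ⟶ m') : con n m ⟶ con n' m' :=
  SimplexCategory.mkHom
    { toFun := fun i : Fin ((n.len + 1) + (m.len + 1)) =>
        Fin.addCases (motive := fun _ => Fin ((n'.len + 1) + (m'.len + 1)))
          (fun i => (a.toOrderHom i).castAdd _) (fun j => (b.toOrderHom j).natAdd _) i
      monotone' := fun (i j : Fin ((n.len + 1) + (m.len + 1))) h => by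
        cases i using Fin.addCases with
        | left i =>
          cases j using Fin.addCases with
          | left j =>
            rw [Fin.le_def] at h
            simp only [Fin.addCases_left]
            exact a.toOrderHom.monotone (Fin.le_def.2 h)
          | right j =>
            simp only [Fin.addCases_left, Fin.addCases_right]
            rw [Fin.le_def]; simp; omega
        | right i =>
          cases j using Fin.addCases with
          | left j => rw [Fin.le_def] at h; simp at h; omega
          | right j =>
            simp only [Fin.addCases_right]
            have : i ≤ j := by rw [Fin.le_def] at h ⊢; simpa using h
            have := b.toOrderHom.monotone this
            rw [Fin.le_def] at this ⊢
            simpa using this }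

/-- The isomorphism of `[n] * [m]` with the join of `[n]` and `[m]`. -/
noncomputable def split (n m : ℕ) : Fin ((n + 1) + (m + 1)) ⥤ Join (Fin (n + 1)) (Fin (m + 1)) where
  obj i := Fin.addCases (motive := fun _ => Join (Fin (n + 1)) (Fin (m + 1))) Join.left Join.right i
  map {i j} h := Nonempty.some (by
    have h := leOfHom h
    cases i using Fin.addCases with
    | left i =>
      cases j using Fin.addCases with
      | left j =>
        rw [Fin.le_def] at h
        simp only [Fin.addCases_left]
        exact ⟨(Join.inclLeft _ _).map (homOfLE (Fin.le_def.2 h))⟩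
      | right j =>
        simp only [Fin.addCases_left, Fin.addCases_right]
        exact ⟨Join.edge i j⟩
    | right i =>
      cases j using Fin.addCases with
      | left j => rw [Fin.le_def] at h; simp at h; omega
      | right j =>
        simp only [Fin.addCases_right]
        have : i ≤ j := by rw [Fin.le_def] at h ⊢; simpa using h
        exact ⟨(Join.inclRight _ _).map (homOfLE this)⟩)
  map_id _ := Subsingleton.elim _ _
  map_comp _ _ := Subsingleton.elim _ _

variable {C : Type u} [Category.{v} C]

/-- The transformation `xᵢ ⟶ xₙ ⟶ y₀ ⟶ yⱼ` given by `α : xₙ ⟶ y₀`. -/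
def bridge {n m : ℕ} (x : ComposableArrows C n) (y : ComposableArrows C m)
    (α : x.obj (Fin.last n) ⟶ y.obj 0) :
    CategoryTheory.Prod.fst (Fin (n + 1)) (Fin (m + 1)) ⋙ x ⟶
      CategoryTheory.Prod.snd (Fin (n + 1)) (Fin (m + 1)) ⋙ y where
  app k := x.map (homOfLE (Fin.le_last k.1)) ≫ α ≫ y.map (homOfLE (Fin.zero_le k.2))
  naturality k l f := by
    change x.map f.1 ≫ x.map _ ≫ α ≫ y.map _ = (x.map _ ≫ α ≫ y.map _) ≫ y.map f.2
    simp only [Category.assoc, ← CategoryTheory.Functor.map_comp,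
      ← CategoryTheory.Functor.map_comp_assoc]
    rfl

/-- The concatenation `x₀ ⟶ ⋯ ⟶ xₙ ⟶ y₀ ⟶ ⋯ ⟶ yₘ` of two chains along `α : xₙ ⟶ y₀`. -/
noncomputable def concat {n m : ℕ} (x : ComposableArrows C n) (y : ComposableArrows C m)
    (α : x.obj (Fin.last n) ⟶ y.obj 0) : ComposableArrows C (n + 1 + m) :=
  split n m ⋙ Join.mkFunctor x y (bridge x y α)

/-- The inclusion of `[n]` into `[n] * [m]`. -/
abbrev conL {n m : ℕ} (i : Fin (n + 1)) : Fin (n + 1 + m + 1) := Fin.castAdd (m + 1) i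

/-- The inclusion of `[m]` into `[n] * [m]`. -/
abbrev conR {n m : ℕ} (j : Fin (m + 1)) : Fin (n + 1 + m + 1) := Fin.natAdd (n + 1) j

theorem con_cases {n m : ℕ} {P : Fin (n + 1 + m + 1) → Prop} (hl : ∀ i : Fin (n + 1), P (conL i))
    (hr : ∀ j : Fin (m + 1), P (conR j)) (i : Fin (n + 1 + m + 1)) : P i :=
  Fin.addCases (m := n + 1) (n := m + 1) hl hr i

theorem split_obj_left {n m : ℕ} (i : Fin (n + 1)) :
    (split n m).obj (conL i) = Join.left i := by
  have h := Fin.addCases_left (m := n + 1) (n := m + 1)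
    (motive := fun _ => Join (Fin (n + 1)) (Fin (m + 1)))
    (left := fun i => Join.left i) (right := fun j => Join.right j) i
  exact h

theorem split_obj_right {n m : ℕ} (j : Fin (m + 1)) :
    (split n m).obj (conR j) = Join.right j := by
  have h := Fin.addCases_right (m := n + 1) (n := m + 1)
    (motive := fun _ => Join (Fin (n + 1)) (Fin (m + 1)))
    (left := fun i => Join.left i) (right := fun j => Join.right j) j
  exact h

theorem conMap_left {n m n' m' : SimplexCategory} (a : n ⟶ n') (b : m ⟶ m')
    (i : Fin (n.len + 1)) : (conMap a b).toOrderHom (conL i) = conL (a.toOrderHom i) :=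
  Fin.addCases_left (motive := fun _ => Fin ((n'.len + 1) + (m'.len + 1)))
    (left := fun i => (a.toOrderHom i).castAdd _)
    (right := fun j => (b.toOrderHom j).natAdd _) i

theorem conMap_right {n m n' m' : SimplexCategory} (a : n ⟶ n') (b : m ⟶ m')
    (j : Fin (m.len + 1)) : (conMap a b).toOrderHom (conR j) = conR (b.toOrderHom j) :=
  Fin.addCases_right (motive := fun _ => Fin ((n'.len + 1) + (m'.len + 1)))
    (left := fun i => (a.toOrderHom i).castAdd _)
    (right := fun j => (b.toOrderHom j).natAdd _) j

theorem conMap_id (n m : SimplexCategory) : conMap (𝟙 n) (𝟙 m) = 𝟙 (con n m) := by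
  apply SimplexCategory.Hom.ext
  apply OrderHom.ext
  funext i
  induction i using con_cases with
  | hl i => exact conMap_left (𝟙 n) (𝟙 m) i
  | hr i => exact conMap_right (𝟙 n) (𝟙 m) i

theorem conMap_comp {n m n' m' n'' m'' : SimplexCategory} (a : n ⟶ n') (b : m ⟶ m')
    (a' : n' ⟶ n'') (b' : m' ⟶ m'') :
    conMap (a ≫ a') (b ≫ b') = conMap a b ≫ conMap a' b' := by
  apply SimplexCategory.Hom.ext
  apply OrderHom.ext
  funext i
  change _ = (conMap a' b').toOrderHom ((conMap a b).toOrderHom i)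
  induction i using con_cases with
  | hl i => rw [conMap_left a b, conMap_left a' b']; exact conMap_left (a ≫ a') (b ≫ b') i
  | hr i => rw [conMap_right a b, conMap_right a' b']; exact conMap_right (a ≫ a') (b ≫ b') i

/-- The functor underlying a map of `Δ`. -/
abbrev orderFunctor {n m : SimplexCategory} (a : n ⟶ m) : Fin (n.len + 1) ⥤ Fin (m.len + 1) :=
  (SimplexCategory.toCat.map a).toFunctor

theorem conMap_split {n m n' m' : SimplexCategory} (a : n' ⟶ n) (b : m' ⟶ m) :
    orderFunctor (conMap a b) ⋙ split n.len m.len =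
      split n'.len m'.len ⋙ Join.mapPair (orderFunctor a) (orderFunctor b) := by
  refine CategoryTheory.Functor.ext (fun i => ?_) (fun _ _ _ => Subsingleton.elim _ _)
  change (split n.len m.len).obj ((conMap a b).toOrderHom i) =
    (Join.mapPair (orderFunctor a) (orderFunctor b)).obj ((split n'.len m'.len).obj i)
  induction i using con_cases with
  | hl i => rw [conMap_left, split_obj_left, split_obj_left]; rfl
  | hr i => rw [conMap_right, split_obj_right, split_obj_right]; rfl

theorem mapPair_mkFunctor {n m n' m' : SimplexCategory} (a : n' ⟶ n) (b : m' ⟶ m)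
    (x : ComposableArrows C n.len) (y : ComposableArrows C m.len)
    (α : x.obj (Fin.last _) ⟶ y.obj 0) :
    Join.mapPair (orderFunctor a) (orderFunctor b) ⋙ Join.mkFunctor x y (bridge x y α) =
      Join.mkFunctor (orderFunctor a ⋙ x) (orderFunctor b ⋙ y)
        (bridge (n := n'.len) (m := m'.len) (orderFunctor a ⋙ x) (orderFunctor b ⋙ y)
          (x.map (homOfLE (Fin.le_last (a.toOrderHom (Fin.last _)))) ≫ α ≫
            y.map (homOfLE (Fin.zero_le (b.toOrderHom 0))))) := by
  refine CategoryTheory.Functor.ext (fun i => by cases i <;> rfl) ?_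
  intro i j f
  cases f with
  | left i j f => exact ((Category.id_comp _).trans (Category.comp_id _)).symm
  | right i j f => exact ((Category.id_comp _).trans (Category.comp_id _)).symm
  | edge i j =>
    refine Eq.trans ?_ ((Category.id_comp _).trans (Category.comp_id _)).symm
    change x.map _ ≫ α ≫ y.map _ = x.map _ ≫ (x.map _ ≫ α ≫ y.map _) ≫ y.map _
    simp only [Category.assoc, ← CategoryTheory.Functor.map_comp,
      ← CategoryTheory.Functor.map_comp_assoc]
    rfl

/-- Concatenation is natural. -/
theorem concat_map {n m n' m' : SimplexCategory} (a : n' ⟶ n) (b : m' ⟶ m)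
    (x : ComposableArrows C n.len) (y : ComposableArrows C m.len)
    (α : x.obj (Fin.last _) ⟶ y.obj 0) :
    orderFunctor (conMap a b) ⋙ concat x y α =
      concat (n := n'.len) (m := m'.len) (orderFunctor a ⋙ x) (orderFunctor b ⋙ y)
          (x.map (homOfLE (Fin.le_last (a.toOrderHom (Fin.last _)))) ≫ α ≫
            y.map (homOfLE (Fin.zero_le (b.toOrderHom 0)))) :=
  (congrArg (· ⋙ Join.mkFunctor x y (bridge x y α)) (conMap_split a b)).trans
    (congrArg (split n'.len m'.len ⋙ ·) (mapPair_mkFunctor a b x y α))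

/-- The inclusion `[n] ⟶ [n] * [m]`, as a map of `Δ`. -/
def conInl (n m : SimplexCategory) : n ⟶ con n m :=
  SimplexCategory.mkHom ⟨conL, fun _ _ h => h⟩

/-- The inclusion `[m] ⟶ [n] * [m]`, as a map of `Δ`. -/
def conInr (n m : SimplexCategory) : m ⟶ con n m :=
  SimplexCategory.mkHom ⟨conR, fun i j h => by
    rw [Fin.le_def] at h ⊢
    simpa using h⟩

theorem conInl_conMap {n m n' m' : SimplexCategory} (a : n ⟶ n') (b : m ⟶ m') :
    conInl n m ≫ conMap a b = a ≫ conInl n' m' :=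
  SimplexCategory.Hom.ext _ _ (OrderHom.ext _ _ (funext fun i => conMap_left a b i))

theorem conInr_conMap {n m n' m' : SimplexCategory} (a : n ⟶ n') (b : m ⟶ m') :
    conInr n m ≫ conMap a b = b ≫ conInr n' m' :=
  SimplexCategory.Hom.ext _ _ (OrderHom.ext _ _ (funext fun i => conMap_right a b i))

theorem conInl_concat {n m : SimplexCategory} (x : ComposableArrows C n.len)
    (y : ComposableArrows C m.len) (α : x.obj (Fin.last _) ⟶ y.obj 0) :
    orderFunctor (conInl n m) ⋙ concat x y α = x := by
  have h : orderFunctor (conInl n m) ⋙ split n.len m.len = Join.inclLeft _ _ :=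
    CategoryTheory.Functor.ext (fun i => split_obj_left i) (fun _ _ _ => Subsingleton.elim _ _)
  exact congrArg (· ⋙ Join.mkFunctor x y (bridge x y α)) h

theorem conInr_concat {n m : SimplexCategory} (x : ComposableArrows C n.len)
    (y : ComposableArrows C m.len) (α : x.obj (Fin.last _) ⟶ y.obj 0) :
    orderFunctor (conInr n m) ⋙ concat x y α = y := by
  have h : orderFunctor (conInr n m) ⋙ split n.len m.len = Join.inclRight _ _ :=
    CategoryTheory.Functor.ext (fun i => split_obj_right i) (fun _ _ _ => Subsingleton.elim _ _)
  exact congrArg (· ⋙ Join.mkFunctor x y (bridge x y α)) h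

end Concatenation

section CommaObject

variable {C D : Type w} [SmallCategory C] [SmallCategory D] (F : D ⥤ C)

open Replacement Sect

theorem lastMap_id_elementsHom {n : SimplexCategoryᵒᵖ} (d : (nerve D).obj n) :
    lastMap (elementsHom (nerve D) (𝟙 n) d) = 𝟙 _ :=
  congrArg Quiver.Hom.unop ((tail D).map_id ⟨n, d⟩)

theorem lastMap_comp_elementsHom {n m l : SimplexCategoryᵒᵖ} (a : n ⟶ m) (b : m ⟶ l)
    (d : (nerve D).obj n) :
    lastMap (elementsHom (nerve D) (a ≫ b) d) =
      lastMap (elementsHom (nerve D) b ((nerve D).map a d)) ≫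
        lastMap (elementsHom (nerve D) a d) :=
  congrArg Quiver.Hom.unop
    ((tail D).map_comp (elementsHom (nerve D) a d)
      (elementsHom (nerve D) b ((nerve D).map a d)))

/-- For `𝐜` in `ℂ` and `n`, the set of pairs of a chain `𝐝 = (d₀ ⟶ ⋯ ⟶ dₙ)` in `D` and a map
`α : F(dₙ) ⟶ c₀`. -/
abbrev CommaObj (k : SimplexCategoryᵒᵖ × Replacement C) : Type w :=
  Σ d : (nerve D).obj k.1, (F.obj (last (C := D) ⟨k.1, d⟩) ⟶ k.2.first)

theorem comp_regroup {x₀ x₁ x₂ x₃ x₄ x₅ : C} (p : x₀ ⟶ x₁) (q : x₁ ⟶ x₂) (a : x₂ ⟶ x₃)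
    (r : x₃ ⟶ x₄) (s : x₄ ⟶ x₅) : (p ≫ q) ≫ a ≫ r ≫ s = p ≫ (q ≫ a ≫ r) ≫ s := by
  simp only [Category.assoc]

/-- A morphism `(n, 𝐜) ⟶ (n', 𝐜')` sends `(𝐝, α)` to the pulled back chain `𝐝'` together with
`F(d'ₙ') ⟶ F(dₙ) ⟶ c₀ ⟶ c'₀`. -/
def commaMap {k l : SimplexCategoryᵒᵖ × Replacement C} (f : k ⟶ l) (x : CommaObj F k) :
    CommaObj F l :=
  ⟨(nerve D).map f.1 x.1, F.map (lastMap (elementsHom (nerve D) f.1 x.1)) ≫ x.2 ≫ firstMap f.2⟩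

theorem commaMap_id (k : SimplexCategoryᵒᵖ × Replacement C) (x : CommaObj F k) :
    commaMap F (𝟙 k) x = x := by
  obtain ⟨d, α⟩ := x
  refine Sigma.ext rfl (heq_of_eq ?_)
  have h1 : F.map (lastMap (elementsHom (nerve D) (𝟙 k.1) d)) = 𝟙 _ :=
    (congrArg F.map (lastMap_id_elementsHom d)).trans (F.map_id _)
  have h2 : firstMap (𝟙 k.2) = 𝟙 _ := (head C).map_id k.2
  refine (congrArg₂ (fun s t => s ≫ α ≫ t) h1 h2).trans ?_
  exact (Category.id_comp _).trans (Category.comp_id _)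

theorem commaMap_comp {k l m : SimplexCategoryᵒᵖ × Replacement C} (f : k ⟶ l) (g : l ⟶ m)
    (x : CommaObj F k) : commaMap F (f ≫ g) x = commaMap F g (commaMap F f x) := by
  obtain ⟨d, α⟩ := x
  refine Sigma.ext rfl (heq_of_eq ?_)
  have h1 : F.map (lastMap (elementsHom (nerve D) (f.1 ≫ g.1) d)) = _ :=
    (congrArg F.map (lastMap_comp_elementsHom f.1 g.1 d)).trans (F.map_comp _ _)
  have h2 : firstMap (f.2 ≫ g.2) = firstMap f.2 ≫ firstMap g.2 := (head C).map_comp f.2 g.2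
  refine (congrArg₂ (fun s t => s ≫ α ≫ t) h1 h2).trans ?_
  exact comp_regroup _ _ _ _ _

/-- The sets of pairs `(𝐝, α)`, as a functor of `(n, 𝐜)`. -/
def comma : SimplexCategoryᵒᵖ × Replacement C ⥤ Type w where
  obj k := CommaObj F k
  map f := ↾commaMap F f
  map_id k := ConcreteCategory.hom_ext _ _ (commaMap_id F k)
  map_comp f g := ConcreteCategory.hom_ext _ _ (commaMap_comp F f g)

/-- The simplicial comma object `𝔽 // ℂ`: its objects are the triples `(𝐝, 𝐜, α : F(dₙ) ⟶ c₀)`,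
its morphisms are pairs of morphisms of `𝔻` and `ℂ` compatible with the maps `α`. -/
abbrev CommaObject := (comma F).Elements

namespace CommaObject

variable {F}

/-- The chain `𝐝` of the triple `(𝐝, 𝐜, α)`. -/
abbrev dPart (z : CommaObject F) : Replacement D := ⟨z.1.1, z.2.1⟩

/-- The chain `𝐜` of the triple `(𝐝, 𝐜, α)`. -/
abbrev cPart (z : CommaObject F) : Replacement C := z.1.2

/-- The map `α` of the triple `(𝐝, 𝐜, α)`. -/
abbrev link (z : CommaObject F) : F.obj z.dPart.last ⟶ z.cPart.first := z.2.2

/-- The action of a morphism of `𝔽 // ℂ` on the chains in `D`. -/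
abbrev dMap {z z' : CommaObject F} (f : z ⟶ z') : z.dPart ⟶ z'.dPart :=
  ⟨f.1.1, congrArg Sigma.fst f.2⟩

/-- The action of a morphism of `𝔽 // ℂ` on the chains in `C`. -/
abbrev cMap {z z' : CommaObject F} (f : z ⟶ z') : z.cPart ⟶ z'.cPart := f.1.2

/-- The square satisfied by a morphism of `𝔽 // ℂ`. -/
theorem comm {z z' : CommaObject F} (f : z ⟶ z') :
    F.map (lastMap (dMap f)) ≫ z.link ≫ firstMap (cMap f) = z'.link := by
  obtain ⟨⟨n, c⟩, x⟩ := z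
  obtain ⟨⟨m, c'⟩, x'⟩ := z'
  obtain ⟨(f : (n, c) ⟶ (m, c')), hf⟩ := f
  change (comma F).map f x = x' at hf
  subst hf
  rfl

variable (F) in
/-- The functor `(𝐝, 𝐜, α) ↦ 𝐝`. -/
def prD : CommaObject F ⥤ Replacement D where
  obj z := z.dPart
  map f := dMap f

variable (F) in
/-- The functor `(𝐝, 𝐜, α) ↦ 𝐜`. -/
abbrev prC : CommaObject F ⥤ Replacement C :=
  CategoryOfElements.π (comma F) ⋙ forgetDegree (Replacement C)

/-- The concatenation `F(d₀) ⟶ ⋯ ⟶ F(dₙ) ⟶ c₀ ⟶ ⋯ ⟶ cₘ`. -/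
noncomputable abbrev join (z : CommaObject F) : Replacement C :=
  ⟨op (con z.dPart.1.unop z.cPart.1.unop),
    concat (((Replacement.map F).obj z.dPart).chain) z.cPart.chain z.link⟩

theorem join_map {z z' : CommaObject F} (f : z ⟶ z') :
    (nerve C).map (conMap (dMap f).1.unop (cMap f).1.unop).op z.join.2 = z'.join.2 := by
  obtain ⟨⟨n, ⟨p, c⟩⟩, ⟨d, α⟩⟩ := z
  obtain ⟨⟨m, ⟨q, c'⟩⟩, x'⟩ := z'
  obtain ⟨⟨(a : n ⟶ m), ⟨(b : p ⟶ q), hb⟩⟩, hf⟩ := f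
  change (nerve C).map b c = c' at hb
  subst hb
  change commaMap F (k := (n, ⟨p, c⟩)) (a, elementsHom (nerve C) b c) ⟨d, α⟩ = x' at hf
  subst hf
  refine (concat_map a.unop b.unop (((Replacement.map F).obj ⟨n, d⟩).chain) c α).trans ?_
  refine congrArg (concat (n := m.unop.len) (m := q.unop.len) _ _) ?_
  refine congrArg₂ (· ≫ α ≫ ·) ?_ ?_
  · exact congrArg F.map (Category.id_comp _).symm
  · exact (Category.comp_id _).symm

variable (F) in
/-- The concatenation functor `(𝐝, 𝐜, α) ↦ 𝔽𝐝 * 𝐜`. -/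
noncomputable def pr : CommaObject F ⥤ Replacement C where
  obj z := z.join
  map f := ⟨(conMap (dMap f).1.unop (cMap f).1.unop).op, join_map f⟩
  map_id _ := Subtype.ext (congrArg Quiver.Hom.op (conMap_id _ _))
  map_comp _ _ := Subtype.ext (congrArg Quiver.Hom.op (conMap_comp _ _ _ _))

variable (F) in
/-- The transformation `𝔽𝐝 * 𝐜 ⟶ 𝔽𝐝`, which restricts chains to an initial segment. -/
noncomputable def toD : pr F ⟶ prD F ⋙ Replacement.map F where
  app z := ⟨(conInl z.dPart.1.unop z.cPart.1.unop).op,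
    conInl_concat (((Replacement.map F).obj z.dPart).chain) z.cPart.chain z.link⟩
  naturality _ _ _ := Subtype.ext (congrArg Quiver.Hom.op (conInl_conMap _ _))

variable (F) in
/-- The transformation `𝔽𝐝 * 𝐜 ⟶ 𝐜`, which restricts chains to a final segment. -/
noncomputable def toC : pr F ⟶ prC F where
  app z := ⟨(conInr z.dPart.1.unop z.cPart.1.unop).op,
    conInr_concat (((Replacement.map F).obj z.dPart).chain) z.cPart.chain z.link⟩
  naturality _ _ _ := Subtype.ext (congrArg Quiver.Hom.op (conInr_conMap _ _))

theorem isAnchor_toD (z : CommaObject F) : IsAnchor ((toD F).app z) := fun _ => rfl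

theorem tail_obj_pr (z : CommaObject F) :
    (tail C).obj ((pr F).obj z) = (tail C).obj ((prC F).obj z) :=
  congrArg op (obj_under ((toC F).app z) (Fin.last _))

theorem tail_map_toC (z : CommaObject F) :
    (tail C).map ((toC F).app z) = eqToHom (tail_obj_pr z) := by
  refine (congrArg Quiver.Hom.op (lastMap_eq ((toC F).app z) rfl)).trans ?_
  exact eqToHom_op _

/-- Concatenation does not change the last object of the chain in `C`. -/
theorem pr_tail : pr F ⋙ tail C = prC F ⋙ tail C := by
  refine CategoryTheory.Functor.ext tail_obj_pr fun z z' f => ?_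
  have n := (Functor.whiskerRight (toC F) (tail C)).naturality f
  change (pr F ⋙ tail C).map f ≫ (tail C).map ((toC F).app z') =
    (tail C).map ((toC F).app z) ≫ (prC F ⋙ tail C).map f at n
  rw [tail_map_toC, tail_map_toC] at n
  change _ = eqToHom (tail_obj_pr z) ≫ (prC F ⋙ tail C).map f ≫ eqToHom (tail_obj_pr z').symm
  rw [← Category.assoc, ← n, Category.assoc, eqToHom_trans, eqToHom_refl, Category.comp_id]

end CommaObject
end CommaObject

theorem isHomLift_id_of_eqToHom {B : Type u₁} [Category.{v₁} B] {F : Type u} [Category.{v} F]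
    {q : F ⥤ B} {a b : B} {f : a ⟶ b} {h : a = b} (hf : f = eqToHom h) {x y : F} {φ : x ⟶ y}
    (hφ : q.IsHomLift f φ) : q.IsHomLift (𝟙 b) φ := by
  subst h hf
  exact hφ

section Presections

variable {C D : Type w} [SmallCategory C] [SmallCategory D] {E : Type u} [Category.{v} E]

open Replacement Sect CommaObject

/-- The category of presections of an opfibration `p : E ⥤ C`: the sections over `ℂ` of the
pullback of the transpose fibration of `p` along the functor `ℂ ⥤ Cᵒᵖ` sending a chain to its
last object. -/
abbrev PSect (p : E ⥤ C) [IsOpfibration p] := Sect (Transpose.proj p) (tail C)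

/-- The category of presections over `𝔻` of the pullback of `p` along `F : D ⥤ C`: the sections
over `𝔻` of the pullback along `𝔽` of the fibration over `ℂ`. -/
abbrev PSectAlong (p : E ⥤ C) [IsOpfibration p] (F : D ⥤ C) :=
  Sect (Transpose.proj p) (Replacement.map F ⋙ tail C)

/-- The functor `𝔽^*` of pullback of presections. -/
noncomputable abbrev pullback (p : E ⥤ C) [IsOpfibration p] (F : D ⥤ C) : PSect p ⥤ PSectAlong p F :=
  precomp (Transpose.proj p) (tail C) (Replacement.map F)

variable {p : E ⥤ C} [IsOpfibration p]

/-- A morphism is weakly Cartesian if it is a weak equivalence followed by a Cartesian morphism. -/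
def IsWeaklyCartesian (W : MorphismProperty E) {x z : Transpose p} (φ : x ⟶ z) : Prop :=
  ∃ (y : Transpose p) (ω : x ⟶ y) (κ : y ⟶ z), transposeW W ω ∧
    (Transpose.proj p).IsCartesian ((Transpose.proj p).map κ) κ ∧ ω ≫ κ = φ

/-- A derived section is a presection which sends the anchor maps to weakly Cartesian morphisms. -/
def IsDerivedSection (W : MorphismProperty E) (A : PSect p) : Prop :=
  ∀ ⦃x y : Replacement C⦄ (f : x ⟶ y), IsAnchor f → IsWeaklyCartesian W (A.functor.map f)

namespace HomotopicalDeltaOpfibration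

variable (H : HomotopicalDeltaOpfibration.{w} p) (F : D ⥤ C)

/-- The pointwise weak equivalences of presections. -/
abbrev weq : MorphismProperty (PSect p) := Sect.weakEquivalences (transposeW H.W)

theorem hasCoproduct (H : HomotopicalDeltaOpfibration.{w} p) (b : Cᵒᵖ) (T : Type w)
    (x : T → Functor.Fiber (Transpose.proj p) b) :
    HasCoproduct x :=
  have := H.cocomplete b
  inferInstance

theorem hasCoend (b : Cᵒᵖ) (X : SimplexCategoryᵒᵖ ⥤ Functor.Fiber (Transpose.proj p) b) :
    HasCoend ((H.isOver.fiber b).integrand X) :=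
  have := H.cocomplete b
  inferInstance

/-- The functor `Π_!` from sections over `𝔽 // ℂ` to simplicial presections: the fibrewise
coproduct over the pairs `(𝐝, α)`. -/
noncomputable def bar : Sect (Transpose.proj p) (prC F ⋙ tail C) ⥤
    Sect (Transpose.proj p) (forgetDegree (Replacement C) ⋙ tail C) :=
  have := H.hasCoproduct
  Sect.coprod (Transpose.proj p) (comma F) (forgetDegree (Replacement C) ⋙ tail C)

/-- The geometric realisation of simplicial presections. -/
noncomputable def geom :
    Sect (Transpose.proj p) (forgetDegree (Replacement C) ⋙ tail C) ⥤ PSect p :=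
  have := H.hasCoend
  realize H.isOver (tail C)

/-- Sections of the pullback of the fibration along `𝔽𝐝 * 𝐜` are sections of the pullback along
`𝐜`, since both chains have the same last object. -/
noncomputable abbrev descent (p : E ⥤ C) [IsOpfibration p] (F : D ⥤ C) :
    Sect (Transpose.proj p) (pr F ⋙ tail C) ⥤ Sect (Transpose.proj p) (prC F ⋙ tail C) :=
  Sect.congr (Transpose.proj p) pr_tail

/-- The functor `S ↦ R_𝔽 pr_D^* S`, whose value at `(𝐝, 𝐜, α)` is the image of `S(𝐝)` under the
transition functor along `F(dₙ) ⟶ c₀ ⟶ cₘ`. -/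
noncomputable abbrev restriction (p : E ⥤ C) [IsOpfibration p] (F : D ⥤ C) :
    PSectAlong p F ⥤ Sect (Transpose.proj p) (pr F ⋙ tail C) :=
  precomp (Transpose.proj p) (Replacement.map F ⋙ tail C) (prD F) ⋙
    restrict (Transpose.proj p) (Functor.whiskerRight (toD F) (tail C))

/-- The derived pushforward `𝔽_!`: the realisation of
`[n] ↦ ∐_{𝐝, α : F(dₙ) ⟶ c₀} (F(dₙ) ⟶ c₀ ⟶ cₘ)_! S(𝐝)`. -/
noncomputable def pushforwardFunctor : PSectAlong p F ⥤ PSect p :=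
  restriction p F ⋙ descent p F ⋙ H.bar F ⋙ H.geom

/-- The functor `A ↦ A^𝔽`: the realisation of `[n] ↦ ∐_{𝐝, α : F(dₙ) ⟶ c₀} A(𝔽𝐝 * 𝐜)`. -/
noncomputable def augmented : PSect p ⥤ PSect p :=
  precomp (Transpose.proj p) (tail C) (pr F) ⋙ descent p F ⋙ H.bar F ⋙ H.geom

/-- The maps `A(𝔽𝐝 * 𝐜) ⟶ (F(dₙ) ⟶ c₀ ⟶ cₘ)_! A(𝔽𝐝)` given by the action of `A` on the anchor
maps `𝔽𝐝 * 𝐜 ⟶ 𝔽𝐝`. -/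
noncomputable def anchorActionApp (A : PSect p) :
    (precomp (Transpose.proj p) (tail C) (pr F)).obj A ⟶
      (pullback p F ⋙ restriction p F).obj A :=
  toRestrict (Functor.whiskerRight (toD F) (tail C))
    (A := (precomp (Transpose.proj p) (Replacement.map F ⋙ tail C) (prD F)).obj
      ((pullback p F).obj A))
    (Functor.whiskerRight (toD F) A.functor) (fun z => A.isHomLift ((toD F).app z))

variable (p) in
/-- The maps `A(𝔽𝐝 * 𝐜) ⟶ (F(dₙ) ⟶ c₀ ⟶ cₘ)_! A(𝔽𝐝)`, as a natural transformation. -/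
noncomputable def anchorAction :
    precomp (Transpose.proj p) (tail C) (pr F) ⟶ pullback p F ⋙ restriction p F where
  app A := anchorActionApp F A
  naturality A A' τ := toRestrict_naturality (Functor.whiskerRight (toD F) (tail C))
    (X := (precomp (Transpose.proj p) (tail C) (pr F)).obj A)
    (X' := (precomp (Transpose.proj p) (tail C) (pr F)).obj A')
    (A := (precomp (Transpose.proj p) (Replacement.map F ⋙ tail C) (prD F)).obj
      ((pullback p F).obj A))
    (A' := (precomp (Transpose.proj p) (Replacement.map F ⋙ tail C) (prD F)).obj
      ((pullback p F).obj A'))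
    (Functor.whiskerRight (toD F) A.functor) (fun z => A.isHomLift ((toD F).app z))
    (Functor.whiskerRight (toD F) A'.functor) (fun z => A'.isHomLift ((toD F).app z))
    ((precomp (Transpose.proj p) (tail C) (pr F)).map τ)
    ((precomp (Transpose.proj p) (Replacement.map F ⋙ tail C) (prD F)).map ((pullback p F).map τ))
    (fun z => (τ.app.naturality ((toD F).app z)).symm)

variable (p) in
/-- The maps `A(𝔽𝐝 * 𝐜) ⟶ A(𝐜)` given by the action of `A` on the structural maps
`𝔽𝐝 * 𝐜 ⟶ 𝐜`. -/
noncomputable def structuralAction :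
    precomp (Transpose.proj p) (tail C) (pr F) ⋙ descent p F ⟶
      precomp (Transpose.proj p) (tail C) (prC F) where
  app A := mkHom (Functor.whiskerRight (toC F) A.functor) (fun z =>
    isHomLift_id_of_eqToHom (tail_map_toC z) (A.isHomLift ((toC F).app z)))
  naturality _ _ τ := Sect.hom_ext fun z => (τ.app.naturality ((toC F).app z)).symm

/-- The folding map `∐_{𝐝, α} A(𝐜) ⟶ A(𝐜)` to the constant simplicial presection. -/
noncomputable def foldBar :
    precomp (Transpose.proj p) (forgetDegree (Replacement C) ⋙ tail C)
      (CategoryOfElements.π (comma F)) ⋙ H.bar F ⟶ 𝟭 _ :=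
  have := H.hasCoproduct
  fold (Transpose.proj p) (comma F) (forgetDegree (Replacement C) ⋙ tail C)

/-- The map `|A| ⟶ A` from the realisation of the constant simplicial presection. -/
noncomputable def geomConst :
    precomp (Transpose.proj p) (tail C) (forgetDegree (Replacement C)) ⋙ H.geom ⟶ 𝟭 (PSect p) :=
  have := H.hasCoend
  realizeConst H.isOver (tail C)

/-- The left map `A^𝔽 ⟶ 𝔽_! 𝔽^* A` of the counit span. -/
noncomputable def counitLeft : H.augmented F ⟶ pullback p F ⋙ H.pushforwardFunctor F :=
  Functor.whiskerRight (anchorAction p F) (descent p F ⋙ H.bar F ⋙ H.geom)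

/-- The right map `A^𝔽 ⟶ A` of the counit span. -/
noncomputable def counitRight : H.augmented F ⟶ 𝟭 (PSect p) :=
  Functor.whiskerRight (structuralAction p F) (H.bar F ⋙ H.geom) ≫
    Functor.whiskerLeft (precomp (Transpose.proj p) (tail C) (forgetDegree (Replacement C)))
      (Functor.whiskerRight (H.foldBar F) H.geom) ≫ H.geomConst

/-- The homotopy category of presections: the localisation at the weak equivalences. -/
abbrev Ho := H.weq.Localization

/-- The counit `ε : 𝔽_! 𝔽^* A ⟶ A` in the homotopy category of presections, for a presection `A`
such that the left map of the counit span is a weak equivalence: the inverse of the left map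
followed by the right map. -/
noncomputable def counit (A : PSect p) (h : H.weq ((H.counitLeft F).app A)) :
    H.weq.Q.obj ((H.pushforwardFunctor F).obj ((pullback p F).obj A)) ⟶ H.weq.Q.obj A :=
  (Localization.Construction.wIso _ h).inv ≫ H.weq.Q.map ((H.counitRight F).app A)

end HomotopicalDeltaOpfibration

/-- A resolution is an opfibration whose fibres have contractible nerves. -/
structure IsResolution (F : D ⥤ C) : Prop where
  opfibration : IsOpfibration F
  contractible (c : C) : IsContractible (nerve (Functor.Fiber F c))

end Presections

end DerSect

/-! Weak equivalences of presections are pointwise, so a chain `c = (c₀ → ⋯ → cₘ)` is fixed and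
everything happens in one fibre, a homotopical `Δ`-category.

The left map needs nothing of `F`. Since `A` is derived, the anchor map `Fd * c → Fd` goes to a
weakly Cartesian map, so its comparison `A(Fd * c) → (F(dₙ) → cₘ)_! A(Fd)` with the Cartesian lift
is a weak equivalence. Coproducts and realisations preserve weak equivalences.

For the right map, the pairs `(d, α : F(dₙ) → c₀)` are the simplices of the nerve of the comma
category `I = F / c₀` (`commaSimplex_bijective`). Thus `A^F(c)` is the realisation of `n ↦ ∐_{x ∈
N(I)_n} B(x)` with `B(x) = A(Fd * c)`, and the right map is induced by an augmentation of `B`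
towards `A(c)`. Three facts are used. The functor `B` sends anchor maps to weak equivalences, by
comparison of both sides with values of `A` on chains from `D` (`commaDiagram_map_mem`). Since `F`
is an opfibration, the strict fibre `D(c₀)` is reflective in `F / c₀`: an opCartesian lift of `α` is
the reflection (`exists_isReflection_inFiber`). On chains inside `D(c₀)` the concatenation `Fd * c`
is a degeneracy of `c`, and the augmentation is a weak equivalence (`commaAugmentation_app_mem`).

The rest is a cofinality argument valid for any such `B` (`augment_chains`). Let `P` be the
reflective property and consider the bisimplicial object of the `B(x * y)`, over concatenated chains
whose right part `y` lies in `P`. It projects to the chains `x` in `I` and to the chains `y` in `P`,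
and both projections realise to weak equivalences. Over a fixed `x`, one first replaces `B(x * y)`
by `B(x)` along an anchor map; then the possible `y` contract to the reflection of the last object
of `x`. Over a fixed `y`, the part `x` contracts to the first object of `y`. Finally, on the chains
in `P` the functor `B` is weakly constant, so its realisation is that of `n ↦ ∐ b` over the nerve of
`P`; this is `N(P) ⊗ b`, which is weakly equivalent to `b` since `N(P)` is contractible.
Two-out-of-three finishes the argument.

Two technical results carry this. If the rows of a bisimplicial object resolve the `X_n`, its
diagonal realises to `|X|` up to weak equivalence (`realizationMap_diagonalAugmentation`); the proof
combines the diagonal axiom with a Fubini isomorphism. And simplicially homotopic maps have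
realisations that are weak equivalences together (`realizationMap_iff_of_levelHomotopy`). The
homotopies themselves are combinatorial: they live in a category of families of simplices and are
carried to the fibre by the functor `total B`. -/

namespace DerSect

/-! ### Geometric realisation and augmented simplicial objects -/

section RealizationAugmentation

variable {M : Type u} [Category.{v} M]

namespace DeltaStructure

variable (D : DeltaStructure M)

theorem collapse_zero (b : M) : D.collapse ⦋0⦌ b = D.unit.hom.app b := by
  unfold collapse
  have h : SimplexCategory.const ⦋0⦌ ⦋0⦌ 0 = 𝟙 _ := Subsingleton.elim _ _
  rw [h, D.tensor.map_id]
  simp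

section

variable [∀ X : SimplexCategoryᵒᵖ ⥤ M, HasCoend (D.integrand X)]

/-- The canonical map `Δ^n ⊗ X_n ⟶ |X|`. -/
noncomputable def realizationι (X : SimplexCategoryᵒᵖ ⥤ M) (n : SimplexCategoryᵒᵖ) :
    (D.tensor.obj n.unop).obj (X.obj n) ⟶ D.realization X :=
  coend.ι (D.integrand X) n

variable {D} in
theorem realization_hom_ext {X : SimplexCategoryᵒᵖ ⥤ M} {b : M} {f g : D.realization X ⟶ b}
    (h : ∀ n, D.realizationι X n ≫ f = D.realizationι X n ≫ g) : f = g :=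
  coend.hom_ext h

theorem realizationι_condition (X : SimplexCategoryᵒᵖ ⥤ M) {m n : SimplexCategoryᵒᵖ} (a : m ⟶ n) :
    (D.tensor.map a.unop).app (X.obj m) ≫ D.realizationι X m =
      (D.tensor.obj n.unop).map (X.map a) ≫ D.realizationι X n :=
  coend.condition (D.integrand X) a

/-- The universal property of the realisation. -/
noncomputable def realizationDesc (X : SimplexCategoryᵒᵖ ⥤ M) {b : M}
    (φ : ∀ n, (D.tensor.obj n.unop).obj (X.obj n) ⟶ b)
    (hφ : ∀ ⦃m n : SimplexCategoryᵒᵖ⦄ (a : m ⟶ n), (D.tensor.map a.unop).app (X.obj m) ≫ φ m =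
      (D.tensor.obj n.unop).map (X.map a) ≫ φ n) : D.realization X ⟶ b :=
  coend.desc (F := D.integrand X) φ hφ

@[simp]
theorem realizationι_desc (X : SimplexCategoryᵒᵖ ⥤ M) {b : M}
    (φ : ∀ n, (D.tensor.obj n.unop).obj (X.obj n) ⟶ b)
    (hφ : ∀ ⦃m n : SimplexCategoryᵒᵖ⦄ (a : m ⟶ n), (D.tensor.map a.unop).app (X.obj m) ≫ φ m =
      (D.tensor.obj n.unop).map (X.map a) ≫ φ n) (n : SimplexCategoryᵒᵖ) :
    D.realizationι X n ≫ D.realizationDesc X φ hφ = φ n :=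
  coend.ι_desc (F := D.integrand X) φ hφ n

theorem realizationι_map {X Y : SimplexCategoryᵒᵖ ⥤ M} (f : X ⟶ Y) (n : SimplexCategoryᵒᵖ) :
    D.realizationι X n ≫ D.realizationMap f =
      (D.tensor.obj n.unop).map (f.app n) ≫ D.realizationι Y n :=
  D.ι_realizationMap f n

theorem realizationMap_id (X : SimplexCategoryᵒᵖ ⥤ M) : D.realizationMap (𝟙 X) = 𝟙 _ :=
  realization_hom_ext fun n => by rw [realizationι_map]; simp

theorem realizationMap_comp {X Y Z : SimplexCategoryᵒᵖ ⥤ M} (f : X ⟶ Y) (g : Y ⟶ Z) :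
    D.realizationMap (f ≫ g) = D.realizationMap f ≫ D.realizationMap g :=
  realization_hom_ext fun n => by
    rw [realizationι_map, ← Category.assoc, realizationι_map, Category.assoc, realizationι_map]
    simp

/-- The geometric realisation, as a functor. -/
noncomputable def realizationFunctor : (SimplexCategoryᵒᵖ ⥤ M) ⥤ M where
  obj X := D.realization X
  map f := D.realizationMap f
  map_id := D.realizationMap_id
  map_comp := D.realizationMap_comp

/-- The map `|X| ⟶ b` induced by an augmentation `X ⟶ b`. -/
noncomputable def augment {X : SimplexCategoryᵒᵖ ⥤ M} {b : M}
    (e : X ⟶ (Functor.const _).obj b) : D.realization X ⟶ b :=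
  D.realizationDesc X (fun n => (D.tensor.obj n.unop).map (e.app n) ≫ D.collapse n.unop b)
    (fun m n a => by
      have h : X.map a ≫ e.app n = e.app m := (e.naturality a).trans (Category.comp_id _)
      rw [← NatTrans.naturality_assoc, ← Functor.map_comp_assoc, h]
      exact congrArg (_ ≫ ·) (D.tensor_map_collapse a.unop b))

theorem realizationι_augment {X : SimplexCategoryᵒᵖ ⥤ M} {b : M}
    (e : X ⟶ (Functor.const _).obj b) (n : SimplexCategoryᵒᵖ) :
    D.realizationι X n ≫ D.augment e =
      (D.tensor.obj n.unop).map (e.app n) ≫ D.collapse n.unop b :=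
  D.realizationι_desc _ _ _ n

theorem realizationMap_augment {X Y : SimplexCategoryᵒᵖ ⥤ M} {b : M} (f : X ⟶ Y)
    (e : Y ⟶ (Functor.const _).obj b) : D.realizationMap f ≫ D.augment e = D.augment (f ≫ e) :=
  realization_hom_ext fun n => by
    rw [← Category.assoc, realizationι_map, Category.assoc, realizationι_augment,
      realizationι_augment]
    simp

/-- Since `[0]` is terminal in `Δ`, the coend condition along `[n] → [0]` makes every `Δ^n ⊗ b →
|b|` factor through `Δ^0 ⊗ b ≅ b`. The inverse is therefore the inclusion in degree `0`. -/
instance (b : M) : IsIso (D.augment (𝟙 ((Functor.const SimplexCategoryᵒᵖ).obj b))) := by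
  refine ⟨D.unit.inv.app b ≫ D.realizationι ((Functor.const _).obj b) (op ⦋0⦌), ?_, ?_⟩
  · refine realization_hom_ext fun n => ?_
    have h := D.realizationι_condition ((Functor.const SimplexCategoryᵒᵖ).obj b)
      (SimplexCategory.const n.unop ⦋0⦌ 0).op
    rw [← Category.assoc, realizationι_augment]
    simp only [Functor.const_obj_obj, NatTrans.id_app, CategoryTheory.Functor.map_id,
      Category.id_comp, Category.comp_id, collapse, Category.assoc]
    rw [Iso.hom_inv_id_app_assoc]
    refine h.trans ?_
    simp
  · rw [Category.assoc, realizationι_augment]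
    have h := D.collapse_zero b
    simp only [Functor.const_obj_obj, NatTrans.id_app, CategoryTheory.Functor.map_id,
      Category.id_comp]
    exact (congrArg (D.unit.inv.app b ≫ ·) h).trans (D.unit.inv_hom_id_app b)

/-- Up to the isomorphism `|b| ≅ b`, an augmentation is the realisation of a map to a constant
object, so homotopy invariance of realisations applies to it. -/
theorem augment_eq {X : SimplexCategoryᵒᵖ ⥤ M} {b : M} (e : X ⟶ (Functor.const _).obj b) :
    D.augment e = D.realizationMap e ≫ D.augment (𝟙 ((Functor.const SimplexCategoryᵒᵖ).obj b)) := by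
  rw [realizationMap_augment, Category.comp_id]

end

/-! ### Coends and coproducts under a cocontinuous functor -/

section Preservation

theorem preservesColimitsOfShape_of_small (T : M ⥤ M) [PreservesColimitsOfSize.{w, w} T] (J : Type)
    [Category.{0} J] : PreservesColimitsOfShape J T :=
  have : PreservesColimitsOfSize.{0, 0} T := preservesColimitsOfSize_of_univLE.{w, w} T
  inferInstance

section

variable {J : Type} [SmallCategory J] (G : Jᵒᵖ ⥤ J ⥤ M) [HasCoend G] (T : M ⥤ M)
  [PreservesColimitsOfSize.{w, w} T]

/-- With `exists_map_coend_desc` this is the universal property of `T(∫ G)`: the functor `T`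
preserves the multicoequaliser that defines the coend. It is applied with `T = Δ^n ⊗ -`. -/
theorem map_coend_hom_ext {b : M} {f g : T.obj (coend G) ⟶ b}
    (h : ∀ j, T.map (coend.ι G j) ≫ f = T.map (coend.ι G j) ≫ g) : f = g := by
  have := preservesColimitsOfShape_of_small.{w} T (WalkingMultispan (multispanShapeCoend J))
  refine (isColimitOfPreserves T (colimit.isColimit (multispanIndexCoend G).multispan)).hom_ext ?_
  rintro (i | j)
  -- The legs of the multispan at its apices factor through the legs at the objects, where the
  -- hypothesis applies.
  · have e := colimit.w (multispanIndexCoend G).multispan (WalkingMultispan.Hom.fst i)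
    have e' := (congrArg T.map e).symm.trans (T.map_comp _ _)
    refine (congrArg (· ≫ f) e').trans (Eq.trans ?_ (congrArg (· ≫ g) e').symm)
    refine (Category.assoc _ _ _).trans (Eq.trans ?_ (Category.assoc _ _ _).symm)
    exact congrArg _ (h _)
  · exact h j

theorem exists_map_coend_desc {b : M} (φ : ∀ j, T.obj ((G.obj (op j)).obj j) ⟶ b)
    (hφ : ∀ ⦃i j : J⦄ (a : i ⟶ j), T.map ((G.map a.op).app i) ≫ φ i =
      T.map ((G.obj (op j)).map a) ≫ φ j) :
    ∃ f : T.obj (coend G) ⟶ b, ∀ j, T.map (coend.ι G j) ≫ f = φ j := by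
  have := preservesColimitsOfShape_of_small.{w} T (WalkingMultispan (multispanShapeCoend J))
  let c : Cocone ((multispanIndexCoend G).multispan ⋙ T) :=
    { pt := b
      ι :=
        { app := fun k => match k with
            | .left i => T.map ((G.map i.hom.op).app i.left) ≫ φ i.left
            | .right j => φ j
          naturality := by
            rintro _ _ (_ | i | i)
            · dsimp
              refine (congrArg (· ≫ _) ?_).trans
                ((Category.id_comp _).trans (Category.comp_id _).symm)
              exact (congrArg T.map ((multispanIndexCoend G).multispan.map_id _)).trans (T.map_id _)
            · exact (Category.comp_id _).symm
            · exact (hφ i.hom).symm.trans (Category.comp_id _).symm } }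
  exact ⟨(isColimitOfPreserves T (colimit.isColimit (multispanIndexCoend G).multispan)).desc c,
    fun j => (isColimitOfPreserves T
      (colimit.isColimit (multispanIndexCoend G).multispan)).fac c (.right j)⟩

end

section

variable {J : Type w} (x : J → M) (T : M ⥤ M) [PreservesColimitsOfSize.{w, w} T]

/-- With `exists_map_sigma_desc`, the universal property of the coproduct `T(∐ x)` of the `T(x j)`.
-/
theorem map_sigma_hom_ext [HasCoproduct x] {b : M} {f g : T.obj (∐ x) ⟶ b}
    (h : ∀ j, T.map (Limits.Sigma.ι x j) ≫ f = T.map (Limits.Sigma.ι x j) ≫ g) : f = g := by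
  have : PreservesColimitsOfSize.{0, w} T := preservesColimitsOfSize_of_univLE.{w, w} T
  refine (isColimitOfPreserves T (colimit.isColimit (Discrete.functor x))).hom_ext ?_
  rintro ⟨j⟩
  exact h j

theorem exists_map_sigma_desc [HasCoproduct x] {b : M} (φ : ∀ j, T.obj (x j) ⟶ b) :
    ∃ f : T.obj (∐ x) ⟶ b, ∀ j, T.map (Limits.Sigma.ι x j) ≫ f = φ j := by
  have : PreservesColimitsOfSize.{0, w} T := preservesColimitsOfSize_of_univLE.{w, w} T
  let c : Cocone (Discrete.functor x ⋙ T) :=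
    { pt := b
      ι := Discrete.natTrans fun j => φ j.as }
  exact ⟨(isColimitOfPreserves T (colimit.isColimit (Discrete.functor x))).desc c,
    fun j => (isColimitOfPreserves T (colimit.isColimit (Discrete.functor x))).fac c ⟨j⟩⟩

end

end Preservation

end DeltaStructure

end RealizationAugmentation

/-! ### Realising a bisimplicial object by rows and along the diagonal -/

section Bisimplicial

variable {M : Type u} [Category.{v} M]

namespace DeltaStructure

variable (D : DeltaStructure M)

/-- The canonical map `Δ^n ⊗ (Δ^m ⊗ Z_{nm}) ⟶ ∫ Δ^• ⊗ (Δ^• ⊗ Z)`. -/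
noncomputable def biι (Z : SimplexCategoryᵒᵖ × SimplexCategoryᵒᵖ ⥤ M) [HasCoend (D.biIntegrand Z)]
    (n m : SimplexCategoryᵒᵖ) :
    (D.tensor.obj n.unop).obj ((D.tensor.obj m.unop).obj (Z.obj (n, m))) ⟶
      coend (D.biIntegrand Z) :=
  coend.ι (D.biIntegrand Z) (n, m)

theorem biι_condition (Z : SimplexCategoryᵒᵖ × SimplexCategoryᵒᵖ ⥤ M)
    [HasCoend (D.biIntegrand Z)] {n n' m m' : SimplexCategoryᵒᵖ} (a : n ⟶ n') (b : m ⟶ m') :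
    (D.tensor.map a.unop).app _ ≫ (D.tensor.obj n.unop).map ((D.tensor.map b.unop).app _) ≫
        D.biι Z n m =
      (D.tensor.obj n'.unop).map ((D.tensor.obj m'.unop).map (Z.map (Prod.mkHom a b))) ≫
        D.biι Z n' m' := by
  refine Eq.trans ?_ (coend.condition (D.biIntegrand Z) (i := (n, m)) (j := (n', m')) (a, b))
  exact (Category.assoc _ _ _).symm

variable [∀ X : SimplexCategoryᵒᵖ ⥤ M, HasCoend (D.integrand X)]

/-- The simplicial object `n ↦ |Z_{n•}|`. -/
noncomputable def rowRealization (Z : SimplexCategoryᵒᵖ × SimplexCategoryᵒᵖ ⥤ M) :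
    SimplexCategoryᵒᵖ ⥤ M :=
  Functor.curry.obj Z ⋙ D.realizationFunctor

/-- The canonical map `Δ^m ⊗ Z_{nm} ⟶ |Z_{n•}|`. -/
noncomputable def rowι (Z : SimplexCategoryᵒᵖ × SimplexCategoryᵒᵖ ⥤ M)
    (n m : SimplexCategoryᵒᵖ) :
    (D.tensor.obj m.unop).obj (Z.obj (n, m)) ⟶ (D.rowRealization Z).obj n :=
  D.realizationι ((Functor.curry.obj Z).obj n) m

theorem rowι_condition (Z : SimplexCategoryᵒᵖ × SimplexCategoryᵒᵖ ⥤ M)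
    (n : SimplexCategoryᵒᵖ) {m m' : SimplexCategoryᵒᵖ} (b : m ⟶ m') :
    (D.tensor.map b.unop).app (Z.obj (n, m)) ≫ D.rowι Z n m =
      (D.tensor.obj m'.unop).map (Z.map (Prod.mkHom (𝟙 n) b)) ≫ D.rowι Z n m' :=
  D.realizationι_condition ((Functor.curry.obj Z).obj n) b

theorem rowι_map (Z : SimplexCategoryᵒᵖ × SimplexCategoryᵒᵖ ⥤ M)
    {n n' : SimplexCategoryᵒᵖ} (a : n ⟶ n') (m : SimplexCategoryᵒᵖ) :
    D.rowι Z n m ≫ (D.rowRealization Z).map a =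
      (D.tensor.obj m.unop).map (Z.map (Prod.mkHom a (𝟙 m))) ≫ D.rowι Z n' m :=
  D.realizationι_map ((Functor.curry.obj Z).map a) m

variable {D} in
theorem rowRealization_hom_ext {Z : SimplexCategoryᵒᵖ × SimplexCategoryᵒᵖ ⥤ M}
    {n : SimplexCategoryᵒᵖ} {b : M} {f g : (D.rowRealization Z).obj n ⟶ b}
    (h : ∀ m, D.rowι Z n m ≫ f = D.rowι Z n m ≫ g) : f = g :=
  realization_hom_ext h

/-- The comparison of `∫ Δ^• ⊗ (Δ^• ⊗ Z)` with the realisation of `n ↦ |Z_{n•}|`. -/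
noncomputable def iteratedRealization (Z : SimplexCategoryᵒᵖ × SimplexCategoryᵒᵖ ⥤ M)
    [HasCoend (D.biIntegrand Z)] :
    coend (D.biIntegrand Z) ⟶ D.realization (D.rowRealization Z) :=
  coend.desc (F := D.biIntegrand Z)
    (fun k => (D.tensor.obj k.1.unop).map (D.rowι Z k.1 k.2) ≫
      D.realizationι (D.rowRealization Z) k.1) (by
    rintro ⟨n, m⟩ ⟨n', m'⟩ ⟨a, b⟩
    change n ⟶ n' at a
    change m ⟶ m' at b
    refine (Category.assoc _ _ _).trans ?_
    change (D.tensor.map a.unop).app _ ≫ (D.tensor.obj n.unop).map ((D.tensor.map b.unop).app _) ≫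
        (D.tensor.obj n.unop).map (D.rowι Z n m) ≫ D.realizationι (D.rowRealization Z) n =
      (D.tensor.obj n'.unop).map ((D.tensor.obj m'.unop).map (Z.map (Prod.mkHom a b))) ≫
        (D.tensor.obj n'.unop).map (D.rowι Z n' m') ≫ D.realizationι (D.rowRealization Z) n'
    have e : Z.map (Prod.mkHom (𝟙 n) b) ≫ Z.map (Prod.mkHom a (𝟙 m')) =
        Z.map (Prod.mkHom a b) := by
      rw [← Z.map_comp]
      congr 1
      exact Prod.ext (Category.id_comp a) (Category.comp_id b)
    rw [← Functor.map_comp_assoc, ← Functor.map_comp_assoc, rowι_condition,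
      ← NatTrans.naturality_assoc, realizationι_condition, ← Functor.map_comp_assoc,
      Category.assoc, rowι_map, ← Functor.map_comp_assoc, e])

theorem biι_iteratedRealization (Z : SimplexCategoryᵒᵖ × SimplexCategoryᵒᵖ ⥤ M)
    [HasCoend (D.biIntegrand Z)] (n m : SimplexCategoryᵒᵖ) :
    D.biι Z n m ≫ D.iteratedRealization Z =
      (D.tensor.obj n.unop).map (D.rowι Z n m) ≫
        D.realizationι (D.rowRealization Z) n :=
  coend.ι_desc (F := D.biIntegrand Z) _ _ (n, m)

theorem map_rowRealization_hom_ext (Z : SimplexCategoryᵒᵖ × SimplexCategoryᵒᵖ ⥤ M)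
    (T : M ⥤ M) [PreservesColimitsOfSize.{w, w} T] {n : SimplexCategoryᵒᵖ} {b : M}
    {f g : T.obj ((D.rowRealization Z).obj n) ⟶ b}
    (h : ∀ m, T.map (D.rowι Z n m) ≫ f = T.map (D.rowι Z n m) ≫ g) : f = g :=
  map_coend_hom_ext.{w} (D.integrand ((Functor.curry.obj Z).obj n)) T h

/-- A Fubini theorem. As `Δ^n ⊗ -` preserves the coend `|Z_{n•}|`, a map out of `Δ^n ⊗ |Z_{n•}|` is
a compatible family of maps out of the `Δ^n ⊗ (Δ^m ⊗ Z_{nm})`, so both sides have the same universal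
property. -/
theorem isIso_iteratedRealization (hD : ∀ n, PreservesColimitsOfSize.{w, w} (D.tensor.obj n))
    (Z : SimplexCategoryᵒᵖ × SimplexCategoryᵒᵖ ⥤ M) [HasCoend (D.biIntegrand Z)] :
    IsIso (D.iteratedRealization Z) := by
  have h (n : SimplexCategoryᵒᵖ) :
      ∃ f : (D.tensor.obj n.unop).obj ((D.rowRealization Z).obj n) ⟶ coend (D.biIntegrand Z),
        ∀ m, (D.tensor.obj n.unop).map (D.rowι Z n m) ≫ f =
          D.biι Z n m := by
    have := hD n.unop
    refine exists_map_coend_desc.{w} (D.integrand ((Functor.curry.obj Z).obj n))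
      (D.tensor.obj n.unop) (D.biι Z n) ?_
    intro i j a
    refine Eq.trans ?_ (D.biι_condition Z (𝟙 n) a)
    refine Eq.trans ?_ (congrArg (fun t => t.app _ ≫ _) (D.tensor.map_id n.unop)).symm
    exact (Category.id_comp _).symm
  choose f hf using h
  -- The two variables of the double coend condition are used separately: the second one produced `f
  -- n`, and the first one gives its compatibility in `n`.
  have hf' ⦃n n' : SimplexCategoryᵒᵖ⦄ (a : n ⟶ n') :
      (D.tensor.map a.unop).app ((D.rowRealization Z).obj n) ≫ f n =
        (D.tensor.obj n'.unop).map ((D.rowRealization Z).map a) ≫ f n' := by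
    have := hD n'.unop
    refine D.map_rowRealization_hom_ext.{w} Z (D.tensor.obj n'.unop) fun m => ?_
    rw [NatTrans.naturality_assoc, hf, ← Functor.map_comp_assoc, rowι_map,
      Functor.map_comp_assoc, hf]
    refine Eq.trans ?_ (D.biι_condition Z a (𝟙 m))
    refine congrArg (_ ≫ ·) ?_
    refine Eq.trans ?_ (congrArg (fun t => (D.tensor.obj n.unop).map (t.app _) ≫ _)
      (D.tensor.map_id m.unop)).symm
    refine Eq.trans ?_ (congrArg (· ≫ _) ((D.tensor.obj n.unop).map_id _)).symm
    exact (Category.id_comp _).symm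
  refine ⟨D.realizationDesc (D.rowRealization Z) f hf', ?_, ?_⟩
  · refine coend.hom_ext (F := D.biIntegrand Z) ?_
    rintro ⟨n, m⟩
    change D.biι Z n m ≫ _ = D.biι Z n m ≫ _
    rw [← Category.assoc, biι_iteratedRealization, Category.assoc, realizationι_desc, hf,
      Category.comp_id]
  · refine realization_hom_ext fun n => ?_
    rw [← Category.assoc, realizationι_desc, Category.comp_id]
    have := hD n.unop
    refine D.map_rowRealization_hom_ext.{w} Z (D.tensor.obj n.unop) fun m => ?_
    rw [← Category.assoc, hf, biι_iteratedRealization]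

end DeltaStructure

/-- The augmentation of the row `Z_{n•}` given by a map `Z_{nm} ⟶ X_n`. -/
def rowAugmentation {Z : SimplexCategoryᵒᵖ × SimplexCategoryᵒᵖ ⥤ M} {X : SimplexCategoryᵒᵖ ⥤ M}
    (ε : Z ⟶ CategoryTheory.Prod.fst _ _ ⋙ X) (n : SimplexCategoryᵒᵖ) :
    (Functor.curry.obj Z).obj n ⟶ (Functor.const _).obj (X.obj n) where
  app m := ε.app (n, m)
  naturality m m' b := by
    refine (ε.naturality (Prod.mkHom (𝟙 n) b)).trans ?_
    exact congrArg (ε.app (n, m) ≫ ·) (X.map_id n)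

/-- The map from the diagonal of `Z` to `X` given by a map `Z_{nm} ⟶ X_n`. -/
def diagonalAugmentation {Z : SimplexCategoryᵒᵖ × SimplexCategoryᵒᵖ ⥤ M}
    {X : SimplexCategoryᵒᵖ ⥤ M} (ε : Z ⟶ CategoryTheory.Prod.fst _ _ ⋙ X) :
    Functor.diag SimplexCategoryᵒᵖ ⋙ Z ⟶ X where
  app n := ε.app (n, n)
  naturality _ _ a := ε.naturality (Prod.mkHom a a)

section

variable (D : DeltaStructure M) [∀ X : SimplexCategoryᵒᵖ ⥤ M, HasCoend (D.integrand X)]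
  {Z : SimplexCategoryᵒᵖ × SimplexCategoryᵒᵖ ⥤ M} {X : SimplexCategoryᵒᵖ ⥤ M}
  (ε : Z ⟶ CategoryTheory.Prod.fst _ _ ⋙ X)

/-- The map `|Z_{n•}| ⟶ X_n` given by a map `Z_{nm} ⟶ X_n`. -/
noncomputable def DeltaStructure.rowAugment (n : SimplexCategoryᵒᵖ) :
    (D.rowRealization Z).obj n ⟶ X.obj n :=
  D.augment (rowAugmentation ε n)

theorem DeltaStructure.rowι_rowAugment (n m : SimplexCategoryᵒᵖ) :
    D.rowι Z n m ≫ D.rowAugment ε n =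
      (D.tensor.obj m.unop).map (ε.app (n, m)) ≫ D.collapse m.unop (X.obj n) :=
  D.realizationι_augment (rowAugmentation ε n) m

end

namespace DeltaStructure.IsHomotopical

variable {D : DeltaStructure M} {W : MorphismProperty M} [HasColimitsOfSize.{w, w} M]

/-- If the rows of a bisimplicial object are resolutions of the `X_n`, then the realisation of
the diagonal is weakly equivalent to the realisation of `X`. -/
theorem realizationMap_diagonalAugmentation (h : D.IsHomotopical.{w} W)
    {Z : SimplexCategoryᵒᵖ × SimplexCategoryᵒᵖ ⥤ M} {X : SimplexCategoryᵒᵖ ⥤ M}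
    (ε : Z ⟶ CategoryTheory.Prod.fst _ _ ⋙ X) (hε : ∀ n, W (D.augment (rowAugmentation ε n))) :
    W (D.realizationMap (diagonalAugmentation ε)) := by
  have := h.twoOutOfThree
  have := D.isIso_iteratedRealization h.preservesColimits Z
  let l : D.rowRealization Z ⟶ X :=
    { app n := D.rowAugment ε n
      naturality n n' a := by
        refine rowRealization_hom_ext fun m => ?_
        rw [← Category.assoc, rowι_map, Category.assoc, rowι_rowAugment,
          ← Category.assoc (D.rowι Z n m), rowι_rowAugment, Category.assoc, ← D.collapse_naturality m.unop (X.map a), ← Functor.map_comp_assoc,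
          ← Functor.map_comp_assoc]
        exact congrArg (fun t => (D.tensor.obj m.unop).map t ≫ _)
          (ε.naturality (Prod.mkHom a (𝟙 m))) }
  -- The map factors as the diagonal comparison, a weak equivalence by axiom, the Fubini
  -- isomorphism, and the realisation of the levelwise weak equivalences `|Z_{n•}| → X_n`.
  have e : D.realizationMap (diagonalAugmentation ε) =
      D.diagonalComparison Z ≫ D.iteratedRealization Z ≫ D.realizationMap l := by
    refine realization_hom_ext fun n => ?_
    rw [realizationι_map]
    have e₁ : D.realizationι (Functor.diag SimplexCategoryᵒᵖ ⋙ Z) n ≫ D.diagonalComparison Z =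
        (D.diag n.unop).app (Z.obj (n, n)) ≫ D.biι Z n n :=
      coend.ι_desc (F := D.integrand (Functor.diag SimplexCategoryᵒᵖ ⋙ Z)) _ _ n
    rw [← Category.assoc, e₁, Category.assoc, ← Category.assoc (D.biι Z n n),
      biι_iteratedRealization, Category.assoc, realizationι_map, ← Functor.map_comp_assoc,
      rowι_rowAugment, Functor.map_comp_assoc]
    have e₂ := (D.diag n.unop).naturality (ε.app (n, n))
    refine Eq.trans ?_ (Category.assoc _ _ _)
    refine Eq.trans ?_ (congrArg (· ≫ _) e₂)
    refine Eq.trans ?_ (Category.assoc _ _ _).symm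
    refine congrArg ((D.tensor.obj n.unop).map (ε.app (n, n)) ≫ ·) ?_
    -- The row augmentation collapses the inner factor of `Δ^n ⊗ (Δ^n ⊗ X_n)`, and the counit law
    -- cancels this against the diagonal.
    have e₃ := D.counit_right n.unop (X.obj n)
    refine Eq.trans ?_ (Category.assoc _ _ _)
    exact (Category.id_comp _).symm.trans (congrArg (· ≫ D.realizationι X n) e₃.symm)
  rw [e]
  exact W.comp_mem _ _ (h.diagonal Z) (W.comp_mem _ _ (h.of_isIso _) (h.realization l hε))

end DeltaStructure.IsHomotopical

end Bisimplicial

/-! ### Contractible simplicial sets -/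

section Contractible

/-- A simplicial set which is simplicially homotopy equivalent to a point is contractible. -/
theorem isContractible_of_homotopy {X : SSet.{w}} (p : ⊤_ SSet.{w} ⟶ X)
    (h : SimplicialHomotopic (terminal.from X ≫ p) (𝟙 X)) : IsContractible X := by
  intro K _
  constructor
  -- Injectivity needs no homotopy: `p` followed by the map to the point is an endomorphism of the
  -- point.
  · have e : Function.LeftInverse (HomotopyClasses.precomp p K)
        (HomotopyClasses.precomp (terminal.from X) K) := by
      rintro ⟨f⟩
      refine congrArg (Quot.mk _) (?_ : p ≫ terminal.from X ≫ f = f)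
      rw [← Category.assoc, Subsingleton.elim (p ≫ terminal.from X) (𝟙 _), Category.id_comp]
    exact e.injective
  · rintro ⟨f⟩
    -- Every map `f` out of `X` is homotopic to its composite with the retraction of `X` onto the
    -- chosen point.
    refine ⟨Quot.mk _ (p ≫ f), Quot.sound ?_⟩
    obtain ⟨H, h₀, h₁⟩ := h
    exact ⟨H ≫ f, by rw [← Category.assoc, h₀, Category.assoc],
      by rw [← Category.assoc, h₁, Category.id_comp]⟩

theorem IsContractible.of_iso {X Y : SSet.{w}} (e : X ≅ Y) (h : IsContractible Y) :
    IsContractible X := by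
  intro K _
  have e₁ : terminal.from X = e.hom ≫ terminal.from Y := Subsingleton.elim _ _
  have e₂ : HomotopyClasses.precomp (terminal.from X) K =
      HomotopyClasses.precomp e.hom K ∘ HomotopyClasses.precomp (terminal.from Y) K := by
    rw [e₁]
    funext x
    obtain ⟨f⟩ := x
    exact congrArg (Quot.mk _) (Category.assoc _ _ _)
  rw [e₂]
  refine Function.Bijective.comp ?_ (h K)
  refine Function.bijective_iff_has_inverse.2 ⟨HomotopyClasses.precomp e.inv K, ?_, ?_⟩
  · rintro ⟨f⟩
    exact congrArg (Quot.mk _) (by simp)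
  · rintro ⟨f⟩
    exact congrArg (Quot.mk _) (by simp)

open MonoidalCategory in
/-- The minimum of two maps to `[1]`. -/
def simplexMin : Δ[1] ⊗ Δ[1] ⟶ (Δ[1] : SSet.{w}) where
  app _ := ↾fun x => SSet.stdSimplex.objEquiv.symm (SimplexCategory.mkHom
    ((SSet.stdSimplex.objEquiv x.1).toOrderHom ⊓ (SSet.stdSimplex.objEquiv x.2).toOrderHom))
  naturality _ _ _ := rfl

/-- The homotopy `(s, t) ↦ min s t` runs from the constant map at `0` to the identity. -/
theorem isContractible_stdSimplex_one : IsContractible (Δ[1] : SSet.{w}) := by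
  refine isContractible_of_homotopy (SSet.const (SSet.stdSimplex.obj₀Equiv.symm 0))
    ⟨simplexMin, ?_, ?_⟩
  · ext n x
    refine SSet.stdSimplex.objEquiv.injective ?_
    ext i : 3
    exact min_eq_right (Fin.zero_le _)
  · ext n x
    refine SSet.stdSimplex.objEquiv.injective ?_
    ext i : 3
    exact min_eq_left (Fin.le_last _)

end Contractible

/-! ### Copowers by a simplicial set and their realisations -/

section Copower

variable {M : Type u} [Category.{v} M] [HasColimitsOfSize.{w, w} M]

/-- The simplicial object `n ↦ ∐_{S_n} b`. -/
noncomputable def copower (S : SSet.{w}) (b : M) : SimplexCategoryᵒᵖ ⥤ M where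
  obj n := ∐ fun _ : S.obj n => b
  map a := Limits.Sigma.map' (fun s => S.map a s) fun _ => 𝟙 b
  map_id n := Limits.Sigma.hom_ext _ _ fun s => by simp
  map_comp a a' := Limits.Sigma.hom_ext _ _ fun s => by simp

/-- The inclusion of the summand of `s`. -/
noncomputable def copowerι {S : SSet.{w}} (b : M) {n : SimplexCategoryᵒᵖ} (s : S.obj n) :
    b ⟶ (copower S b).obj n :=
  Limits.Sigma.ι (fun _ : S.obj n => b) s

theorem copowerι_map {S : SSet.{w}} (b : M) {n n' : SimplexCategoryᵒᵖ} (a : n ⟶ n')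
    (s : S.obj n) : copowerι b s ≫ (copower S b).map a = copowerι b (S.map a s) :=
  (Limits.Sigma.ι_comp_map' _ _ _).trans (Category.id_comp _)

/-- The folding map `∐_{S_n} b ⟶ b`. -/
noncomputable def copowerFold (S : SSet.{w}) (b : M) :
    copower S b ⟶ (Functor.const _).obj b where
  app n := Limits.Sigma.desc fun _ => 𝟙 b
  naturality m n a := Limits.Sigma.hom_ext _ _ fun s => by simp [copower]

theorem copowerι_fold {S : SSet.{w}} (b : M) {n : SimplexCategoryᵒᵖ} (s : S.obj n) :
    copowerι b s ≫ (copowerFold S b).app n = 𝟙 b :=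
  Limits.Sigma.ι_desc _ _

/-- The bisimplicial object `(m, n) ↦ ∐_{S_n} X_m`. -/
noncomputable def copowerBi (S : SSet.{w}) (X : SimplexCategoryᵒᵖ ⥤ M) :
    SimplexCategoryᵒᵖ × SimplexCategoryᵒᵖ ⥤ M where
  obj k := ∐ fun _ : S.obj k.2 => X.obj k.1
  map a := Limits.Sigma.map' (fun s => S.map a.2 s) fun _ => X.map a.1
  map_id n := Limits.Sigma.hom_ext _ _ fun s => by simp
  map_comp a a' := Limits.Sigma.hom_ext _ _ fun s => by simp

/-- The inclusion of the summand of `s`. -/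
noncomputable def copowerBiι {S : SSet.{w}} (X : SimplexCategoryᵒᵖ ⥤ M) (m : SimplexCategoryᵒᵖ)
    {n : SimplexCategoryᵒᵖ} (s : S.obj n) : X.obj m ⟶ (copowerBi S X).obj (m, n) :=
  Limits.Sigma.ι (fun _ : S.obj n => X.obj m) s

theorem copowerBi_hom_ext {S : SSet.{w}} {X : SimplexCategoryᵒᵖ ⥤ M} {m n : SimplexCategoryᵒᵖ}
    {y : M} {f g : (copowerBi S X).obj (m, n) ⟶ y}
    (h : ∀ s : S.obj n, copowerBiι X m s ≫ f = copowerBiι X m s ≫ g) : f = g :=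
  Limits.Sigma.hom_ext _ _ h

theorem copowerBiι_map {S : SSet.{w}} (X : SimplexCategoryᵒᵖ ⥤ M) {m m' n n' : SimplexCategoryᵒᵖ}
    (a : m ⟶ m') (b : n ⟶ n') (s : S.obj n) :
    copowerBiι X m s ≫ (copowerBi S X).map (Prod.mkHom a b) =
      X.map a ≫ copowerBiι X m' (S.map b s) :=
  Limits.Sigma.ι_comp_map' _ _ _

/-- The map out of `∐_{S_n} X_m` with given components. -/
noncomputable def copowerBiDesc {S : SSet.{w}} {X : SimplexCategoryᵒᵖ ⥤ M}
    {m n : SimplexCategoryᵒᵖ} {y : M} (f : S.obj n → (X.obj m ⟶ y)) :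
    (copowerBi S X).obj (m, n) ⟶ y :=
  Limits.Sigma.desc f

theorem copowerBiι_desc {S : SSet.{w}} {X : SimplexCategoryᵒᵖ ⥤ M}
    {m n : SimplexCategoryᵒᵖ} {y : M} (f : S.obj n → (X.obj m ⟶ y)) (s : S.obj n) :
    copowerBiι X m s ≫ copowerBiDesc f = f s :=
  Limits.Sigma.ι_desc _ _

/-- The folding map `∐_{S_n} X_m ⟶ X_m`. -/
noncomputable def copowerBiFold (S : SSet.{w}) (X : SimplexCategoryᵒᵖ ⥤ M) :
    copowerBi S X ⟶ CategoryTheory.Prod.fst _ _ ⋙ X where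
  app k := Limits.Sigma.desc fun _ => 𝟙 (X.obj k.1)
  naturality m n a := Limits.Sigma.hom_ext _ _ fun s => by simp [copowerBi]

/-- The rows of `(m, n) ↦ ∐_{S_n} X_m`. -/
noncomputable def copowerBiRow (S : SSet.{w}) (X : SimplexCategoryᵒᵖ ⥤ M)
    (m : SimplexCategoryᵒᵖ) : (Functor.curry.obj (copowerBi S X)).obj m ≅ copower S (X.obj m) :=
  NatIso.ofComponents (fun n => Iso.refl _) fun {n n'} a => by
    refine (Category.comp_id _).trans (Eq.trans ?_ (Category.id_comp _).symm)
    refine copowerBi_hom_ext fun s => ?_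
    refine (copowerBiι_map X (𝟙 m) a s).trans (Eq.trans ?_ (copowerι_map (X.obj m) a s).symm)
    exact (congrArg (· ≫ _) (X.map_id m)).trans (Category.id_comp _)

namespace DeltaStructure

variable (D : DeltaStructure M)

/-- The map `S ⊗ b ⟶ b`. -/
noncomputable def tensorCollapse (S : SSet.{w}) (b : M) : D.tensorSSet S b ⟶ b :=
  D.tensorDesc (fun n _ => D.collapse n b) fun a _ => D.tensor_map_collapse a b

variable {D} in
theorem tensorSSet_hom_ext {S : SSet.{w}} {x y : M} {f g : D.tensorSSet S x ⟶ y}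
    (h : ∀ (n : SimplexCategory) (s : simplex.obj n ⟶ S), D.tensorι s x ≫ f = D.tensorι s x ≫ g) :
    f = g :=
  colimit.hom_ext fun j => h j.left j.hom

theorem tensorι_desc {S : SSet.{w}} {x y : M}
    (φ : ∀ (n : SimplexCategory) (_ : simplex.obj n ⟶ S), (D.tensor.obj n).obj x ⟶ y)
    (hφ : ∀ {m n : SimplexCategory} (a : m ⟶ n) (s : simplex.obj n ⟶ S),
      (D.tensor.map a).app x ≫ φ n s = φ m (simplex.map a ≫ s))
    {n : SimplexCategory} (s : simplex.obj n ⟶ S) :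
    D.tensorι s x ≫ D.tensorDesc φ hφ = φ n s :=
  colimit.ι_desc _ _

theorem tensorι_map {S T : SSet.{w}} (f : S ⟶ T) (b : M) {n : SimplexCategory}
    (s : simplex.obj n ⟶ S) : D.tensorι s b ≫ D.tensorSSetMap f b = D.tensorι (s ≫ f) b :=
  colimit.ι_desc _ _

theorem tensorι_collapse {S : SSet.{w}} (b : M) {n : SimplexCategory} (s : simplex.obj n ⟶ S) :
    D.tensorι s b ≫ D.tensorCollapse S b = D.collapse n b :=
  D.tensorι_desc (fun n _ => D.collapse n b) _ s

theorem tensorSSetMap_tensorCollapse {S T : SSet.{w}} (f : S ⟶ T) (b : M) :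
    D.tensorSSetMap f b ≫ D.tensorCollapse T b = D.tensorCollapse S b :=
  tensorSSet_hom_ext fun n s => by
    rw [← Category.assoc, tensorι_map, tensorι_collapse, tensorι_collapse]

/-- The simplices of the point form the category `Δ`, which has the terminal object `[0]`, so the
colimit is `Δ^0 ⊗ b ≅ b`. -/
theorem isIso_tensorCollapse_terminal (b : M) : IsIso (D.tensorCollapse (⊤_ SSet.{w}) b) := by
  refine ⟨D.unit.inv.app b ≫ D.tensorι (terminal.from (simplex.{w}.obj ⦋0⦌)) b, ?_, ?_⟩
  · refine tensorSSet_hom_ext fun n s => ?_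
    rw [← Category.assoc, tensorι_collapse, collapse, Category.assoc, Iso.hom_inv_id_app_assoc,
      tensorι_naturality, Category.comp_id]
    exact congrArg (fun t => D.tensorι t b) (Subsingleton.elim _ _)
  · rw [Category.assoc, tensorι_collapse, collapse_zero]
    exact D.unit.inv_hom_id_app b

/-- The map `Δ^n ⊗ b ⟶ |∐_S b|` given by a simplex of `S`. -/
noncomputable def copowerRealizationι {S : SSet.{w}} (b : M) {n : SimplexCategory}
    (s : S.obj (op n)) : (D.tensor.obj n).obj b ⟶ D.realization (copower S b) :=
  (D.tensor.obj n).map (copowerι b s) ≫ D.realizationι (copower S b) (op n)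

theorem copowerRealizationι_naturality {S : SSet.{w}} (b : M) {m n : SimplexCategory} (a : m ⟶ n)
    (s : S.obj (op n)) : (D.tensor.map a).app b ≫ D.copowerRealizationι b s =
      D.copowerRealizationι b (S.map a.op s) := by
  have e := D.realizationι_condition (copower S b) a.op
  unfold copowerRealizationι
  rw [← copowerι_map, ← NatTrans.naturality_assoc]
  refine (congrArg (_ ≫ ·) e).trans ?_
  rw [Functor.map_comp, Category.assoc]

theorem copowerRealizationι_augment {S : SSet.{w}} (b : M) {n : SimplexCategory}
    (s : S.obj (op n)) :
    D.copowerRealizationι b s ≫ D.augment (copowerFold S b) = D.collapse n b := by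
  unfold copowerRealizationι
  rw [Category.assoc, realizationι_augment, ← Functor.map_comp_assoc, copowerι_fold,
    CategoryTheory.Functor.map_id, Category.id_comp]

/-- The comparison of `S ⊗ b` with the realisation of `n ↦ ∐_{S_n} b`. -/
noncomputable def tensorToRealization (S : SSet.{w}) (b : M) :
    D.tensorSSet S b ⟶ D.realization (copower S b) :=
  D.tensorDesc (fun _ s => D.copowerRealizationι b (SSet.yonedaEquiv s)) (fun a s =>
    (D.copowerRealizationι_naturality b a _).trans
      (congrArg (D.copowerRealizationι b) (SSet.yonedaEquiv_naturality a s)))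

theorem tensorι_tensorToRealization (S : SSet.{w}) (b : M) {n : SimplexCategory}
    (s : simplex.obj n ⟶ S) : D.tensorι s b ≫ D.tensorToRealization S b =
      D.copowerRealizationι b (SSet.yonedaEquiv s) :=
  colimit.ι_desc _ _

theorem tensorToRealization_augment (S : SSet.{w}) (b : M) :
    D.tensorToRealization S b ≫ D.augment (copowerFold S b) = D.tensorCollapse S b :=
  tensorSSet_hom_ext fun n s => by
    rw [← Category.assoc, tensorι_tensorToRealization, copowerRealizationι_augment,
      tensorι_collapse]

/-- As `Δ^n ⊗ -` preserves coproducts, the coend of the `Δ^n ⊗ ∐_{S_n} b` is glued from one copy of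
`Δ^n ⊗ b` for each simplex of `S`, which is the description of `S ⊗ b` as a colimit. Simplices of
`S` and maps `Δ^n → S` are exchanged by the Yoneda lemma. -/
theorem isIso_tensorToRealization (hD : ∀ n, PreservesColimitsOfSize.{w, w} (D.tensor.obj n))
    (S : SSet.{w}) (b : M) : IsIso (D.tensorToRealization S b) := by
  have h (n : SimplexCategoryᵒᵖ) :
      ∃ f : (D.tensor.obj n.unop).obj ((copower S b).obj n) ⟶ D.tensorSSet S b,
        ∀ s : S.obj n, (D.tensor.obj n.unop).map (copowerι b s) ≫ f =
          D.tensorι (SSet.yonedaEquiv.symm s) b :=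
    have := hD n.unop
    exists_map_sigma_desc.{w} (fun _ : S.obj n => b) (D.tensor.obj n.unop)
      fun s => D.tensorι (SSet.yonedaEquiv.symm s) b
  choose f hf using h
  have ext {n : SimplexCategory} {m : SimplexCategoryᵒᵖ} {y : M}
      {f g : (D.tensor.obj n).obj ((copower S b).obj m) ⟶ y}
      (h : ∀ s : S.obj m, (D.tensor.obj n).map (copowerι b s) ≫ f =
        (D.tensor.obj n).map (copowerι b s) ≫ g) : f = g :=
    have := hD n
    map_sigma_hom_ext.{w} (fun _ : S.obj m => b) (D.tensor.obj n) h
  have hf' ⦃m n : SimplexCategoryᵒᵖ⦄ (a : m ⟶ n) :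
      (D.tensor.map a.unop).app ((copower S b).obj m) ≫ f m =
        (D.tensor.obj n.unop).map ((copower S b).map a) ≫ f n := by
    refine ext fun s => ?_
    rw [NatTrans.naturality_assoc, hf, ← Functor.map_comp_assoc, copowerι_map, hf]
    refine (D.tensorι_naturality _ _ _).trans ?_
    exact congrArg (fun t => D.tensorι t b) (SSet.yonedaEquiv_symm_naturality_left a.unop s)
  refine ⟨D.realizationDesc (copower S b) f hf', ?_, ?_⟩
  · refine tensorSSet_hom_ext fun n s => ?_
    rw [← Category.assoc, tensorι_tensorToRealization, copowerRealizationι, Category.assoc,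
      realizationι_desc, Category.comp_id]
    refine (hf (op n) _).trans ?_
    rw [Equiv.symm_apply_apply]
  · refine realization_hom_ext fun n => ?_
    rw [← Category.assoc, realizationι_desc, Category.comp_id]
    refine ext fun s => ?_
    rw [← Category.assoc, hf, tensorι_tensorToRealization, Equiv.apply_symm_apply]
    rfl

namespace IsHomotopical

variable {D} {W : MorphismProperty M} (h : D.IsHomotopical.{w} W)

include h

/-- Under the isomorphism `S ⊗ b ≅ |∐_S b|` the augmentation becomes `S ⊗ b → b`. This factors
through `pt ⊗ b ≅ b`, and `S ⊗ b → pt ⊗ b` is a weak equivalence because `S → pt` is one. -/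
theorem augment_copowerFold {S : SSet.{w}} (hS : IsContractible S) (b : M) :
    W (D.augment (copowerFold S b)) := by
  have := h.twoOutOfThree
  have := D.isIso_tensorToRealization h.preservesColimits S b
  have := D.isIso_tensorCollapse_terminal.{w} b
  refine W.of_precomp _ _ (h.of_isIso (D.tensorToRealization S b)) ?_
  rw [tensorToRealization_augment, ← D.tensorSSetMap_tensorCollapse (terminal.from S)]
  exact W.comp_mem _ _ (h.tensor_left _ hS b) (h.of_isIso _)

/-- The projection `S × X ⟶ X` is a weak equivalence on realisations if `S` is contractible. -/
theorem realizationMap_copowerBiFold {S : SSet.{w}} (hS : IsContractible S)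
    (X : SimplexCategoryᵒᵖ ⥤ M) :
    W (D.realizationMap (diagonalAugmentation (copowerBiFold S X))) := by
  have := h.twoOutOfThree
  -- The row over `m` is the copower of the single object `X_m` by `S`, which the previous lemma
  -- treats.
  refine h.realizationMap_diagonalAugmentation _ fun m => ?_
  have e : rowAugmentation (copowerBiFold S X) m =
      (copowerBiRow S X m).hom ≫ copowerFold S (X.obj m) := by
    ext n
    exact (Category.id_comp _).symm
  rw [e, ← realizationMap_augment]
  exact W.comp_mem _ _ (h.realization _ fun n => h.of_isIso _) (h.augment_copowerFold hS _)

end IsHomotopical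

end DeltaStructure

end Copower

/-! ### Simplicial homotopies and deformation retractions -/

section LevelHomotopy

variable {M : Type u} [Category.{v} M]

/-- A simplicial homotopy: a natural family of maps `X_n ⟶ Y_n` indexed by the maps
`[n] ⟶ [1]`. -/
structure LevelHomotopy {X Y : SimplexCategoryᵒᵖ ⥤ M} (f g : X ⟶ Y) where
  app (n : SimplexCategoryᵒᵖ) (t : n.unop ⟶ ⦋1⦌) : X.obj n ⟶ Y.obj n
  naturality {m n : SimplexCategoryᵒᵖ} (a : m ⟶ n) (t : m.unop ⟶ ⦋1⦌) :
    app m t ≫ Y.map a = X.map a ≫ app n (a.unop ≫ t)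
  app_zero (n : SimplexCategoryᵒᵖ) : app n (SimplexCategory.const n.unop ⦋1⦌ 0) = f.app n
  app_one (n : SimplexCategoryᵒᵖ) : app n (SimplexCategory.const n.unop ⦋1⦌ 1) = g.app n

/-- The image of a simplicial homotopy. -/
def LevelHomotopy.map {M' : Type u₁} [Category.{v₁} M'] {X Y : SimplexCategoryᵒᵖ ⥤ M}
    {f g : X ⟶ Y} (H : LevelHomotopy f g) (G : M ⥤ M') :
    LevelHomotopy (Functor.whiskerRight f G) (Functor.whiskerRight g G) where
  app n t := G.map (H.app n t)
  naturality a t := by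
    refine (G.map_comp _ _).symm.trans (Eq.trans ?_ (G.map_comp _ _))
    exact congrArg G.map (H.naturality a t)
  app_zero n := congrArg G.map (H.app_zero n)
  app_one n := congrArg G.map (H.app_one n)

/-- The image of an augmentation. -/
def mapAugmentation {M' : Type u₁} [Category.{v₁} M'] (G : M ⥤ M') {X : SimplexCategoryᵒᵖ ⥤ M}
    {b : M} (ε : X ⟶ (Functor.const _).obj b) : X ⋙ G ⟶ (Functor.const _).obj (G.obj b) where
  app n := G.map (ε.app n)
  naturality m n a := by
    refine (G.map_comp _ _).symm.trans ?_
    refine (congrArg G.map (ε.naturality a)).trans ?_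
    exact (G.map_comp _ _).trans (congrArg (_ ≫ ·) (G.map_id b))

namespace DeltaStructure.IsHomotopical

variable {D : DeltaStructure M} {W : MorphismProperty M} [HasColimitsOfSize.{w, w} M]
  (h : D.IsHomotopical.{w} W)

include h

/-- The homotopy is a map `k` from the cylinder `n ↦ ∐_{Δ[1]_n} X_n` to `Y`, with `f` and `g` its
restrictions to the two ends. Both ends are sections of the projection to `X`, a weak equivalence on
realisations since `Δ[1]` is contractible. So each of `|f|` and `|g|` is a weak equivalence exactly
when `|k|` is. -/
theorem realizationMap_iff_of_levelHomotopy {X Y : SimplexCategoryᵒᵖ ⥤ M} {f g : X ⟶ Y}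
    (H : LevelHomotopy f g) : W (D.realizationMap f) ↔ W (D.realizationMap g) := by
  have := h.twoOutOfThree
  let S : SSet.{w} := Δ[1]
  let Z := Functor.diag SimplexCategoryᵒᵖ ⋙ copowerBi S X
  let i (j : Fin 2) : X ⟶ Z :=
    { app n := copowerBiι (S := S) X n
        (SSet.stdSimplex.objEquiv.symm (SimplexCategory.const n.unop ⦋1⦌ j))
      naturality m n a := (copowerBiι_map (S := S) X a a
        (SSet.stdSimplex.objEquiv.symm (SimplexCategory.const m.unop ⦋1⦌ j))).symm }
  let k : Z ⟶ Y :=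
    { app n := copowerBiDesc fun s => H.app n (SSet.stdSimplex.objEquiv s)
      naturality m n a := by
        refine copowerBi_hom_ext fun s => ?_
        refine (Category.assoc _ _ _).symm.trans ?_
        refine (congrArg (· ≫ _) (copowerBiι_map X a a s)).trans ?_
        refine (Category.assoc _ _ _).trans ?_
        refine (congrArg (X.map a ≫ ·) (copowerBiι_desc _ _)).trans ?_
        refine Eq.trans ?_ (Category.assoc _ _ _)
        refine Eq.trans ?_ (congrArg (· ≫ Y.map a) (copowerBiι_desc _ s).symm)
        exact (H.naturality a (SSet.stdSimplex.objEquiv s)).symm }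
  have hi (j : Fin 2) : W (D.realizationMap (i j)) := by
    refine W.of_postcomp _ _
      (h.realizationMap_copowerBiFold isContractible_stdSimplex_one X) ?_
    rw [← realizationMap_comp]
    have e : i j ≫ diagonalAugmentation (copowerBiFold S X) = 𝟙 X := by
      ext n
      exact Limits.Sigma.ι_desc _ _
    rw [e, realizationMap_id]
    exact h.of_isIso _
  have e₀ : i 0 ≫ k = f := by
    ext n
    refine (copowerBiι_desc _ _).trans ?_
    rw [Equiv.apply_symm_apply]
    exact H.app_zero n
  have e₁ : i 1 ≫ k = g := by
    ext n
    refine (copowerBiι_desc _ _).trans ?_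
    rw [Equiv.apply_symm_apply]
    exact H.app_one n
  have key (j : Fin 2) : W (D.realizationMap (i j ≫ k)) ↔ W (D.realizationMap k) := by
    rw [realizationMap_comp]
    exact ⟨W.of_precomp _ _ (hi j), W.comp_mem _ _ (hi j)⟩
  rw [← e₀, ← e₁, key, key]

/-- An augmentation which is a deformation retraction is a weak equivalence on realisations. -/
theorem augment_of_realizationMap {X : SimplexCategoryᵒᵖ ⥤ M} {b : M}
    (ε : X ⟶ (Functor.const _).obj b) (s : (Functor.const _).obj b ⟶ X) (hs : s ≫ ε = 𝟙 _)
    (hW : W (D.realizationMap (ε ≫ s)) ↔ W (D.realizationMap (𝟙 X))) : W (D.augment ε) := by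
  have := h.twoOutOfThree
  have h₁ : W (D.realizationMap s ≫ D.realizationMap ε) := by
    rw [← realizationMap_comp, hs, realizationMap_id]
    exact h.of_isIso _
  have h₂ : W (D.realizationMap ε ≫ D.realizationMap s) := by
    rw [← realizationMap_comp, hW, realizationMap_id]
    exact h.of_isIso _
  rw [augment_eq]
  -- Two-out-of-six is applied to `|s|`, `|ε|`, `|s|`, whose two consecutive composites are weak
  -- equivalences; the middle map is the one wanted.
  exact W.comp_mem _ _ (h.twoOutOfSix _ _ _ h₁ h₂).2.1 (h.of_isIso _)

/-- The retraction and the homotopy are given in an arbitrary category `K` and only transported by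
`G`, so they can be built combinatorially. The homotopy may run in either direction, because
simplicial homotopy is not symmetric and both directions occur below. -/
theorem augment_mapAugmentation {K : Type u₁} [Category.{v₁} K] (G : K ⥤ M)
    {X : SimplexCategoryᵒᵖ ⥤ K} {b : K} (ε : X ⟶ (Functor.const _).obj b)
    (s : (Functor.const _).obj b ⟶ X) (hs : s ≫ ε = 𝟙 _)
    (H : Nonempty (LevelHomotopy (ε ≫ s) (𝟙 X)) ∨ Nonempty (LevelHomotopy (𝟙 X) (ε ≫ s))) :
    W (D.augment (mapAugmentation G ε)) := by
  let s' : (Functor.const _).obj (G.obj b) ⟶ X ⋙ G :=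
    { app n := G.map (s.app n)
      naturality m n a := by
        refine Eq.trans ?_ (G.map_comp _ _)
        refine Eq.trans ?_ (congrArg G.map (s.naturality a))
        exact (congrArg (· ≫ _) (G.map_id b).symm).trans (G.map_comp _ _).symm }
  have e₁ : mapAugmentation G ε ≫ s' = Functor.whiskerRight (ε ≫ s) G := by
    ext n
    exact (G.map_comp _ _).symm
  have e₂ : 𝟙 (X ⋙ G) = Functor.whiskerRight (𝟙 X) G := by
    ext n
    exact (G.map_id _).symm
  refine h.augment_of_realizationMap _ s' ?_ ?_
  · ext n
    refine (G.map_comp _ _).symm.trans ?_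
    exact (congrArg G.map (NatTrans.congr_app hs n)).trans (G.map_id b)
  · rw [e₁, e₂]
    obtain ⟨⟨H⟩⟩ | ⟨⟨H⟩⟩ := H
    · exact h.realizationMap_iff_of_levelHomotopy (H.map G)
    · exact (h.realizationMap_iff_of_levelHomotopy (H.map G)).symm

end DeltaStructure.IsHomotopical

end LevelHomotopy

/-! ### Inserting a reflection into a chain -/

section ChainExtension

variable {I : Type u} [Category.{v} I]

/-- Chains are compared as functors whose objects agree only propositionally, so their arrows are
compared heterogeneously. -/
theorem heq_comp {X Y Z X' Y' Z' : I} {f : X ⟶ Y} {g : Y ⟶ Z} {f' : X' ⟶ Y'} {g' : Y' ⟶ Z'}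
    (hX : X = X') (hY : Y = Y') (hZ : Z = Z') (hf : HEq f f') (hg : HEq g g') :
    HEq (f ≫ g) (f' ≫ g') := by
  subst hX hY hZ hf hg
  rfl

/-- A morphism `i ⟶ r` with the universal property of the reflection of `i` in the objects
satisfying `P`. -/
structure IsReflection (P : I → Prop) {i r : I} (η : i ⟶ r) : Prop where
  property : P r
  existsUnique {y : I} (hy : P y) (f : i ⟶ y) : ∃! g, η ≫ g = f

theorem IsReflection.heq_of_comp {P : I → Prop} {i r i' r' y y' : I} {η : i ⟶ r} {η' : i' ⟶ r'}
    (h : IsReflection P η) (hi : i = i') (hr : r = r') (hη : HEq η η') (hy : P y) (hyy : y = y')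
    {g : r ⟶ y} {g' : r' ⟶ y'} (hg : HEq (η ≫ g) (η' ≫ g')) : HEq g g' := by
  subst hi hr hη hyy
  exact heq_of_eq ((h.existsUnique hy _).unique (eq_of_heq hg) rfl)

theorem map_heq {J : Type u₁} [Category.{v₁} J] {X Y : J ⥤ I} (h : X = Y) {i j : J} (f : i ⟶ j) :
    HEq (X.map f) (Y.map f) := by
  subst h
  rfl

/-- The edge `[n] ∋ n ⟶ 0 ∈ [m]` of `[n] * [m]`. -/
def conEdge (n m : SimplexCategory) :
    (conL (Fin.last n.len) : Fin (n.len + 1 + m.len + 1)) ⟶ conR (0 : Fin (m.len + 1)) :=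
  homOfLE (by rw [Fin.le_def]; simp)

/-- Every arrow of `[n] * [m]` lies in one of the blocks or passes through the connecting edge, so a
chain is determined by its two parts and that edge. -/
theorem con_functor_ext {n m : SimplexCategory} {x y : ComposableArrows I (con n m).len}
    (hl : orderFunctor (conInl n m) ⋙ x = orderFunctor (conInl n m) ⋙ y)
    (hr : orderFunctor (conInr n m) ⋙ x = orderFunctor (conInr n m) ⋙ y)
    (h : HEq (x.map (conEdge n m)) (y.map (conEdge n m))) : x = y := by
  have ho (i : Fin (n.len + 1 + m.len + 1)) : x.obj i = y.obj i := by
    induction i using con_cases with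
    | hl i => exact Functor.congr_obj hl i
    | hr i => exact Functor.congr_obj hr i
  have hL {i j : Fin (n.len + 1)} (f : (conL i : Fin (n.len + 1 + m.len + 1)) ⟶ conL j) :
      HEq (x.map f) (y.map f) :=
    map_heq hl (homOfLE (Fin.le_def.2 (leOfHom f)) : i ⟶ j)
  have hR {i j : Fin (m.len + 1)} (f : (conR i : Fin (n.len + 1 + m.len + 1)) ⟶ conR j) :
      HEq (x.map f) (y.map f) :=
    map_heq hr (homOfLE (by have := leOfHom f; rw [Fin.le_def] at this ⊢; simpa using this) :
      i ⟶ j)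
  refine Functor.hext ho fun i j f => ?_
  induction i using con_cases with
  | hl i =>
    induction j using con_cases with
    | hl j => exact hL f
    | hr j =>
      let f₁ : (conL i : Fin (n.len + 1 + m.len + 1)) ⟶ conL (Fin.last n.len) :=
        homOfLE (Fin.le_last i)
      let f₂ : (conR 0 : Fin (n.len + 1 + m.len + 1)) ⟶ conR j :=
        homOfLE (by rw [Fin.le_def]; simp)
      have e : f = f₁ ≫ conEdge n m ≫ f₂ := Subsingleton.elim _ _
      rw [e, x.map_comp, x.map_comp, y.map_comp, y.map_comp]
      exact heq_comp (ho _) (ho _) (ho _) (hL f₁) (heq_comp (ho _) (ho _) (ho _) h (hR f₂))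
  | hr i =>
    induction j using con_cases with
    | hl j => have := leOfHom f; rw [Fin.le_def] at this; simp at this; omega
    | hr j => exact hR f

theorem concat_map_conEdge {n m : SimplexCategory} (x : ComposableArrows I n.len)
    (y : ComposableArrows I m.len) (α : x.obj (Fin.last _) ⟶ y.obj 0) :
    HEq ((concat x y α).map (conEdge n m)) α := by
  let e : (split n.len m.len).obj (conL (Fin.last _)) ⟶ (split n.len m.len).obj (conR 0) :=
    (split n.len m.len).map (conEdge n m)
  -- `split` hits the endpoints of the edge only up to a propositional equality; with variable
  -- endpoints these equalities can be substituted.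
  have key {a b : Join (Fin (n.len + 1)) (Fin (m.len + 1))} (e : a ⟶ b)
      (ha : a = Join.left (Fin.last _)) (hb : b = Join.right 0) :
      HEq ((Join.mkFunctor x y (bridge x y α)).map e) α := by
    subst ha hb
    have he : e = Join.edge _ _ := Subsingleton.elim _ _
    rw [he, Join.mkFunctor_map_edge]
    refine heq_of_eq ?_
    change x.map (𝟙 _) ≫ α ≫ y.map (𝟙 _) = α
    simp
  exact key e (split_obj_left _) (split_obj_right _)

/-- The map `[n] * [k] ⟶ ([n] * [0]) * [k]` which omits `[0]`. -/
def conSkip (n k : SimplexCategory) : con n k ⟶ con (con n ⦋0⦌) k :=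
  conMap (conInl n ⦋0⦌) (𝟙 k)

theorem map_heq_of_eq {J : Type u₁} [Preorder J] (X : J ⥤ I) {i j i' j' : J} (f : i ⟶ j)
    (f' : i' ⟶ j') (hi : i = i') (hj : j = j') : HEq (X.map f) (X.map f') := by
  subst hi hj
  exact heq_of_eq (congrArg X.map (Subsingleton.elim _ _))

theorem orderFunctor_comp {n m l : SimplexCategory} (a : n ⟶ m) (b : m ⟶ l)
    (t : ComposableArrows I l.len) :
    orderFunctor a ⋙ orderFunctor b ⋙ t = orderFunctor (a ≫ b) ⋙ t := rfl

theorem orderFunctor_square {n m m' l : SimplexCategory} {a : n ⟶ m} {b : m ⟶ l} {a' : n ⟶ m'}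
    {b' : m' ⟶ l} (h : a ≫ b = a' ≫ b') (t : ComposableArrows I l.len) :
    orderFunctor a ⋙ orderFunctor b ⋙ t = orderFunctor a' ⋙ orderFunctor b' ⋙ t := by
  rw [orderFunctor_comp, orderFunctor_comp, h]

/-- When the middle object of `x * r * y` is dropped, the new connecting map is the composite `xₙ →
r → y₀`. -/
theorem conSkip_map_conEdge {n k : SimplexCategory}
    (t : ComposableArrows I (con (con n ⦋0⦌) k).len) :
    HEq ((orderFunctor (conSkip n k) ⋙ t).map (conEdge n k))
      ((orderFunctor (conInl (con n ⦋0⦌) k) ⋙ t).map (conEdge n ⦋0⦌) ≫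
        t.map (conEdge (con n ⦋0⦌) k)) := by
  refine HEq.trans ?_ (heq_of_eq (t.map_comp _ _))
  exact map_heq_of_eq t _ _ (conMap_left (conInl n ⦋0⦌) (𝟙 k) _)
    (conMap_right (conInl n ⦋0⦌) (𝟙 k) _)

/-- Here `z` is `x₀ → ⋯ → xₙ → r` with `xₙ → r` a reflection. As `y₀` satisfies `P`, the map `xₙ →
y₀` factors through `r`, which yields the chain `x * r * y`. -/
theorem exists_reflection_extension {P : I → Prop} {n k : SimplexCategory}
    (z : ComposableArrows I (con n ⦋0⦌).len) (hz : IsReflection P (z.map (conEdge n ⦋0⦌)))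
    (x : ComposableArrows I (con n k).len) (hx : ∀ j : Fin (k.len + 1), P (x.obj (conR j)))
    (h : orderFunctor (conInl n k) ⋙ x = orderFunctor (conInl n ⦋0⦌) ⋙ z) :
    ∃ t : ComposableArrows I (con (con n ⦋0⦌) k).len,
      orderFunctor (conInl (con n ⦋0⦌) k) ⋙ t = z ∧ orderFunctor (conSkip n k) ⋙ t = x := by
  have h₁ : z.obj (conL (Fin.last _)) = x.obj (conL (Fin.last _)) :=
    (Functor.congr_obj h (Fin.last _)).symm
  obtain ⟨g, hg, -⟩ := hz.existsUnique (hx 0) (eqToHom h₁ ≫ x.map (conEdge n k))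
  let t : ComposableArrows I (con (con n ⦋0⦌) k).len :=
    concat (n := (con n ⦋0⦌).len) z (orderFunctor (conInr n k) ⋙ x) g
  have hl : orderFunctor (conInl (con n ⦋0⦌) k) ⋙ t = z := conInl_concat _ _ _
  have hr : orderFunctor (conInr (con n ⦋0⦌) k) ⋙ t = orderFunctor (conInr n k) ⋙ x :=
    conInr_concat _ _ _
  have hg' : HEq (t.map (conEdge (con n ⦋0⦌) k)) g := concat_map_conEdge _ _ _
  refine ⟨t, hl, con_functor_ext ?_ ?_ ?_⟩
  · refine (orderFunctor_square (conInl_conMap (conInl n ⦋0⦌) (𝟙 k)) t).trans ?_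
    exact (congrArg (orderFunctor (conInl n ⦋0⦌) ⋙ ·) hl).trans h.symm
  · exact (orderFunctor_square (conInr_conMap (conInl n ⦋0⦌) (𝟙 k)) t).trans hr
  · refine (conSkip_map_conEdge t).trans ?_
    refine (heq_comp (Functor.congr_obj hl _) (Functor.congr_obj hl _) (Functor.congr_obj hr 0)
      (map_heq hl _) hg').trans ?_
    exact (heq_of_eq hg).trans (eqToHom_comp_heq _ _)

/-- Only the edge `r → y₀` is not visible in the two restrictions, and it is determined by its
composite with the reflection. This uniqueness makes the chosen insertions natural in `y`. -/
theorem reflection_extension_unique {P : I → Prop} {n k : SimplexCategory}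
    {t t' : ComposableArrows I (con (con n ⦋0⦌) k).len}
    (ht : IsReflection P ((orderFunctor (conInl (con n ⦋0⦌) k) ⋙ t).map (conEdge n ⦋0⦌)))
    (hP : ∀ j : Fin (k.len + 1), P (t.obj (conR j)))
    (hl : orderFunctor (conInl (con n ⦋0⦌) k) ⋙ t = orderFunctor (conInl (con n ⦋0⦌) k) ⋙ t')
    (h : orderFunctor (conSkip n k) ⋙ t = orderFunctor (conSkip n k) ⋙ t') : t = t' := by
  have hr : orderFunctor (conInr (con n ⦋0⦌) k) ⋙ t = orderFunctor (conInr (con n ⦋0⦌) k) ⋙ t' := by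
    refine (orderFunctor_square (conInr_conMap (conInl n ⦋0⦌) (𝟙 k)) t).symm.trans
      (Eq.trans ?_ (orderFunctor_square (conInr_conMap (conInl n ⦋0⦌) (𝟙 k)) t'))
    exact congrArg (orderFunctor (conInr n k) ⋙ ·) h
  refine con_functor_ext hl hr ?_
  refine ht.heq_of_comp (Functor.congr_obj hl _) (Functor.congr_obj hl _) (map_heq hl _) (hP 0)
    (Functor.congr_obj hr 0) ?_
  exact (conSkip_map_conEdge t).symm.trans ((map_heq h _).trans (conSkip_map_conEdge t'))

end ChainExtension

/-! ### Families of simplices and coproducts indexed by them -/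

/-- A family of simplices of the same degree. -/
structure SimplexFamily (N : SSet.{w}) where
  deg : SimplexCategoryᵒᵖ
  index : Type w
  simplex : index → N.obj deg

namespace SimplexFamily

variable {N : SSet.{w}}

/-- A morphism of families of simplices. -/
@[ext]
structure Hom (P Q : SimplexFamily N) where
  map : P.deg ⟶ Q.deg
  fn : P.index → Q.index
  comm (i : P.index) : N.map map (P.simplex i) = Q.simplex (fn i)

instance : Category (SimplexFamily N) where
  Hom := Hom
  id P := ⟨𝟙 _, id, fun i => by simp⟩
  comp {P Q R} f g := ⟨f.map ≫ g.map, g.fn ∘ f.fn, fun i => by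
    rw [N.map_comp]
    exact (congrArg (N.map g.map) (f.comm i)).trans (g.comm _)⟩

/-- The element given by a member of a family. -/
abbrev element (P : SimplexFamily N) (i : P.index) : N.Elements := ⟨P.deg, P.simplex i⟩

/-- The map of elements given by a morphism of families. -/
def elementMap {P Q : SimplexFamily N} (f : P ⟶ Q) (i : P.index) :
    P.element i ⟶ Q.element (f.fn i) :=
  ⟨f.map, f.comm i⟩

variable {M : Type u} [Category.{v} M] [HasColimitsOfSize.{w, w} M] (B : N.Elements ⥤ M)

/-- The coproduct of the values of a functor on a family of simplices. -/
noncomputable def total : SimplexFamily N ⥤ M where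
  obj P := ∐ fun i : P.index => B.obj (P.element i)
  map f := Limits.Sigma.map' f.fn fun i => B.map (elementMap f i)
  map_id P := Limits.Sigma.hom_ext _ _ fun i => by
    refine (Limits.Sigma.ι_comp_map' _ _ _).trans ?_
    refine (congrArg (· ≫ _) (B.map_id _)).trans ?_
    exact (Category.id_comp _).trans (Category.comp_id _).symm
  map_comp f g := Limits.Sigma.hom_ext _ _ fun i => by
    refine (Limits.Sigma.ι_comp_map' _ _ _).trans ?_
    rw [Limits.Sigma.ι_comp_map'_assoc, Limits.Sigma.ι_comp_map', ← Category.assoc,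
      ← B.map_comp]
    rfl

/-- The inclusion of a summand. -/
noncomputable def totalι (P : SimplexFamily N) (i : P.index) :
    B.obj (P.element i) ⟶ (total B).obj P :=
  Limits.Sigma.ι (fun i : P.index => B.obj (P.element i)) i

theorem totalι_map {P Q : SimplexFamily N} (f : P ⟶ Q) (i : P.index) :
    totalι B P i ≫ (total B).map f = B.map (elementMap f i) ≫ totalι B Q (f.fn i) :=
  Limits.Sigma.ι_comp_map' _ _ _

variable {B} in
theorem total_hom_ext {P : SimplexFamily N} {y : M} {f g : (total B).obj P ⟶ y}
    (h : ∀ i, totalι B P i ≫ f = totalι B P i ≫ g) : f = g :=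
  Limits.Sigma.hom_ext _ _ h

variable {B} in
/-- The map out of the coproduct with given components. -/
noncomputable def totalDesc {P : SimplexFamily N} {y : M}
    (f : ∀ i, B.obj (P.element i) ⟶ y) : (total B).obj P ⟶ y :=
  Limits.Sigma.desc f

variable {B} in
theorem totalι_desc {P : SimplexFamily N} {y : M} (f : ∀ i, B.obj (P.element i) ⟶ y)
    (i : P.index) : totalι B P i ≫ totalDesc f = f i :=
  Limits.Sigma.ι_desc _ _

variable {B} {b : M} (τ : B ⟶ (Functor.const _).obj b)

/-- The augmentation of the coproducts of the values of an augmented functor. -/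
noncomputable def totalAugmentation : total B ⟶ (Functor.const _).obj b where
  app P := totalDesc fun i => τ.app (P.element i)
  naturality P Q f := total_hom_ext fun i => by
    rw [← Category.assoc, totalι_map, Category.assoc, totalι_desc, τ.naturality,
      ← Category.assoc, totalι_desc]
    rfl

theorem totalι_augmentation (P : SimplexFamily N) (i : P.index) :
    totalι B P i ≫ (totalAugmentation τ).app P = τ.app (P.element i) :=
  totalι_desc _ _

end SimplexFamily

/-! ### Chains in a category as simplicial and bisimplicial families -/

section Chains

variable {I : Type w} [SmallCategory I]

/-- The family of the chains of length `n` with a given property. -/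
def chainFamily (n : SimplexCategoryᵒᵖ) (S : ComposableArrows I n.unop.len → Prop) :
    SimplexFamily (nerve I) :=
  ⟨n, {x : ComposableArrows I n.unop.len // S x}, fun x => x.1⟩

/-- The restriction of chains along a map of `Δ`. -/
def chainFamilyMap {n m : SimplexCategoryᵒᵖ} {S : ComposableArrows I n.unop.len → Prop}
    {S' : ComposableArrows I m.unop.len → Prop} (a : n ⟶ m)
    (h : ∀ x, S x → S' (orderFunctor a.unop ⋙ x)) : chainFamily n S ⟶ chainFamily m S' :=
  ⟨a, fun x => ⟨orderFunctor a.unop ⋙ x.1, h _ x.2⟩, fun _ => rfl⟩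

/-- In the target the index is the chain itself, so the function on indices is forced by the map of
`Δ`. Identities between such morphisms thereby reduce to identities in `Δ`. -/
theorem chainFamily_hom_ext {Q : SimplexFamily (nerve I)} {m : SimplexCategoryᵒᵖ}
    {S : ComposableArrows I m.unop.len → Prop} {f g : Q ⟶ chainFamily m S}
    (h : f.map = g.map) : f = g :=
  SimplexFamily.Hom.ext h (funext fun i => Subtype.ext ((f.comm i).symm.trans
    ((congrArg (fun a => (nerve I).map a (Q.simplex i)) h).trans (g.comm i))))

variable (P : I → Prop)

/-- All the chains in the objects with a given property, as a simplicial object. -/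
def chainsIn : SimplexCategoryᵒᵖ ⥤ SimplexFamily (nerve I) where
  obj n := chainFamily n fun x => ∀ j : Fin (n.unop.len + 1), P (x.obj j)
  map a := chainFamilyMap a fun _ h j => h _

/-- The chains `x₀ ⟶ ⋯ ⟶ xₙ ⟶ y₀ ⟶ ⋯ ⟶ yₖ` such that the `yⱼ` have a given property. -/
def splitChains : SimplexCategoryᵒᵖ × SimplexCategoryᵒᵖ ⥤ SimplexFamily (nerve I) where
  obj k := chainFamily (op (con k.1.unop k.2.unop)) fun x =>
    ∀ j : Fin (k.2.unop.len + 1), P (x.obj (conR j))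
  map {k l} a := chainFamilyMap (conMap a.1.unop a.2.unop).op fun x h j => by
    have e : (orderFunctor (conMap a.1.unop a.2.unop)).obj (conR j) =
      conR (a.2.unop.toOrderHom j) := conMap_right _ _ _
    refine Eq.subst (motive := fun i => P (x.obj i)) e.symm (h _)
  map_id _ := chainFamily_hom_ext (congrArg Quiver.Hom.op (conMap_id _ _))
  map_comp _ _ := chainFamily_hom_ext (congrArg Quiver.Hom.op (conMap_comp _ _ _ _))

/-- The projection of the split chains to their left parts. -/
def splitChainsLeft : splitChains P ⟶ CategoryTheory.Prod.fst _ _ ⋙ chainsIn fun _ => True where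
  app k := chainFamilyMap (conInl k.1.unop k.2.unop).op fun _ _ _ => trivial
  naturality _ _ f := chainFamily_hom_ext
    (congrArg Quiver.Hom.op (conInl_conMap f.1.unop f.2.unop))

/-- The projection of the split chains to their right parts. -/
def splitChainsRight : splitChains P ⟶ CategoryTheory.Prod.snd _ _ ⋙ chainsIn P where
  app k := chainFamilyMap (conInr k.1.unop k.2.unop).op fun _ h => h
  naturality _ _ f := chainFamily_hom_ext
    (congrArg Quiver.Hom.op (conInr_conMap f.1.unop f.2.unop))

end Chains

/-! ### Maps of `Δ` between concatenations, used to write down the homotopies -/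

section SimplexMaps

/-- The map `[n] * [m] ⟶ [l]` with given restrictions. -/
def conDesc {n m l : SimplexCategory} (f : n ⟶ l) (g : m ⟶ l)
    (h : ∀ i j, f.toOrderHom i ≤ g.toOrderHom j) : con n m ⟶ l :=
  SimplexCategory.mkHom
    { toFun := fun i : Fin ((n.len + 1) + (m.len + 1)) =>
        Fin.addCases (motive := fun _ => Fin (l.len + 1)) f.toOrderHom g.toOrderHom i
      monotone' := fun (i j : Fin ((n.len + 1) + (m.len + 1))) hij => by
        cases i using Fin.addCases with
        | left i =>
          cases j using Fin.addCases with
          | left j =>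
            simp only [Fin.addCases_left]
            exact f.toOrderHom.monotone (Fin.le_def.2 hij)
          | right j =>
            simp only [Fin.addCases_left, Fin.addCases_right]
            exact h i j
        | right i =>
          cases j using Fin.addCases with
          | left j => rw [Fin.le_def] at hij; simp at hij; omega
          | right j =>
            simp only [Fin.addCases_right]
            exact g.toOrderHom.monotone (by rw [Fin.le_def] at hij ⊢; simpa using hij) }

theorem conInl_conDesc {n m l : SimplexCategory} (f : n ⟶ l) (g : m ⟶ l)
    (h : ∀ i j, f.toOrderHom i ≤ g.toOrderHom j) : conInl n m ≫ conDesc f g h = f :=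
  SimplexCategory.Hom.ext _ _ (OrderHom.ext _ _ (funext fun i =>
    Fin.addCases_left (motive := fun _ => Fin (l.len + 1))
      (left := f.toOrderHom) (right := g.toOrderHom) i))

theorem conInr_conDesc {n m l : SimplexCategory} (f : n ⟶ l) (g : m ⟶ l)
    (h : ∀ i j, f.toOrderHom i ≤ g.toOrderHom j) : conInr n m ≫ conDesc f g h = g :=
  SimplexCategory.Hom.ext _ _ (OrderHom.ext _ _ (funext fun i =>
    Fin.addCases_right (motive := fun _ => Fin (l.len + 1))
      (left := f.toOrderHom) (right := g.toOrderHom) i))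

theorem con_hom_ext {n m l : SimplexCategory} {f g : con n m ⟶ l}
    (hl : conInl n m ≫ f = conInl n m ≫ g) (hr : conInr n m ≫ f = conInr n m ≫ g) : f = g := by
  refine SimplexCategory.Hom.ext _ _ (OrderHom.ext _ _ (funext fun i => ?_))
  induction i using con_cases with
  | hl i => exact congrArg (fun f : n ⟶ l => f.toOrderHom i) hl
  | hr i => exact congrArg (fun f : m ⟶ l => f.toOrderHom i) hr

/-- The map which is `f` where `t` is `0` and `g` where `t` is `1`. -/
def switch {n l : SimplexCategory} (t : n ⟶ ⦋1⦌) (f g : n ⟶ l)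
    (h : ∀ i, f.toOrderHom i ≤ g.toOrderHom i) : n ⟶ l :=
  SimplexCategory.mkHom
    { toFun := fun i => if t.toOrderHom i = 0 then f.toOrderHom i else g.toOrderHom i
      monotone' := fun i j hij => by
        have ht : t.toOrderHom i ≤ t.toOrderHom j := t.toOrderHom.monotone hij
        dsimp only
        split_ifs with hi hj hj
        · exact f.toOrderHom.monotone hij
        · exact (h i).trans (g.toOrderHom.monotone hij)
        · rw [hj] at ht
          exact (hi (Fin.le_zero_iff.1 ht)).elim
        · exact g.toOrderHom.monotone hij }

theorem switch_comp {n l l' : SimplexCategory} (t : n ⟶ ⦋1⦌) (f g : n ⟶ l)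
    (h : ∀ i, f.toOrderHom i ≤ g.toOrderHom i) (k : l ⟶ l') :
    switch t f g h ≫ k = switch t (f ≫ k) (g ≫ k) (fun i => k.toOrderHom.monotone (h i)) :=
  SimplexCategory.Hom.ext _ _ (OrderHom.ext _ _ (funext fun _ => apply_ite _ _ _ _))

theorem comp_switch {n n' l : SimplexCategory} (t : n ⟶ ⦋1⦌) (f g : n ⟶ l)
    (h : ∀ i, f.toOrderHom i ≤ g.toOrderHom i) (k : n' ⟶ n) :
    k ≫ switch t f g h = switch (k ≫ t) (k ≫ f) (k ≫ g) (fun i => h (k.toOrderHom i)) := rfl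

theorem switch_zero {n l : SimplexCategory} (f g : n ⟶ l)
    (h : ∀ i, f.toOrderHom i ≤ g.toOrderHom i) :
    switch (SimplexCategory.const n ⦋1⦌ 0) f g h = f :=
  SimplexCategory.Hom.ext _ _ (OrderHom.ext _ _ (funext fun i =>
    show (if (0 : Fin 2) = 0 then f.toOrderHom i else g.toOrderHom i) = _ from if_pos rfl))

theorem switch_one {n l : SimplexCategory} (f g : n ⟶ l)
    (h : ∀ i, f.toOrderHom i ≤ g.toOrderHom i) :
    switch (SimplexCategory.const n ⦋1⦌ 1) f g h = g :=
  SimplexCategory.Hom.ext _ _ (OrderHom.ext _ _ (funext fun i =>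
    show (if (1 : Fin 2) = 0 then f.toOrderHom i else g.toOrderHom i) = _ from
      if_neg (by decide)))

/-- Rewriting inside `switch` would also have to change the proof of comparability; this lemma lets
that proof vary. -/
theorem switch_congr {n l : SimplexCategory} {t : n ⟶ ⦋1⦌} {f g f' g' : n ⟶ l}
    {h : ∀ i, f.toOrderHom i ≤ g.toOrderHom i} {h' : ∀ i, f'.toOrderHom i ≤ g'.toOrderHom i}
    (hf : f = f') (hg : g = g') : switch t f g h = switch t f' g' h' := by
  subst hf hg
  rfl

theorem switch_cases {n l : SimplexCategory} (t : n ⟶ ⦋1⦌) (f g : n ⟶ l)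
    (h : ∀ i, f.toOrderHom i ≤ g.toOrderHom i) (i : Fin (n.len + 1)) :
    (switch t f g h).toOrderHom i = f.toOrderHom i ∨
      (switch t f g h).toOrderHom i = g.toOrderHom i :=
  ite_eq_or_eq (t.toOrderHom i = 0) (f.toOrderHom i) (g.toOrderHom i)

theorem conL_le_conR {n m : ℕ} (i : Fin (n + 1)) (j : Fin (m + 1)) :
    (conL i : Fin (n + 1 + m + 1)) ≤ conR j := by
  rw [Fin.le_def]
  simp
  omega

theorem conR_le_conR {n m : ℕ} {i j : Fin (m + 1)} (h : i ≤ j) :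
    (conR i : Fin (n + 1 + m + 1)) ≤ conR j := by
  rw [Fin.le_def] at h ⊢
  simpa using h

theorem const_zero_le {n m l : SimplexCategory} (g : m ⟶ l) (i : Fin (n.len + 1))
    (j : Fin (m.len + 1)) : (SimplexCategory.const n l 0).toOrderHom i ≤ g.toOrderHom j :=
  Fin.zero_le _

theorem conInl_le_const (n k : SimplexCategory) (i : Fin (n.len + 1)) :
    (conInl n k).toOrderHom i ≤ (SimplexCategory.const n (con n k) (conR 0)).toOrderHom i :=
  conL_le_conR i 0

theorem const_conInl_le (n k : SimplexCategory) (j : Fin (n.len + 1)) (i : Fin (k.len + 1)) :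
    (SimplexCategory.const k n j ≫ conInl n k).toOrderHom i ≤ (conInr n k).toOrderHom i :=
  conL_le_conR j i

theorem switch_conInl_le {n : SimplexCategory} (k : SimplexCategory) (t : n ⟶ ⦋1⦌)
    (i : Fin (n.len + 1)) (j : Fin (k.len + 1)) :
    (switch t _ _ (conInl_le_const n k)).toOrderHom i ≤ (conInr n k).toOrderHom j := by
  obtain e | e := switch_cases t _ _ (conInl_le_const n k) i
  · exact e.trans_le (conL_le_conR i j)
  · exact e.trans_le (conR_le_conR (Fin.zero_le j))

theorem conInl_le_switch (n : SimplexCategory) {k : SimplexCategory} (t : k ⟶ ⦋1⦌)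
    (i : Fin (n.len + 1)) (j : Fin (k.len + 1)) :
    (conInl n ⦋0⦌ ≫ conInl (con n ⦋0⦌) k).toOrderHom i ≤
      (switch t _ _ (const_conInl_le (con n ⦋0⦌) k (conR 0))).toOrderHom j := by
  obtain e | e := switch_cases t _ _ (const_conInl_le (con n ⦋0⦌) k (conR 0)) j
  -- The length of `con n ⦋0⦌` is written out as `n.len + 1 + 0`, so that the inequality inside `[n]
  -- * [0]` can be reused.
  · have h : (conL (n := n.len + 1 + 0) (m := k.len) (conL (n := n.len) (m := 0) i)) ≤
        conL (n := n.len + 1 + 0) (m := k.len) (conR (n := n.len) (m := 0) 0) := by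
      have h := conL_le_conR (n := n.len) (m := 0) i 0
      rw [Fin.le_def] at h ⊢
      exact h
    exact h.trans_eq e.symm
  · exact (conL_le_conR _ j).trans_eq e.symm

/-- The degeneracy `[n] * [k] ⟶ [k]` which sends `[n]` to `0`. -/
def conCollapse (n k : SimplexCategory) : con n k ⟶ k :=
  conDesc (SimplexCategory.const n k 0) (𝟙 k) (const_zero_le _)

theorem conMap_conCollapse {n n' : SimplexCategory} (a : n ⟶ n') (k : SimplexCategory) :
    conMap a (𝟙 k) ≫ conCollapse n' k = conCollapse n k := by
  refine con_hom_ext ?_ ?_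
  · rw [← Category.assoc, conInl_conMap, Category.assoc, conCollapse, conInl_conDesc,
      conCollapse, conInl_conDesc]
    rfl
  · rw [← Category.assoc, conInr_conMap, Category.assoc, conCollapse, conInr_conDesc,
      conCollapse, conInr_conDesc, Category.comp_id]

theorem conInr_conCollapse (n k : SimplexCategory) : conInr n k ≫ conCollapse n k = 𝟙 k :=
  conInr_conDesc _ _ _

/-- The map `[n] * [k] ⟶ [n] * [k]` which moves the vertices of `[n]` with `t = 1` to `[k]`. -/
def conShift {n : SimplexCategory} (k : SimplexCategory) (t : n ⟶ ⦋1⦌) : con n k ⟶ con n k :=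
  conDesc (switch t _ _ (conInl_le_const n k)) (conInr n k) (switch_conInl_le k t)

theorem conInr_conShift {n : SimplexCategory} (k : SimplexCategory) (t : n ⟶ ⦋1⦌) :
    conInr n k ≫ conShift k t = conInr n k :=
  conInr_conDesc _ _ _

/-- Compatibility with simplicial operators in `n`: the naturality of the homotopy that contracts
the left part of a chain. `conShift_zero` and `conShift_one` identify its ends. -/
theorem conMap_conShift {n n' : SimplexCategory} (a : n ⟶ n') (k : SimplexCategory)
    (t : n' ⟶ ⦋1⦌) :
    conMap a (𝟙 k) ≫ conShift k t = conShift k (a ≫ t) ≫ conMap a (𝟙 k) := by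
  refine con_hom_ext ?_ ?_
  · rw [← Category.assoc, conInl_conMap, Category.assoc, conShift, conInl_conDesc,
      conShift, ← Category.assoc, conInl_conDesc, comp_switch, switch_comp]
    refine switch_congr (conInl_conMap _ _).symm ?_
    refine SimplexCategory.Hom.ext _ _ (OrderHom.ext _ _ (funext fun i => ?_))
    exact (conMap_right a (𝟙 k) 0).symm
  · rw [← Category.assoc, conInr_conMap, Category.assoc, conInr_conShift, ← Category.assoc,
      conInr_conShift, conInr_conMap]

theorem conShift_zero (n k : SimplexCategory) :
    conShift k (SimplexCategory.const n ⦋1⦌ 0) = 𝟙 _ := by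
  refine con_hom_ext ?_ ?_
  · rw [conShift, conInl_conDesc, switch_zero, Category.comp_id]
  · rw [conInr_conShift, Category.comp_id]

theorem conShift_one (n k : SimplexCategory) :
    conShift k (SimplexCategory.const n ⦋1⦌ 1) = conCollapse n k ≫ conInr n k := by
  refine con_hom_ext ?_ ?_
  · rw [conShift, conInl_conDesc, switch_one, ← Category.assoc, conCollapse, conInl_conDesc]
    rfl
  · rw [conInr_conShift, ← Category.assoc, conInr_conCollapse, Category.id_comp]

/-- The map `[n] * [k] ⟶ ([n] * [0]) * [k]` which moves the vertices of `[k]` with `t = 0`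
to `[0]`. -/
def conRetract (n : SimplexCategory) {k : SimplexCategory} (t : k ⟶ ⦋1⦌) :
    con n k ⟶ con (con n ⦋0⦌) k :=
  conDesc (conInl n ⦋0⦌ ≫ conInl (con n ⦋0⦌) k)
    (switch t _ _ (const_conInl_le (con n ⦋0⦌) k (conR 0))) (conInl_le_switch n t)

theorem conInl_conRetract (n : SimplexCategory) {k : SimplexCategory} (t : k ⟶ ⦋1⦌) :
    conInl n k ≫ conRetract n t = conInl n ⦋0⦌ ≫ conInl (con n ⦋0⦌) k :=
  conInl_conDesc _ _ _

/-- Compatibility with simplicial operators in `k`: the naturality of the homotopy that contracts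
the right part of a chain to the inserted reflection. -/
theorem conMap_conRetract (n : SimplexCategory) {k k' : SimplexCategory} (b : k ⟶ k')
    (t : k' ⟶ ⦋1⦌) :
    conMap (𝟙 n) b ≫ conRetract n t = conRetract n (b ≫ t) ≫ conMap (𝟙 _) b := by
  refine con_hom_ext ?_ ?_
  · rw [← Category.assoc, conInl_conMap, Category.assoc, conInl_conRetract, ← Category.assoc
      (conInl n k), conInl_conRetract, Category.assoc (conInl n ⦋0⦌), conInl_conMap,
      Category.id_comp, Category.id_comp]
  · rw [← Category.assoc, conInr_conMap, Category.assoc, conRetract, conInr_conDesc,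
      conRetract, ← Category.assoc, conInr_conDesc, comp_switch, switch_comp]
    refine switch_congr ?_ (conInr_conMap _ _).symm
    rw [Category.assoc, conInl_conMap, Category.id_comp]
    rfl

/-- At this end all of `[k]` is sent to the inserted vertex, so only the chain `x * r` is seen,
prolonged degenerately. At the other end, in `conRetract_one`, the inserted vertex is skipped and `x
* y` comes back. -/
theorem conRetract_zero (n k : SimplexCategory) :
    conRetract n (SimplexCategory.const k ⦋1⦌ 0) =
      conMap (𝟙 n) (SimplexCategory.const k ⦋0⦌ 0) ≫ conInl (con n ⦋0⦌) k := by
  refine con_hom_ext ?_ ?_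
  · rw [conInl_conRetract, ← Category.assoc, conInl_conMap, Category.id_comp]
  · rw [conRetract, conInr_conDesc, switch_zero, ← Category.assoc, conInr_conMap]
    rfl

theorem conRetract_one (n k : SimplexCategory) :
    conRetract n (SimplexCategory.const k ⦋1⦌ 1) = conSkip n k := by
  refine con_hom_ext ?_ ?_
  · rw [conInl_conRetract, conSkip, conInl_conMap]
  · rw [conRetract, conInr_conDesc, switch_one, conSkip, conInr_conMap, Category.id_comp]

end SimplexMaps

/-! ### Fixed right part: contracting `x` to the first object of `y` -/

section RightParts

variable {I : Type w} [SmallCategory I] (P : I → Prop)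

/-- The chains `x ∗ y` with varying `x` and with `y` of length `k` in the objects with a given
property. -/
def leftVariation (k : SimplexCategoryᵒᵖ) : SimplexCategoryᵒᵖ ⥤ SimplexFamily (nerve I) :=
  (Functor.curry.obj (CategoryTheory.Prod.swap _ _ ⋙ splitChains P)).obj k

/-- The augmentation `x ∗ y ↦ y`. -/
def leftVariationAugmentation (k : SimplexCategoryᵒᵖ) :
    leftVariation P k ⟶ (Functor.const _).obj ((chainsIn P).obj k) where
  app n := (splitChainsRight P).app (n, k)
  naturality _ _ a := chainFamily_hom_ext
    (congrArg Quiver.Hom.op ((conInr_conMap a.unop (𝟙 k.unop)).trans (Category.id_comp _)))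

/-- The section given by degeneracies. -/
def leftVariationSection (k : SimplexCategoryᵒᵖ) :
    (Functor.const _).obj ((chainsIn P).obj k) ⟶ leftVariation P k where
  app n := chainFamilyMap (conCollapse n.unop k.unop).op fun x h j => by
    have e : (orderFunctor (conCollapse n.unop k.unop)).obj (conR j) = j :=
      congrArg (fun f : k.unop ⟶ k.unop => f.toOrderHom j) (conInr_conCollapse _ _)
    exact Eq.subst (motive := fun i => P (x.obj i)) e.symm (h _)
  naturality _ _ a := chainFamily_hom_ext
    (congrArg Quiver.Hom.op (conMap_conCollapse a.unop k.unop).symm)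

theorem leftVariationSection_augmentation (k : SimplexCategoryᵒᵖ) :
    leftVariationSection P k ≫ leftVariationAugmentation P k = 𝟙 _ := by
  ext n
  exact chainFamily_hom_ext (congrArg Quiver.Hom.op (conInr_conCollapse n.unop k.unop))

/-- The homotopy which moves `x` to the first object of `y`. -/
def leftVariationHomotopy (k : SimplexCategoryᵒᵖ) :
    LevelHomotopy (𝟙 (leftVariation P k))
      (leftVariationAugmentation P k ≫ leftVariationSection P k) where
  app n t := chainFamilyMap (conShift k.unop t).op fun x h j => by
    have e : (orderFunctor (conShift k.unop t)).obj (conR j) = conR j :=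
      congrArg (fun f : k.unop ⟶ _ => f.toOrderHom j) (conInr_conShift _ t)
    exact Eq.subst (motive := fun i => P (x.obj i)) e.symm (h _)
  naturality a t := chainFamily_hom_ext
    (congrArg Quiver.Hom.op (conMap_conShift a.unop k.unop t))
  app_zero n := chainFamily_hom_ext (congrArg Quiver.Hom.op (conShift_zero n.unop k.unop))
  app_one n := chainFamily_hom_ext (congrArg Quiver.Hom.op (conShift_one n.unop k.unop))

end RightParts

/-! ### Fixed left part: contracting `y` to the reflection of the last object of `x` -/

section LeftParts

variable {I : Type w} [SmallCategory I]

/-- The family of simplices `ζ`. -/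
def indexedFamily (n : SimplexCategoryᵒᵖ) {Q : Type w} (ζ : Q → ComposableArrows I n.unop.len) :
    SimplexFamily (nerve I) :=
  ⟨n, Q, ζ⟩

/-- The morphism of families of simplices given by a map of the index sets. -/
def indexedFamilyMap {n : SimplexCategoryᵒᵖ} {Q Q' : Type w}
    {ζ : Q → ComposableArrows I n.unop.len} {ζ' : Q' → ComposableArrows I n.unop.len}
    (f : Q → Q') (h : ∀ q, ζ q = ζ' (f q)) : indexedFamily n ζ ⟶ indexedFamily n ζ' :=
  ⟨𝟙 n, f, fun q => h q⟩

theorem indexedFamily_hom_ext {n : SimplexCategoryᵒᵖ} {Q Q' : Type w}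
    {ζ : Q → ComposableArrows I n.unop.len} {ζ' : Q' → ComposableArrows I n.unop.len}
    {f g : indexedFamily n ζ ⟶ indexedFamily n ζ'} (hm : f.map = g.map)
    (h : ∀ q, f.fn q = g.fn q) : f = g :=
  SimplexFamily.Hom.ext hm (funext h)

variable (P : I → Prop)

/-- The chains `x ∗ y` with the `yⱼ` satisfying the given property. -/
abbrev SplitChain (n k : SimplexCategory) : Type w :=
  {x : ComposableArrows I (con n k).len // ∀ j : Fin (k.len + 1), P (x.obj (conR j))}

variable {P} in
/-- The part `x` of a chain `x ∗ y`. -/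
abbrev SplitChain.left {n k : SimplexCategory} (x : SplitChain P n k) : ComposableArrows I n.len :=
  orderFunctor (conInl n k) ⋙ x.1

variable {P} in
/-- Restriction of the right part. -/
def SplitChain.restrict {n k k' : SimplexCategory} (b : k' ⟶ k) (x : SplitChain P n k) :
    SplitChain P n k' :=
  ⟨orderFunctor (conMap (𝟙 n) b) ⋙ x.1, fun j =>
    Eq.subst (motive := fun i => P (x.1.obj i)) (conMap_right (𝟙 n) b j).symm (x.2 _)⟩

theorem SplitChain.restrict_left {n k k' : SimplexCategory} (b : k' ⟶ k) (x : SplitChain P n k) :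
    (x.restrict b).left = x.left := by
  change orderFunctor (conInl n k' ≫ conMap (𝟙 n) b) ⋙ x.1 = _
  rw [conInl_conMap, Category.id_comp]

theorem SplitChain.restrict_id {n k : SimplexCategory} (x : SplitChain P n k) :
    x.restrict (𝟙 k) = x := by
  refine Subtype.ext ?_
  change orderFunctor (conMap (𝟙 n) (𝟙 k)) ⋙ x.1 = x.1
  rw [conMap_id]
  rfl

theorem SplitChain.restrict_comp {n k k' k'' : SimplexCategory} (b : k' ⟶ k) (b' : k'' ⟶ k')
    (x : SplitChain P n k) : x.restrict (b' ≫ b) = (x.restrict b).restrict b' := by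
  refine Subtype.ext ?_
  change orderFunctor (conMap (𝟙 n) (b' ≫ b)) ⋙ x.1 =
    orderFunctor (conMap (𝟙 n) b' ≫ conMap (𝟙 n) b) ⋙ x.1
  rw [← conMap_comp, Category.comp_id]

/-- The chains `x` for varying `y` such that `x ∗ y` is a chain. -/
def rightVariation (n : SimplexCategoryᵒᵖ) : SimplexCategoryᵒᵖ ⥤ SimplexFamily (nerve I) where
  obj k := indexedFamily n (SplitChain.left (P := P) (n := n.unop) (k := k.unop))
  map b := indexedFamilyMap (SplitChain.restrict b.unop) fun x => (x.restrict_left P b.unop).symm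
  map_id _ := by
    refine indexedFamily_hom_ext ?_ fun x => ?_
    · rfl
    · exact x.restrict_id P
  map_comp b b' := by
    refine indexedFamily_hom_ext ?_ fun x => ?_
    · exact (Category.comp_id _).symm
    · exact x.restrict_comp P b.unop b'.unop

/-- The augmentation by the chains `x`. -/
def rightVariationAugmentation (n : SimplexCategoryᵒᵖ) :
    rightVariation P n ⟶ (Functor.const _).obj ((chainsIn fun _ => True).obj n) where
  app _ := ⟨𝟙 n, fun x => ⟨x.left, fun _ => trivial⟩, fun _ => rfl⟩
  naturality _ _ _ := chainFamily_hom_ext rfl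

variable {P} (hP : ∀ i : I, ∃ (r : I) (η : i ⟶ r), IsReflection P η)

/-- Concatenate `x` with the one-object chain on the reflection of its last object. -/
theorem exists_reflection_chain {n : SimplexCategory} (x : ComposableArrows I n.len)
    (hP : ∀ i : I, ∃ (r : I) (η : i ⟶ r), IsReflection P η) :
    ∃ z : ComposableArrows I (con n ⦋0⦌).len, orderFunctor (conInl n ⦋0⦌) ⋙ z = x ∧
      IsReflection P (z.map (conEdge n ⦋0⦌)) := by
  obtain ⟨r, η, h⟩ := hP (x.obj (Fin.last _))
  let z : ComposableArrows I (con n ⦋0⦌).len :=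
    concat (m := (⦋0⦌ : SimplexCategory).len) x ((Functor.const _).obj r) η
  have hl : orderFunctor (conInl n ⦋0⦌) ⋙ z = x := conInl_concat _ _ _
  have hr : orderFunctor (conInr n ⦋0⦌) ⋙ z = (Functor.const _).obj r := conInr_concat _ _ _
  have hη : HEq (z.map (conEdge n ⦋0⦌)) η := concat_map_conEdge _ _ _
  refine ⟨z, hl, ?_⟩
  -- The connecting edge of the concatenation agrees with `η` only heterogeneously, so the property
  -- is transported along the equalities of the endpoints.
  have key {a a' b b' : I} (f : a ⟶ b) (g : a' ⟶ b') (ha : a = a') (hb : b = b') (hf : HEq f g)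
      (hg : IsReflection P g) : IsReflection P f := by
    subst ha hb hf
    exact hg
  exact key _ _ (Functor.congr_obj hl _) (Functor.congr_obj hr 0) hη h

/-- The prolongation of a chain by the reflection of its last object. -/
noncomputable def reflectionChain {n : SimplexCategory} (x : ComposableArrows I n.len) :
    ComposableArrows I (con n ⦋0⦌).len :=
  (exists_reflection_chain x hP).choose

theorem reflectionChain_left {n : SimplexCategory} (x : ComposableArrows I n.len) :
    orderFunctor (conInl n ⦋0⦌) ⋙ reflectionChain hP x = x :=
  (exists_reflection_chain x hP).choose_spec.1

theorem isReflection_reflectionChain {n : SimplexCategory} (x : ComposableArrows I n.len) :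
    IsReflection P ((reflectionChain hP x).map (conEdge n ⦋0⦌)) :=
  (exists_reflection_chain x hP).choose_spec.2

theorem exists_retraction {n k : SimplexCategory} (x : SplitChain P n k) :
    ∃ t : ComposableArrows I (con (con n ⦋0⦌) k).len,
      orderFunctor (conInl (con n ⦋0⦌) k) ⋙ t = reflectionChain hP x.left ∧
        orderFunctor (conSkip n k) ⋙ t = x.1 :=
  exists_reflection_extension _ (isReflection_reflectionChain hP _) x.1 x.2
    (reflectionChain_left hP _).symm

/-- The chain `x ∗ r ∗ y` obtained from `x ∗ y`, with `r` the reflection of the last object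
of `x`. -/
noncomputable def retraction {n k : SimplexCategory} (x : SplitChain P n k) :
    ComposableArrows I (con (con n ⦋0⦌) k).len :=
  (exists_retraction hP x).choose

theorem retraction_left {n k : SimplexCategory} (x : SplitChain P n k) :
    orderFunctor (conInl (con n ⦋0⦌) k) ⋙ retraction hP x = reflectionChain hP x.left :=
  (exists_retraction hP x).choose_spec.1

theorem retraction_skip {n k : SimplexCategory} (x : SplitChain P n k) :
    orderFunctor (conSkip n k) ⋙ retraction hP x = x.1 :=
  (exists_retraction hP x).choose_spec.2

theorem retraction_right {n k : SimplexCategory} (x : SplitChain P n k) (j : Fin (k.len + 1)) :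
    P ((retraction hP x).obj (conR j)) := by
  have e : (retraction hP x).obj ((conSkip n k).toOrderHom (conR j)) = x.1.obj (conR j) :=
    Functor.congr_obj (retraction_skip hP x) (conR j)
  have e' : (conSkip n k).toOrderHom (conR j) = conR j := conMap_right _ _ _
  rw [← e', e]
  exact x.2 j

/-- The inserted vertex is the reflection itself, which satisfies `P`; this keeps the stages of the
homotopy among the split chains. -/
theorem retraction_middle {n k : SimplexCategory} (x : SplitChain P n k) :
    P ((retraction hP x).obj (conL (n := (con n ⦋0⦌).len) (conR (n := n.len) (m := 0) 0))) := by
  have e : (retraction hP x).obj (conL (n := (con n ⦋0⦌).len) (conR (n := n.len) (m := 0) 0)) =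
      (reflectionChain hP x.left).obj (conR (n := n.len) (m := 0) 0) :=
    Functor.congr_obj (retraction_left hP x) (conR (n := n.len) (m := 0) 0)
  rw [e]
  exact (isReflection_reflectionChain hP x.left).property

/-- The insertion is chosen for each chain separately, so naturality is not built in; it follows
from uniqueness. The reflection chain depends only on the left part, which restriction in `y` does
not change. -/
theorem retraction_restrict {n k k' : SimplexCategory} (b : k' ⟶ k) (x : SplitChain P n k) :
    retraction hP (x.restrict b) = orderFunctor (conMap (𝟙 _) b) ⋙ retraction hP x := by
  refine reflection_extension_unique (P := P) ?_ (retraction_right hP _) ?_ ?_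
  · rw [retraction_left]
    exact isReflection_reflectionChain hP _
  · rw [retraction_left, orderFunctor_comp, conInl_conMap, Category.id_comp, retraction_left,
      SplitChain.restrict_left]
  · rw [retraction_skip, orderFunctor_comp, conSkip, ← conMap_comp, Category.id_comp,
      Category.comp_id]
    have e : conMap (conInl n ⦋0⦌) b = conMap (𝟙 n) b ≫ conSkip n k := by
      rw [conSkip, ← conMap_comp, Category.id_comp, Category.comp_id]
    rw [e, ← orderFunctor_comp, retraction_skip]
    rfl

/-- At each stage a right vertex is either the reflection `r` or the original `yⱼ`, and both satisfy
`P`. -/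
theorem conRetract_cases (n : SimplexCategory) {k : SimplexCategory} (t : k ⟶ ⦋1⦌)
    (j : Fin (k.len + 1)) :
    (conRetract n t).toOrderHom (conR j) =
        conL (n := (con n ⦋0⦌).len) (conR (n := n.len) (m := 0) 0) ∨
      (conRetract n t).toOrderHom (conR j) = conR j := by
  have e : (conRetract n t).toOrderHom (conR j) =
      (switch t _ _ (const_conInl_le (con n ⦋0⦌) k (conR 0))).toOrderHom j :=
    congrArg (fun f : k ⟶ _ => f.toOrderHom j) (conInr_conDesc _ _ (conInl_le_switch n t))
  rw [e]
  exact switch_cases t _ _ (const_conInl_le (con n ⦋0⦌) k (conR 0)) j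

/-- The stages of the homotopy which contracts the right part of a chain to the reflection of
the last object of its left part. -/
noncomputable def SplitChain.deform {n k : SimplexCategory} (t : k ⟶ ⦋1⦌) (x : SplitChain P n k) :
    SplitChain P n k :=
  ⟨orderFunctor (conRetract n t) ⋙ retraction hP x, fun j => by
    obtain e | e := conRetract_cases n t j
    · exact Eq.subst (motive := fun i => P ((retraction hP x).obj i)) e.symm
        (retraction_middle hP x)
    · exact Eq.subst (motive := fun i => P ((retraction hP x).obj i)) e.symm
        (retraction_right hP x j)⟩

/-- The degenerate prolongation of a chain by the reflection of its last object. -/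
noncomputable def degenerateSplitChain {n : SimplexCategory} (k : SimplexCategory)
    (x : ComposableArrows I n.len) : SplitChain P n k :=
  ⟨orderFunctor (conMap (𝟙 n) (SimplexCategory.const k ⦋0⦌ 0)) ⋙ reflectionChain hP x, fun j => by
    have e : (conMap (𝟙 n) (SimplexCategory.const k ⦋0⦌ 0)).toOrderHom (conR j) =
      conR (n := n.len) (m := 0) 0 := conMap_right _ _ _
    exact Eq.subst (motive := fun i => P ((reflectionChain hP x).obj i)) e.symm
      (isReflection_reflectionChain hP x).property⟩

theorem degenerateSplitChain_left {n : SimplexCategory} (k : SimplexCategory)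
    (x : ComposableArrows I n.len) : (degenerateSplitChain hP k x).left = x := by
  change orderFunctor (conInl n k ≫ conMap (𝟙 n) (SimplexCategory.const k ⦋0⦌ 0)) ⋙ _ = x
  rw [conInl_conMap, Category.id_comp, reflectionChain_left]

theorem degenerateSplitChain_restrict {n k k' : SimplexCategory} (b : k' ⟶ k)
    (x : ComposableArrows I n.len) :
    (degenerateSplitChain hP k x).restrict b = degenerateSplitChain hP k' x := by
  refine Subtype.ext ?_
  change orderFunctor (conMap (𝟙 n) b ≫ conMap (𝟙 n) (SimplexCategory.const k ⦋0⦌ 0)) ⋙ _ = _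
  rw [← conMap_comp, Category.comp_id]
  rfl

/-- The homotopy never moves `x`, so it acts on the summands `B(x)` by identities. On the summands
`B(x * y)` it could not be defined this way, since a chain containing `r` is in general not obtained
from `x * y` by a map of `Δ`; this is why `rightVariation` remembers only the left parts. -/
theorem SplitChain.deform_left {n k : SimplexCategory} (t : k ⟶ ⦋1⦌) (x : SplitChain P n k) :
    (x.deform hP t).left = x.left := by
  change orderFunctor (conInl n k ≫ conRetract n t) ⋙ retraction hP x = _
  rw [conInl_conRetract, ← orderFunctor_comp, retraction_left, reflectionChain_left]

theorem SplitChain.restrict_deform {n k k' : SimplexCategory} (b : k' ⟶ k) (t : k ⟶ ⦋1⦌)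
    (x : SplitChain P n k) :
    (x.deform hP t).restrict b = (x.restrict b).deform hP (b ≫ t) := by
  refine Subtype.ext ?_
  change orderFunctor (conMap (𝟙 n) b ≫ conRetract n t) ⋙ retraction hP x =
    orderFunctor (conRetract n (b ≫ t)) ⋙ retraction hP (x.restrict b)
  rw [conMap_conRetract, retraction_restrict, orderFunctor_comp]

theorem SplitChain.deform_zero {n k : SimplexCategory} (x : SplitChain P n k) :
    x.deform hP (SimplexCategory.const k ⦋1⦌ 0) = degenerateSplitChain hP k x.left := by
  refine Subtype.ext ?_
  change orderFunctor (conRetract n _) ⋙ retraction hP x =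
    orderFunctor (conMap (𝟙 n) (SimplexCategory.const k ⦋0⦌ 0)) ⋙ reflectionChain hP x.left
  rw [conRetract_zero, ← orderFunctor_comp, retraction_left]

theorem SplitChain.deform_one {n k : SimplexCategory} (x : SplitChain P n k) :
    x.deform hP (SimplexCategory.const k ⦋1⦌ 1) = x := by
  refine Subtype.ext ?_
  change orderFunctor (conRetract n _) ⋙ retraction hP x = x.1
  rw [conRetract_one, retraction_skip]

/-- The section given by the reflections. -/
noncomputable def rightVariationSection (n : SimplexCategoryᵒᵖ) :
    (Functor.const _).obj ((chainsIn fun _ => True).obj n) ⟶ rightVariation P n where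
  app k := ⟨𝟙 n, fun x => degenerateSplitChain hP k.unop x.1,
    fun x => (degenerateSplitChain_left hP k.unop x.1).symm⟩
  naturality k k' b := by
    refine SimplexFamily.Hom.ext ?_ (funext fun x => ?_)
    · rfl
    · exact (degenerateSplitChain_restrict hP b.unop x.1).symm

theorem rightVariationSection_augmentation (n : SimplexCategoryᵒᵖ) :
    rightVariationSection hP n ≫ rightVariationAugmentation P n = 𝟙 _ := by
  ext k
  exact chainFamily_hom_ext (Category.id_comp _)

/-- The homotopy which moves `y` to the reflection of the last object of `x`. -/
noncomputable def rightVariationHomotopy (n : SimplexCategoryᵒᵖ) :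
    LevelHomotopy (rightVariationAugmentation P n ≫ rightVariationSection hP n)
      (𝟙 (rightVariation P n)) where
  app k t := indexedFamilyMap (SplitChain.deform hP t) fun x => (x.deform_left hP t).symm
  naturality b t := by
    refine indexedFamily_hom_ext ?_ fun x => ?_
    · rfl
    · exact x.restrict_deform hP b.unop t
  app_zero k := by
    refine indexedFamily_hom_ext ?_ fun x => ?_
    · exact (Category.id_comp _).symm
    · exact x.deform_zero hP
  app_one k := by
    refine indexedFamily_hom_ext ?_ fun x => ?_
    · rfl
    · exact x.deform_one hP

end LeftParts

/-! ### Reducing the realisation over all chains to the chains in a reflective property -/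

section ChainResolution

variable {I : Type w} [SmallCategory I]

/-- The simplicial set of the chains in the objects with a given property. -/
def subNerve (P : I → Prop) : SSet.{w} where
  obj n := {x : ComposableArrows I n.unop.len // ∀ j : Fin (n.unop.len + 1), P (x.obj j)}
  map a := ↾fun x => ⟨orderFunctor a.unop ⋙ x.1, fun _ => x.2 _⟩
  map_id _ := rfl
  map_comp _ _ := rfl

/-- The projection of the chains `x ∗ y` to the left parts, with fixed left part. -/
def toRightVariation (P : I → Prop) (n : SimplexCategoryᵒᵖ) :
    (Functor.curry.obj (splitChains P)).obj n ⟶ rightVariation P n where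
  app k := ⟨(conInl n.unop k.unop).op, id, fun _ => rfl⟩
  naturality k k' b := by
    refine SimplexFamily.Hom.ext ?_ (funext fun x => ?_)
    · exact congrArg Quiver.Hom.op (conInl_conMap (𝟙 n.unop) b.unop)
    · rfl

open SimplexFamily

variable {M : Type u} [Category.{v} M] [HasColimitsOfSize.{w, w} M]
  {D : DeltaStructure M} {W : MorphismProperty M} {B : (nerve I).Elements ⥤ M}

/-- A morphism of families which is the identity on indices induces a coproduct of the maps given by
`B`, and weak equivalences are closed under coproducts. -/
theorem DeltaStructure.IsHomotopical.total_map (h : D.IsHomotopical.{w} W)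
    {n m : SimplexCategoryᵒᵖ} {Q : Type w}
    {x : Q → (nerve I).obj n} {y : Q → (nerve I).obj m}
    (f : (⟨n, Q, x⟩ : SimplexFamily (nerve I)) ⟶ ⟨m, Q, y⟩) (hf : ∀ q, f.fn q = q)
    (hW : ∀ q, W (B.map (elementMap f q))) : W ((total B).map f) := by
  obtain ⟨a, g, c⟩ := f
  -- Only now does the map of coproducts have the form `Limits.Sigma.map`, with no reindexing.
  obtain rfl : g = id := funext hf
  have e : (total B).map ⟨a, id, c⟩ = Limits.Sigma.map fun q => B.map (elementMap ⟨a, id, c⟩ q) :=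
    total_hom_ext fun q => (totalι_map B _ q).trans (Limits.Sigma.ι_map
      (fun q => B.map (elementMap (P := ⟨n, Q, x⟩) (Q := ⟨m, Q, y⟩) ⟨a, id, c⟩ q)) q).symm
  rw [e]
  exact h.coproduct _ _ _ hW

variable (P : I → Prop)

/-- In the row over `n`, the anchor maps `x * y → x` allow `B(x * y)` to be replaced by `B(x)`. The
resulting object retracts by deformation onto `∐ B(x)`, because the chains `y` under the last object
of `x` contract to its reflection. -/
theorem DeltaStructure.IsHomotopical.realizationMap_splitChainsLeft (h : D.IsHomotopical.{w} W)
    (hB : ∀ ⦃x y : (nerve I).Elements⦄ (f : x ⟶ y), Replacement.IsAnchor (C := I) f → W (B.map f))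
    (hP : ∀ i : I, ∃ (r : I) (η : i ⟶ r), IsReflection P η) :
    W (D.realizationMap (diagonalAugmentation
      (X := (chainsIn fun _ : I => True) ⋙ total B)
      (Functor.whiskerRight (splitChainsLeft P) (total B)))) := by
  have := h.twoOutOfThree
  refine h.realizationMap_diagonalAugmentation _ fun n => ?_
  have e : rowAugmentation (X := (chainsIn fun _ : I => True) ⋙ total B)
      (Functor.whiskerRight (splitChainsLeft P) (total B)) n =
      Functor.whiskerRight (toRightVariation P n) (total B) ≫
        mapAugmentation (total B) (rightVariationAugmentation P n) := by
    ext k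
    refine Eq.trans ?_ ((total B).map_comp _ _)
    exact congrArg (total B).map (chainFamily_hom_ext (Category.comp_id _).symm)
  rw [e, ← DeltaStructure.realizationMap_augment]
  refine W.comp_mem _ _ (h.realization _ fun k => ?_) ?_
  · exact h.total_map _ (fun _ => rfl) fun q => hB _ fun _ => rfl
  · exact h.augment_mapAugmentation _ _ (rightVariationSection hP n)
      (rightVariationSection_augmentation hP n) (Or.inl ⟨rightVariationHomotopy hP n⟩)

/-- With `y` fixed, the degeneracies at `y₀` and the homotopy moving `x` to `y₀` are restrictions of
chains, so `B` acts on them directly. Neither reflections nor the behaviour of `B` on anchor maps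
enter. The swap makes `y` the index of the rows. -/
theorem DeltaStructure.IsHomotopical.realizationMap_splitChainsRight (h : D.IsHomotopical.{w} W) :
    W (D.realizationMap (diagonalAugmentation
      (Z := (CategoryTheory.Prod.swap _ _ ⋙ splitChains P) ⋙ total B)
      (X := chainsIn P ⋙ total B)
      (Functor.whiskerRight (Functor.whiskerLeft (CategoryTheory.Prod.swap _ _)
        (splitChainsRight P)) (total B)))) := by
  refine h.realizationMap_diagonalAugmentation _ fun k => ?_
  exact h.augment_mapAugmentation (total B) (leftVariationAugmentation P k)
    (leftVariationSection P k) (leftVariationSection_augmentation P k)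
    (Or.inr ⟨leftVariationHomotopy P k⟩)

/-- On chains in `P` the map `B(x) → b` is a weak equivalence, so the realisation may be compared
with that of the copower of `b` by the nerve of `P`, which is contractible. -/
theorem DeltaStructure.IsHomotopical.augment_chainsIn (h : D.IsHomotopical.{w} W)
    (hR : IsContractible (subNerve P)) {b : M}
    (τ : B ⟶ (Functor.const _).obj b)
    (hτ : ∀ (n : SimplexCategoryᵒᵖ) (x : ComposableArrows I n.unop.len),
      (∀ j : Fin (n.unop.len + 1), P (x.obj j)) → W (τ.app ⟨n, x⟩)) :
    W (D.augment (X := chainsIn P ⋙ total B)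
      (Functor.whiskerLeft (chainsIn P) (totalAugmentation τ))) := by
  have := h.twoOutOfThree
  let t : chainsIn P ⋙ total B ⟶ copower (subNerve P) b :=
    { app n := totalDesc fun x => τ.app (((chainsIn P).obj n).element x) ≫
        copowerι (S := subNerve P) b (n := n) x
      naturality n m a := total_hom_ext fun x => by
        refine (Category.assoc _ _ _).symm.trans ?_
        refine (congrArg (· ≫ _) (totalι_map B ((chainsIn P).map a) x)).trans ?_
        rw [Category.assoc, totalι_desc, ← Category.assoc, τ.naturality, ← Category.assoc,
          totalι_desc, Category.assoc]
        refine Eq.trans ?_ (Category.assoc _ _ _).symm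
        refine congrArg (τ.app _ ≫ ·) ((Category.id_comp _).trans ?_)
        exact (copowerι_map (S := subNerve P) b a x).symm }
  have e : Functor.whiskerLeft (chainsIn P) (totalAugmentation τ) =
      t ≫ copowerFold (subNerve P) b := by
    ext n
    refine total_hom_ext fun x => ?_
    refine (totalι_augmentation τ _ x).trans ?_
    symm
    change totalι B _ x ≫ totalDesc _ ≫ (copowerFold (subNerve P) b).app n = _
    refine (Category.assoc _ _ _).symm.trans ?_
    refine (congrArg (· ≫ (copowerFold (subNerve P) b).app n) (totalι_desc _ x)).trans ?_
    refine (Category.assoc _ _ _).trans ?_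
    exact (congrArg (_ ≫ ·) (copowerι_fold (S := subNerve P) b x)).trans (Category.comp_id _)
  rw [e, ← DeltaStructure.realizationMap_augment]
  refine W.comp_mem _ _ (h.realization _ fun n => ?_) (h.augment_copowerFold hR b)
  have e' : t.app n = Limits.Sigma.map fun x => τ.app (((chainsIn P).obj n).element x) :=
    total_hom_ext fun x => (totalι_desc _ x).trans (Limits.Sigma.ι_map
      (fun x => τ.app (((chainsIn P).obj n).element x)) x).symm
  rw [e']
  exact h.coproduct _ _ _ fun x => hτ _ _ x.2

/-- Let `P` be a reflective property of objects such that the nerve of the objects with this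
property is contractible. -/
theorem DeltaStructure.IsHomotopical.augment_chains (h : D.IsHomotopical.{w} W)
    (hB : ∀ ⦃x y : (nerve I).Elements⦄ (f : x ⟶ y), Replacement.IsAnchor (C := I) f → W (B.map f))
    (hP : ∀ i : I, ∃ (r : I) (η : i ⟶ r), IsReflection P η) (hR : IsContractible (subNerve P))
    {b : M} (τ : B ⟶ (Functor.const _).obj b)
    (hτ : ∀ (n : SimplexCategoryᵒᵖ) (x : ComposableArrows I n.unop.len),
      (∀ j : Fin (n.unop.len + 1), P (x.obj j)) → W (τ.app ⟨n, x⟩)) :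
    W (D.augment (X := (chainsIn fun _ : I => True) ⋙ total B)
      (Functor.whiskerLeft (chainsIn fun _ : I => True) (totalAugmentation τ))) := by
  have := h.twoOutOfThree
  have h₁ := h.realizationMap_splitChainsLeft P hB hP
  have h₂ := h.realizationMap_splitChainsRight (B := B) P
  have h₃ := h.augment_chainsIn P hR τ hτ
  -- It suffices to treat the composite from the diagonal of the split chains to `b` through the
  -- left projection.
  refine W.of_precomp _ _ h₁ ?_
  have h₄ := W.comp_mem _ _ h₂ h₃
  rw [DeltaStructure.realizationMap_augment] at h₄ ⊢
  -- On the diagonal the swap of the two indices is invisible, so the augmentations through the left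
  -- and the right projections have the same source.
  refine Eq.mp (congrArg (fun e => W (D.augment
    (X := Functor.diag SimplexCategoryᵒᵖ ⋙ splitChains P ⋙ total B) e)) ?_) h₄
  have key {x y : (nerve I).Elements} (f : x ⟶ y) : B.map f ≫ τ.app y = τ.app x :=
    (τ.naturality f).trans (Category.comp_id _)
  ext n
  refine total_hom_ext fun x => ?_
  -- Both composites restrict to `τ` at `x * y` on the summand of `x * y`, whichever projection is
  -- used, by naturality of `τ`.
  have e (Q : SimplexFamily (nerve I)) (f : (splitChains P).obj (n, n) ⟶ Q) :
      totalι B _ x ≫ (total B).map f ≫ (totalAugmentation τ).app Q = τ.app _ := by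
    rw [← Category.assoc, totalι_map, Category.assoc, totalι_augmentation, key]
  exact (e _ ((splitChainsRight P).app (n, n))).trans (e _ ((splitChainsLeft P).app (n, n))).symm

end ChainResolution

/-! ### Weakly Cartesian morphisms and weak equivalences in a fibre -/

section WeaklyCartesian

variable {C : Type w} [SmallCategory C] {E : Type u} [Category.{v} E] {p : E ⥤ C}
  [IsOpfibration p] (H : HomotopicalDeltaOpfibration.{w} p)

/-- The weak equivalences of the fibre over `b`. -/
abbrev HomotopicalDeltaOpfibration.fiberWeq (b : Cᵒᵖ) :
    MorphismProperty (Functor.Fiber (Transpose.proj p) b) :=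
  (transposeW H.W).inverseImage Functor.Fiber.fiberInclusion

theorem isHomLift_eq {B : Type u₂} [Category.{v₂} B] {F : Type u₃} [Category.{v₃} F] (q : F ⥤ B)
    {b s : B} {f g : b ⟶ s} {x y : F} (φ : x ⟶ y) (hf : q.IsHomLift f φ) (hg : q.IsHomLift g φ) :
    f = g :=
  (IsHomLift.fac q f φ).trans (IsHomLift.fac q g φ).symm

/-- A fibrewise morphism of `E`, seen in the transpose, lies over the equality of the two base
objects. -/
theorem transposeW_isHomLift {W : MorphismProperty E} {x y : Transpose p} {ω : x ⟶ y}
    (hω : transposeW W ω) : (Transpose.proj p).IsHomLift (𝟙 ((Transpose.proj p).obj x)) ω := by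
  obtain ⟨f, hf, -, rfl⟩ := hω
  have hb : (Transpose.proj p).obj y = (Transpose.proj p).obj x :=
    congrArg op (IsHomLift.codomain_eq p (𝟙 (p.obj x.obj)) f)
  have e : (Transpose.proj p).map (Transpose.ofFiberwise f hf) = eqToHom hb.symm :=
    eqToHom_op (IsHomLift.codomain_eq p (𝟙 (p.obj x.obj)) f)
  refine IsHomLift.of_fac' _ _ _ rfl hb (e.trans ?_)
  rw [Category.id_comp]
  exact (eqToHom_trans _ _).symm

/-- The fibrewise part of a weakly Cartesian morphism is a weak equivalence. -/
theorem HomotopicalDeltaOpfibration.of_comp_isCartesian {b s : Cᵒᵖ} (g : b ⟶ s)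
    {x y : Functor.Fiber (Transpose.proj p) b} {z : Transpose p} (χ : x ⟶ y) (κ : y.1 ⟶ z)
    (hκ : (Transpose.proj p).IsCartesian g κ) (h : IsWeaklyCartesian H.W (χ.1 ≫ κ)) :
    H.fiberWeq b χ := by
  obtain ⟨t, ω, κ', hω, hκ', e⟩ := h
  have h₁ := transposeW_isHomLift hω
  have := H.cocomplete b
  have := (H.homotopical b).twoOutOfThree
  have hx : (Transpose.proj p).obj x.1 = b := x.2
  have h₂ : (Transpose.proj p).IsHomLift (𝟙 b) ω := isHomLift_id_of_eq hx h₁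
  obtain rfl : (Transpose.proj p).obj t = b := IsHomLift.codomain_eq _ (𝟙 b) ω
  obtain rfl : (Transpose.proj p).obj z = s := IsHomLift.codomain_eq _ g κ
  have h₃ : (Transpose.proj p).IsHomLift g (χ.1 ≫ κ) := lift_id_comp χ.2 inferInstance
  have h₄ : (Transpose.proj p).IsHomLift ((Transpose.proj p).map κ') (χ.1 ≫ κ) :=
    e ▸ lift_id_comp h₂ inferInstance
  -- The two factorisations are of one and the same morphism, so their Cartesian parts lie over the
  -- same map.
  obtain rfl := isHomLift_eq (Transpose.proj p) (χ.1 ≫ κ) h₃ h₄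
  -- Cartesian morphisms with the same base map and target have isomorphic sources over the fibre,
  -- so `χ` is `ω` followed by an isomorphism.
  let θ := Functor.IsCartesian.domainUniqueUpToIso (Transpose.proj p) ((Transpose.proj p).map κ') κ κ'
  have hθ : (Transpose.proj p).IsHomLift (𝟙 ((Transpose.proj p).obj t)) θ.hom := inferInstance
  have hθ' : (Transpose.proj p).IsHomLift (𝟙 ((Transpose.proj p).obj t)) θ.inv := inferInstance
  let t' : Functor.Fiber (Transpose.proj p) ((Transpose.proj p).obj t) := ⟨t, rfl⟩
  let ω' : x ⟶ t' := fiberHom ω h₂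
  let θ' : t' ≅ y :=
    { hom := fiberHom θ.hom hθ
      inv := fiberHom θ.inv hθ'
      hom_inv_id := Subtype.ext θ.hom_inv_id
      inv_hom_id := Subtype.ext θ.inv_hom_id }
  have e' : χ = ω' ≫ θ'.hom := by
    have h₅ := χ.2
    have h₆ := (ω' ≫ θ'.hom).2
    refine Subtype.ext (Functor.IsCartesian.ext (Transpose.proj p) ((Transpose.proj p).map κ') κ
      χ.1 (ω' ≫ θ'.hom).1 (e.symm.trans ?_))
    refine Eq.trans ?_ (Category.assoc _ _ _).symm
    exact congrArg (ω ≫ ·) (Functor.IsCartesian.fac (Transpose.proj p) ((Transpose.proj p).map κ') κ κ').symm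
  have hi : IsIso θ'.hom := ⟨θ'.inv, θ'.hom_inv_id, θ'.inv_hom_id⟩
  rw [e']
  exact (H.fiberWeq _).comp_mem _ _ hω ((H.homotopical _).of_isIso θ'.hom)

/-- A fibrewise morphism between weakly Cartesian morphisms is a weak equivalence. -/
theorem HomotopicalDeltaOpfibration.of_comp_isWeaklyCartesian {b s : Cᵒᵖ} (g : b ⟶ s)
    {x y : Functor.Fiber (Transpose.proj p) b} {z : Transpose p} (χ : x ⟶ y) (ψ : y.1 ⟶ z)
    (hψ : (Transpose.proj p).IsHomLift g ψ) (h : IsWeaklyCartesian H.W ψ)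
    (h' : IsWeaklyCartesian H.W (χ.1 ≫ ψ)) : H.fiberWeq b χ := by
  have := H.cocomplete b
  have := (H.homotopical b).twoOutOfThree
  have hz := IsHomLift.codomain_eq (Transpose.proj p) g ψ
  have e := toPull_fac hz g ψ hψ
  -- Both `ψ` and `χ ≫ ψ` are compared with the chosen Cartesian lift of `g`; the two comparison
  -- maps are weak equivalences and differ by `χ`.
  have h₁ : H.fiberWeq b (toPull hz g ψ hψ) := by
    refine H.of_comp_isCartesian g _ (Functor.IsPreFibered.pullbackMap hz g) inferInstance ?_
    rwa [e]
  refine (H.fiberWeq b).of_postcomp χ (toPull hz g ψ hψ) h₁ ?_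
  · refine H.of_comp_isCartesian g _ (Functor.IsPreFibered.pullbackMap hz g) inferInstance ?_
    refine Eq.subst (motive := IsWeaklyCartesian H.W) ?_ h'
    exact (congrArg (χ.1 ≫ ·) e.symm).trans (Category.assoc _ _ _).symm

end WeaklyCartesian

/-! ### The left map of the counit span -/

section CounitLeft

open Replacement Sect CommaObject

variable {C D : Type w} [SmallCategory C] [SmallCategory D] {E : Type u} [Category.{v} E]
  {p : E ⥤ C} [IsOpfibration p]

namespace HomotopicalDeltaOpfibration

variable (H : HomotopicalDeltaOpfibration.{w} p) (F : D ⥤ C)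

theorem geom_map_mem {X X' : Sect (Transpose.proj p) (forgetDegree (Replacement C) ⋙ tail C)}
    (τ : X ⟶ X') (c : Replacement C)
    (hτ : ∀ n : SimplexCategoryᵒᵖ, transposeW H.W (τ.app.app (n, c))) :
    transposeW H.W ((H.geom.map τ).app.app c) :=
  have := H.cocomplete ((tail C).obj c)
  (H.homotopical ((tail C).obj c)).realization (sliceMap τ c) hτ

theorem bar_map_mem {X X' : Sect (Transpose.proj p)
      (CategoryOfElements.π (comma F) ⋙ forgetDegree (Replacement C) ⋙ tail C)} (τ : X ⟶ X')
    (hτ : ∀ z : CommaObject F, transposeW H.W (τ.app.app z))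
    (k : SimplexCategoryᵒᵖ × Replacement C) :
    transposeW H.W (((H.bar F).map τ).app.app k) :=
  have := H.cocomplete ((tail C).obj k.2)
  (H.homotopical ((tail C).obj k.2)).coproduct (X.family k) (X'.family k)
    (fun j => fiberHom (τ.app.app ((comma F).elementsMk k j))
      (τ.fiberwise ((comma F).elementsMk k j))) fun _ => hτ _

/-- At each triple `(d, c, α)` the map is the factorisation of `A` of an anchor map through a
Cartesian morphism, hence a weak equivalence for derived `A`; coproducts and realisation preserve
this. No hypothesis on `F` is involved. -/
theorem weq_counitLeft (A : PSect p) (hA : IsDerivedSection H.W A) :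
    H.weq ((H.counitLeft F).app A) := by
  intro c
  refine H.geom_map_mem _ c fun n => H.bar_map_mem F _ (fun z => ?_) (n, c)
  let A' : Sect (Transpose.proj p) (prD F ⋙ Replacement.map F ⋙ tail C) :=
    (precomp (Transpose.proj p) (Replacement.map F ⋙ tail C) (prD F)).obj ((pullback p F).obj A)
  let α : pr F ⋙ tail C ⟶ prD F ⋙ Replacement.map F ⋙ tail C :=
    Functor.whiskerRight (toD F) (tail C)
  let χ : ((precomp (Transpose.proj p) (tail C) (pr F)).obj A).fib z ⟶
      ((restrict (Transpose.proj p) α).obj A').fib z :=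
    fiberHom ((anchorActionApp F A).app.app z) ((anchorActionApp F A).fiberwise z)
  have e : χ.1 ≫ Functor.IsPreFibered.pullbackMap (A'.proj z) (α.app z) =
      A.functor.map ((toD F).app z) :=
    toRestrict_fac α (X := (precomp (Transpose.proj p) (tail C) (pr F)).obj A) (A := A')
      (Functor.whiskerRight (toD F) A.functor) (fun z => A.isHomLift ((toD F).app z)) z
  have hκ : (Transpose.proj p).IsCartesian (α.app z)
    (Functor.IsPreFibered.pullbackMap (A'.proj z) (α.app z)) := inferInstance
  refine H.of_comp_isCartesian (α.app z) χ _ hκ ?_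
  rw [e]
  exact hA _ (isAnchor_toD z)

end HomotopicalDeltaOpfibration

end CounitLeft

/-! ### Pairs `(d, α)` as simplices of the nerve of the comma category -/

section CommaChains

open Replacement

variable {C D : Type w} [SmallCategory C] [SmallCategory D] {F : D ⥤ C} {c : Replacement C}

/-- The pair `(𝐝, α)` given by a chain in the comma category `F / c₀`. -/
def commaSimplex {n : SimplexCategoryᵒᵖ}
    (x : ComposableArrows (CostructuredArrow F c.first) n.unop.len) : CommaObj F (n, c) :=
  ⟨x ⋙ CostructuredArrow.proj F c.first, (x.obj (Fin.last _)).hom⟩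

theorem commaSimplex_map {n m : SimplexCategoryᵒᵖ} (a : n ⟶ m)
    (x : ComposableArrows (CostructuredArrow F c.first) n.unop.len) :
    commaMap F ((a, 𝟙 c) : (n, c) ⟶ (m, c)) (commaSimplex x) =
      commaSimplex (orderFunctor a.unop ⋙ x) := by
  refine Sigma.ext rfl (heq_of_eq ?_)
  have h : firstMap (𝟙 c) = 𝟙 _ := (head C).map_id c
  refine (congrArg (fun t => F.map _ ≫ (x.obj (Fin.last _)).hom ≫ t) h).trans ?_
  refine (congrArg (F.map _ ≫ ·) (Category.comp_id _)).trans ?_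
  refine (congrArg (fun t => F.map t ≫ _) (Category.id_comp _)).trans ?_
  -- After restriction the last object is the one at `a(m)`; its structure map is recovered from
  -- that of `xₙ` by the commuting triangle.
  exact CostructuredArrow.w (x.map (homOfLE (Fin.le_last (a.unop.toOrderHom (Fin.last _)))))

/-- The chain in `F / c₀` given by a chain in `D` and a map from its last object. -/
def costructuredChain {n : SimplexCategoryᵒᵖ} (d : ComposableArrows D n.unop.len)
    {c₀ : C} (α : F.obj (d.obj (Fin.last _)) ⟶ c₀) :
    ComposableArrows (CostructuredArrow F c₀) n.unop.len where
  obj i := CostructuredArrow.mk (F.map (d.map (homOfLE (Fin.le_last i))) ≫ α)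
  map {i j} f := CostructuredArrow.homMk (d.map f) (by
    refine (Category.assoc _ _ _).symm.trans ?_
    refine congrArg (· ≫ α) ((F.map_comp _ _).symm.trans ?_)
    exact congrArg F.map (d.map_comp f (homOfLE (Fin.le_last j))).symm)
  map_id i := by
    ext
    exact d.map_id i
  map_comp f g := by
    ext
    exact d.map_comp f g

theorem eqToHom_left_of_eq {c₀ : C} {i j : CostructuredArrow F c₀} (h : i = j)
    (h' : i.left = j.left) : (eqToHom h).left = eqToHom h' := by
  cases h
  rfl

/-- A morphism of the comma category is determined by its component in `D`, so beyond the underlying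
functors only the objects, with their structure maps, must be compared. -/
theorem costructuredArrow_functor_ext {J : Type u₂} [Category.{v₂} J] {c₀ : C}
    {X Y : J ⥤ CostructuredArrow F c₀}
    (h : X ⋙ CostructuredArrow.proj F c₀ = Y ⋙ CostructuredArrow.proj F c₀)
    (h' : ∀ j, X.obj j = Y.obj j) : X = Y := by
  refine CategoryTheory.Functor.ext h' fun i j f => ?_
  ext
  have e := Functor.congr_hom h f
  refine e.trans ?_
  rw [CategoryTheory.Comma.comp_left, CategoryTheory.Comma.comp_left, eqToHom_left_of_eq (h' i) (congrArg (·.left) (h' i)),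
    eqToHom_left_of_eq (h' j).symm (congrArg (·.left) (h' j).symm)]
  rfl

theorem costructuredChain_proj {n : SimplexCategoryᵒᵖ} {c₀ : C}
    (x : ComposableArrows (CostructuredArrow F c₀) n.unop.len) :
    costructuredChain (n := n) (x ⋙ CostructuredArrow.proj F c₀) (x.obj (Fin.last _)).hom = x := by
  have h (i : Fin (n.unop.len + 1)) :
      CostructuredArrow.mk (F.map (x.map (homOfLE (Fin.le_last i))).left ≫
        (x.obj (Fin.last _)).hom) = x.obj i :=
    congrArg CostructuredArrow.mk (CostructuredArrow.w (x.map (homOfLE (Fin.le_last i))))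
  exact costructuredArrow_functor_ext rfl h

/-- In a chain in `F / c₀` every structure map is the composite of a map to the last object with the
last structure map, so the chain in `D` and the last structure map determine everything. -/
theorem commaSimplex_bijective (n : SimplexCategoryᵒᵖ) :
    Function.Bijective (commaSimplex (F := F) (c := c) (n := n)) := by
  refine Function.bijective_iff_has_inverse.2
    ⟨fun x => costructuredChain (n := n) x.1 x.2, costructuredChain_proj, ?_⟩
  rintro ⟨(d : ComposableArrows D n.unop.len), α⟩
  refine Sigma.ext rfl (heq_of_eq ?_)
  refine (congrArg (· ≫ α) ((congrArg F.map (d.map_id _)).trans (F.map_id _))).trans ?_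
  exact Category.id_comp α

variable (F c) in
/-- The functor from the simplices of the nerve of `F / c₀` to the triples `(𝐝, 𝐜, α)`. -/
def commaChain : (nerve (CostructuredArrow F c.first)).Elements ⥤ CommaObject F where
  obj x := ⟨(x.1, c), commaSimplex x.2⟩
  map {x _} f := ⟨(f.1, 𝟙 c), (commaSimplex_map f.1 x.2).trans (congrArg commaSimplex f.2)⟩
  map_id _ := rfl
  map_comp _ _ := Subtype.ext (Prod.ext rfl (Category.comp_id _).symm)

end CommaChains

/-! ### The fibre of an opfibration as a reflective subcategory of the comma category -/

section InFiber

variable {C D : Type w} [SmallCategory C] [SmallCategory D] {F : D ⥤ C} {c : C}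

variable (F c) in
/-- The objects of `F / c` which lie in the fibre over `c`. -/
def InFiber (i : CostructuredArrow F c) : Prop :=
  ∃ h : F.obj i.left = c, i.hom = eqToHom h

/-- The reflection of `(d, α : F(d) → c)` is an opCartesian lift `d → r` of `α`. A map from `(d, α)`
to an object of the fibre is exactly a lift of `α`, hence factors uniquely through `r` by a map over
the identity. -/
theorem exists_isReflection_inFiber (hF : IsOpfibration F) (i : CostructuredArrow F c) :
    ∃ (r : CostructuredArrow F c) (η : i ⟶ r), IsReflection (InFiber F c) η := by
  obtain ⟨r, η, hη⟩ := IsOpfibration.exists_lift F rfl i.hom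
  obtain rfl : F.obj r = c := IsHomLift.codomain_eq F i.hom η
  have e : F.map η = i.hom := (isHomLift_eq F η inferInstance inferInstance)
  refine ⟨CostructuredArrow.mk (𝟙 (F.obj r)), CostructuredArrow.homMk η (by simpa using e),
    ⟨rfl, rfl⟩, ?_⟩
  intro y hy f
  obtain ⟨h, hy⟩ := hy
  have hw := CostructuredArrow.w f
  have hf : F.IsHomLift i.hom f.left := by
    refine IsHomLift.of_fac _ _ _ rfl h ?_
    rw [← hw, hy]
    simp
  let g := Functor.IsCocartesian.map F i.hom η f.left
  have hg : F.IsHomLift (𝟙 (F.obj r)) g := inferInstance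
  have hg' : η ≫ g = f.left := Functor.IsCocartesian.fac F i.hom η f.left
  refine ⟨CostructuredArrow.homMk g ?_, ?_, ?_⟩
  · have := IsHomLift.fac' F (𝟙 (F.obj r)) g
    simp [this, hy]
  · ext
    exact hg'
  · intro g' h'
    ext
    have e' : η ≫ g'.left = f.left := congrArg (fun t => t.left) h'
    have hw' := CostructuredArrow.w g'
    -- Any competing factorisation is automatically fibrewise by its triangle in `F / c`, so
    -- opCartesian uniqueness applies.
    have : F.IsHomLift (𝟙 (F.obj r)) g'.left := by
      refine IsHomLift.of_fac _ _ _ rfl h ?_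
      rw [hy] at hw'
      simpa using hw'.symm
    exact Functor.IsCocartesian.map_uniq F i.hom η f.left g'.left e'

variable (F c) in
/-- The fibre over `c`, as a subcategory of `F / c`. -/
def fiberToCostructuredArrow : Functor.Fiber F c ⥤ CostructuredArrow F c where
  obj a := CostructuredArrow.mk (eqToHom a.2)
  map {a b} φ := CostructuredArrow.homMk φ.1 (by
    have := φ.2
    simp [IsHomLift.fac' F (𝟙 c) φ.1])

/-- Chains in the fibre over `c₀`. -/
theorem isContractible_subNerve_inFiber (h : IsContractible (nerve (Functor.Fiber F c))) :
    IsContractible (subNerve (InFiber F c)) := by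
  let t : nerve (Functor.Fiber F c) ⟶ subNerve (InFiber F c) :=
    { app n := ↾fun y => ⟨(y : ComposableArrows _ n.unop.len) ⋙ fiberToCostructuredArrow F c,
        fun j => ⟨((y : ComposableArrows _ n.unop.len).obj j).2, rfl⟩⟩
      naturality _ _ _ := rfl }
  -- A chain in `F / c` with all structure maps equalities has all its arrows over the identity, so
  -- it is a chain in the strict fibre; the two simplicial sets are isomorphic.
  have ht (n : SimplexCategoryᵒᵖ) : Function.Bijective (t.app n) := by
    have hl (x : (subNerve (InFiber F c)).obj n) {i j : Fin (n.unop.len + 1)} (f : i ⟶ j) :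
        F.IsHomLift (𝟙 c) (x.1.map f).left := by
      have hw := CostructuredArrow.w (x.1.map f)
      rw [(x.2 i).choose_spec, (x.2 j).choose_spec] at hw
      refine IsHomLift.of_fac _ _ _ (x.2 i).choose (x.2 j).choose ?_
      rw [hw]
      simp
    refine Function.bijective_iff_has_inverse.2 ⟨fun x =>
      { obj j := ⟨(x.1.obj j).left, (x.2 j).choose⟩
        map {i j} f := ⟨(x.1.map f).left, hl x f⟩
        map_id j := Subtype.ext (congrArg (·.left) (x.1.map_id j))
        map_comp f g := Subtype.ext (congrArg (·.left) (x.1.map_comp f g)) },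
      fun y => rfl, fun x => Subtype.ext ?_⟩
    have h' (i : Fin (n.unop.len + 1)) : CostructuredArrow.mk (eqToHom (x.2 i).choose) =
          x.1.obj i :=
      congrArg CostructuredArrow.mk (x.2 i).choose_spec.symm
    exact costructuredArrow_functor_ext rfl h'
  have : ∀ n, IsIso (t.app n) := fun n => (isIso_iff_bijective _).2 (ht n)
  have : IsIso t := NatIso.isIso_of_isIso_app t
  exact IsContractible.of_iso (asIso t).symm h

end InFiber

/-! ### The values on concatenations `Fd * c` as an augmented functor -/

section CounitRight

open Replacement Sect CommaObject HomotopicalDeltaOpfibration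

variable {C D : Type w} [SmallCategory C] [SmallCategory D] {E : Type u} [Category.{v} E]
  {p : E ⥤ C} [IsOpfibration p] {F : D ⥤ C}

/-- The section `(𝐝, 𝐜, α) ↦ A(𝔽𝐝 * 𝐜)`. -/
noncomputable abbrev joinSection (F : D ⥤ C) (A : PSect p) :
    Sect (Transpose.proj p) (prC F ⋙ tail C) :=
  (descent p F).obj ((precomp (Transpose.proj p) (tail C) (pr F)).obj A)

/-- The values of `A` on the concatenations `𝔽𝐝 * 𝐜`, as a functor on the simplices of the nerve
of `F / c₀`. -/
noncomputable def commaDiagram (F : D ⥤ C) (A : PSect p) (c : Replacement C) :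
    (nerve (CostructuredArrow F c.first)).Elements ⥤
      Functor.Fiber (Transpose.proj p) ((tail C).obj c) where
  obj x := (joinSection F A).fib ((commaChain F c).obj x)
  map f := fiberHom ((joinSection F A).functor.map ((commaChain F c).map f)) (by
    have h := (joinSection F A).isHomLift ((commaChain F c).map f)
    exact (tail C).map_id c ▸ h)
  map_id x := Subtype.ext ((congrArg (joinSection F A).functor.map
    ((commaChain F c).map_id x)).trans ((joinSection F A).functor.map_id _))
  map_comp f g := Subtype.ext ((congrArg (joinSection F A).functor.map
    ((commaChain F c).map_comp f g)).trans ((joinSection F A).functor.map_comp _ _))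

/-- The maps `A(𝔽𝐝 * 𝐜) ⟶ A(𝐜)`, as an augmentation. -/
noncomputable def commaAugmentation (F : D ⥤ C) (A : PSect p) (c : Replacement C) :
    commaDiagram F A c ⟶ (Functor.const _).obj (A.fib c) where
  app x := fiberHom (A.functor.map ((toC F).app ((commaChain F c).obj x)))
    (((structuralAction p F).app A).fiberwise ((commaChain F c).obj x))
  naturality x y f := Subtype.ext (by
    have e := (toC F).naturality ((commaChain F c).map f)
    have e' : (prC F).map ((commaChain F c).map f) = 𝟙 c := rfl
    have h := congrArg A.functor.map (e.trans ((congrArg ((toC F).app _ ≫ ·) e').trans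
      (Category.comp_id _)))
    refine Eq.trans ?_ (h.trans (Category.comp_id _).symm)
    exact (A.functor.map_comp _ _).symm)

/-- Together with the condition on structure maps, this shows that `F` turns a chain in the fibre
into a constant chain, as `conCollapse_comp_chain` requires. -/
theorem map_eq_eqToHom_of_inFiber {c : C} {i j : CostructuredArrow F c} (hi : InFiber F c i)
    (hj : InFiber F c j) (f : i ⟶ j) :
    F.map f.left = eqToHom (hi.choose.trans hj.choose.symm) := by
  have hw := CostructuredArrow.w f
  rw [hi.choose_spec, hj.choose_spec] at hw
  rw [← cancel_mono (eqToHom hj.choose), hw, eqToHom_trans]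

theorem eq_eqToHom_of_comp {I : Type u} [Category.{v} I] {x y : I} {f : x ⟶ y} (h : y = x)
    (e : f ≫ eqToHom h = 𝟙 x) : f = eqToHom h.symm := by
  subst h
  simpa using e

theorem eqToHom_heq_eqToHom {I : Type u} [Category.{v} I] {x y x' y' : I} (h : x = y)
    (h' : x' = y') (hx : x = x') (hy : y = y') : HEq (eqToHom h) (eqToHom h') := by
  subst hx h h'
  rfl

theorem conCollapse_left (n m : SimplexCategory) (i : Fin (n.len + 1)) :
    (conCollapse n m).toOrderHom (conL i) = 0 :=
  congrArg (fun t => t.toOrderHom i)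
    (conInl_conDesc (SimplexCategory.const n m 0) (𝟙 _) (const_zero_le _))

/-- The concatenation of a constant chain with a chain is a degeneracy of the latter. -/
theorem conCollapse_comp_chain {I : Type u} [Category.{v} I] {n m : SimplexCategory}
    (x : ComposableArrows I n.len) (y : ComposableArrows I m.len)
    (α : x.obj (Fin.last _) ⟶ y.obj 0) (hx : ∀ i, x.obj i = y.obj 0)
    (hf : ∀ ⦃i j⦄ (f : i ⟶ j), x.map f = eqToHom ((hx i).trans (hx j).symm))
    (hα : α = eqToHom (hx _)) :
    orderFunctor (conCollapse n m) ⋙ y = concat x y α := by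
  have hl := conCollapse_left n m
  have hr : (conCollapse n m).toOrderHom (conR 0) = 0 :=
    congrArg (fun t => t.toOrderHom 0) (conInr_conCollapse n m)
  have e₀ : orderFunctor (conInl n m) ⋙ orderFunctor (conCollapse n m) ⋙ y = x := by
    refine CategoryTheory.Functor.ext (fun i => ?_) (fun i j f => ?_)
    · exact (congrArg y.obj (hl i)).trans (hx i).symm
    · have e : (orderFunctor (conInl n m) ⋙ orderFunctor (conCollapse n m)).map f =
        eqToHom ((hl i).trans (hl j).symm) := Subsingleton.elim _ _
      rw [hf f]
      refine ((congrArg y.map e).trans (eqToHom_map _ _)).trans ?_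
      exact (eqToHom_trans _ _).symm.trans (congrArg (eqToHom _ ≫ ·) (eqToHom_trans _ _).symm)
  refine con_functor_ext (e₀.trans (conInl_concat _ _ _).symm) ?_ ?_
  · refine Eq.trans ?_ (conInr_concat _ _ _).symm
    refine (orderFunctor_comp _ _ _).trans ?_
    rw [conInr_conCollapse]
    rfl
  · refine HEq.trans ?_ (concat_map_conEdge _ _ _).symm
    have e : (orderFunctor (conCollapse n m)).map (conEdge n m) = eqToHom ((hl _).trans hr.symm) :=
      Subsingleton.elim _ _
    refine (heq_of_eq ((congrArg y.map e).trans (eqToHom_map _ _))).trans ?_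
    subst hα
    exact eqToHom_heq_eqToHom _ _ ((congrArg y.obj (hl _)).trans (hx _).symm) (congrArg y.obj hr)

namespace HomotopicalDeltaOpfibration

variable (H : HomotopicalDeltaOpfibration.{w} p)

/-- If `d'` is an initial segment of `d`, then `Fd * c → Fd' * c` is not an anchor map in general,
but it becomes one after composition with `Fd' * c → Fd'`. Since `A` sends both the composite and
the second map to weakly Cartesian maps, the first one goes to a weak equivalence. -/
theorem commaDiagram_map_mem {A : PSect p} (hA : IsDerivedSection H.W A) {c : Replacement C}
    {x y : (nerve (CostructuredArrow F c.first)).Elements} (f : x ⟶ y)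
    (hf : IsAnchor (C := CostructuredArrow F c.first) f) :
    H.fiberWeq _ ((commaDiagram F A c).map f) := by
  let z := (commaChain F c).obj y
  let ψ : (joinSection F A).functor.obj z ⟶ _ := A.functor.map ((toD F).app z)
  refine H.of_comp_isWeaklyCartesian
    -- The equality map corrects the base: `A(Fd' * c)` lies over the last object of the
    -- concatenation, which equals `cₘ` only propositionally.
    (eqToHom ((commaDiagram F A c).obj y).2.symm ≫ (Transpose.proj p).map ψ) _ ψ
    (IsHomLift.of_fac _ _ _ ((commaDiagram F A c).obj y).2 rfl
      (congrArg (_ ≫ ·) (Category.comp_id _).symm)) (hA _ (isAnchor_toD z)) ?_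
  -- By naturality, the composite is the restriction of `Fd * c` first to `Fd` and then to `Fd'`,
  -- which is an anchor map.
  have e := (A.functor.map_comp ((pr F).map ((commaChain F c).map f)) ((toD F).app z)).symm.trans
    (congrArg A.functor.map ((toD F).naturality ((commaChain F c).map f)))
  refine Eq.subst (motive := IsWeaklyCartesian H.W) e.symm (hA _ fun i => ?_)
  exact hf i

/-- For a chain in the fibre, `Fd * c` is a degeneracy of `c`, so the augmentation has a section
`A(c) → A(Fd * c)`. It is enough that the section is a weak equivalence, which is seen by mapping
both sides to the value of `A` at the first vertex. -/
theorem commaAugmentation_app_mem {A : PSect p} (hA : IsDerivedSection H.W A) {c : Replacement C}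
    {n : SimplexCategoryᵒᵖ} (x : ComposableArrows (CostructuredArrow F c.first) n.unop.len)
    (hx : ∀ j : Fin (n.unop.len + 1), InFiber F c.first (x.obj j)) :
    H.fiberWeq _ ((commaAugmentation F A c).app ⟨n, x⟩) := by
  have := H.cocomplete ((tail C).obj c)
  have := (H.homotopical ((tail C).obj c)).twoOutOfThree
  let z := (commaChain F c).obj ⟨n, x⟩
  let s : c ⟶ (pr F).obj z :=
    ⟨(conCollapse n.unop c.1.unop).op, conCollapse_comp_chain (n := n.unop) (m := c.1.unop)
      ((x ⋙ CostructuredArrow.proj F c.first) ⋙ F) c.chain _ (fun i => (hx i).choose)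
      (fun i j f => map_eq_eqToHom_of_inFiber (hx i) (hx j) (x.map f)) (hx _).choose_spec⟩
  have hs : s ≫ (toC F).app z = 𝟙 c :=
    Subtype.ext (congrArg Quiver.Hom.op (conInr_conCollapse n.unop c.1.unop))
  -- The degeneracy keeps the last object, so `A` sends it to a map in the fibre over `cₘ`.
  have ht : (tail C).map s = eqToHom (tail_obj_pr z).symm := by
    have e := ((tail C).map_comp s ((toC F).app z)).symm.trans
      ((congrArg (tail C).map hs).trans ((tail C).map_id c))
    exact eq_eqToHom_of_comp (tail_obj_pr z)
      ((congrArg ((tail C).map s ≫ ·) (tail_map_toC z)).symm.trans e)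
  have hl : (Transpose.proj p).IsHomLift (𝟙 ((tail C).obj c)) (A.functor.map s) := by
    have h := isHomLift_id_of_eqToHom ht (A.isHomLift s)
    exact Eq.subst (motive := fun b => (Transpose.proj p).IsHomLift (𝟙 b) (A.functor.map s))
      (tail_obj_pr z) h
  let χ : A.fib c ⟶ (commaDiagram F A c).obj ⟨n, x⟩ := fiberHom (A.functor.map s) hl
  have hχ : χ ≫ (commaAugmentation F A c).app ⟨n, x⟩ = 𝟙 _ :=
    Subtype.ext ((A.functor.map_comp s ((toC F).app z)).symm.trans
      ((congrArg A.functor.map hs).trans (A.functor.map_id c)))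
  refine (H.fiberWeq _).of_precomp (W' := H.fiberWeq _) χ ((commaAugmentation F A c).app ⟨n, x⟩) ?_ ?_
  -- Restriction to the vertex `0` is an anchor map for `Fd * c`, and also for `c` after the
  -- degeneracy, because the degeneracy sends the vertex `0` to `0`.
  · let a : ((pr F).obj z).1 ⟶ op ⦋0⦌ := (SimplexCategory.const ⦋0⦌ (con n.unop c.1.unop) 0).op
    let v : (pr F).obj z ⟶ ⟨op ⦋0⦌, (nerve C).map a ((pr F).obj z).2⟩ := ⟨a, rfl⟩
    let ψ : (joinSection F A).functor.obj z ⟶ _ := A.functor.map v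
    refine H.of_comp_isWeaklyCartesian
      (eqToHom ((commaDiagram F A c).obj ⟨n, x⟩).2.symm ≫ (Transpose.proj p).map ψ) _ ψ
      (IsHomLift.of_fac _ _ _ ((commaDiagram F A c).obj ⟨n, x⟩).2 rfl
      (congrArg (_ ≫ ·) (Category.comp_id _).symm))
      (hA _ fun i => ?_) ?_
    · have hi : i = 0 := Subsingleton.elim (α := Fin 1) _ _
      rw [hi]
      rfl
    · refine Eq.subst (motive := IsWeaklyCartesian H.W) (A.functor.map_comp s v) (hA _ fun i => ?_)
      have hi : i = 0 := Subsingleton.elim (α := Fin 1) _ _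
      rw [hi]
      refine (congrArg Fin.val (?_ : (conCollapse n.unop c.1.unop).toOrderHom (conL 0) = 0))
      exact conCollapse_left n.unop c.1.unop 0
  · rw [hχ]
    exact (H.homotopical _).of_isIso _

end HomotopicalDeltaOpfibration

end CounitRight

/-! ### The right map of the counit span -/

section CounitRight

open Replacement Sect CommaObject HomotopicalDeltaOpfibration SimplexFamily

variable {C D : Type w} [SmallCategory C] [SmallCategory D] {E : Type u} [Category.{v} E]
  {p : E ⥤ C} [IsOpfibration p]

namespace HomotopicalDeltaOpfibration

variable (H : HomotopicalDeltaOpfibration.{w} p) (F : D ⥤ C) (A : PSect p) (c : Replacement C)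

/-- The simplices of the nerve of `F / c₀` of degree `n` are the pairs `(𝐝, α)`. -/
noncomputable def chainsEquiv (n : SimplexCategoryᵒᵖ) :
    ((chainsIn fun _ : CostructuredArrow F c.first => True).obj n).index ≃ CommaObj F (n, c) :=
  (Equiv.subtypeUnivEquiv fun _ _ => trivial).trans (Equiv.ofBijective _ (commaSimplex_bijective n))

variable [HasColimitsOfSize.{w, w} (Functor.Fiber (Transpose.proj p) ((tail C).obj c))]

variable {F} {c} in
/-- The objects `A(𝔽𝐝 * 𝐜)` for a fixed chain `𝐜`. -/
noncomputable abbrev joinFamily (n : SimplexCategoryᵒᵖ) (j : CommaObj F (n, c)) :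
    Functor.Fiber (Transpose.proj p) ((tail C).obj c) :=
  Sect.family (J := comma F) (k := forgetDegree (Replacement C) ⋙ tail C)
    (joinSection F A) (n, c) j

variable {F} {c} in
/-- The inclusion of a summand into the coproduct of the `A(𝔽𝐝 * 𝐜)`. -/
noncomputable def joinι (n : SimplexCategoryᵒᵖ) (j : CommaObj F (n, c)) :
    joinFamily A n j ⟶ (((H.bar F).obj (joinSection F A)).slice c).obj n :=
  Limits.Sigma.ι (joinFamily A n) j

/-- The coproducts of the values of `A` on the concatenations `𝔽𝐝 * 𝐜` in a fixed degree. -/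
noncomputable def totalIso (n : SimplexCategoryᵒᵖ) :
    ((chainsIn fun _ : CostructuredArrow F c.first => True) ⋙ total (commaDiagram F A c)).obj n ≅
      (((H.bar F).obj (joinSection F A)).slice c).obj n :=
  Limits.Sigma.reindex (chainsEquiv F c n) (joinFamily A n)

theorem totalι_totalIso (n : SimplexCategoryᵒᵖ)
    (i : ((chainsIn fun _ : CostructuredArrow F c.first => True).obj n).index) :
    totalι (commaDiagram F A c) _ i ≫ (H.totalIso F A c n).hom =
      H.joinι A n (commaSimplex i.1) :=
  Limits.Sigma.ι_reindex_hom (chainsEquiv F c n) (joinFamily A n) i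

theorem totalIso_naturality {n m : SimplexCategoryᵒᵖ} (a : n ⟶ m) :
    ((chainsIn fun _ : CostructuredArrow F c.first => True) ⋙ total (commaDiagram F A c)).map a ≫
        (H.totalIso F A c m).hom =
      (H.totalIso F A c n).hom ≫ (((H.bar F).obj (joinSection F A)).slice c).map a := by
  have := H.hasCoproduct
  refine total_hom_ext fun i => ?_
  refine (Category.assoc _ _ _).symm.trans (Eq.trans ?_ (Category.assoc _ _ _))
  refine (congrArg (· ≫ (H.totalIso F A c m).hom) (totalι_map (commaDiagram F A c)
    ((chainsIn fun _ : CostructuredArrow F c.first => True).map a) i)).trans ?_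
  refine (Category.assoc _ _ _).trans ?_
  refine (congrArg (_ ≫ ·) (H.totalι_totalIso F A c m _)).trans ?_
  refine Eq.trans ?_ (congrArg (· ≫ _) (H.totalι_totalIso F A c n i).symm)
  -- The bar construction lands in the summand of `commaMap` applied to the pair, while the chains
  -- land in the summand of the restricted chain; `commaSimplex_map` identifies the two indices.
  have h := Sect.ι_coprodMap (J := comma F) (k := forgetDegree (Replacement C) ⋙ tail C)
    (joinSection F A) ((a, 𝟙 c) : (n, c) ⟶ (m, c)) (commaSimplex i.1)
  have h' := Sect.map_coprodι (J := comma F) (k := forgetDegree (Replacement C) ⋙ tail C)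
    (joinSection F A) ((a, 𝟙 c) : (n, c) ⟶ (m, c)) (commaSimplex_map a i.1)
  exact Subtype.ext (h'.trans h.symm)

/-- The total coproducts form the value of the bar construction at `𝐜`. -/
noncomputable def totalSlice :
    (chainsIn fun _ : CostructuredArrow F c.first => True) ⋙ total (commaDiagram F A c) ⟶
      ((H.bar F).obj (joinSection F A)).slice c where
  app n := (H.totalIso F A c n).hom
  naturality _ _ a := H.totalIso_naturality F A c a

/-- The augmentation of the bar construction given by the maps `A(𝔽𝐝 * 𝐜) ⟶ A(𝐜)`. -/
noncomputable def sliceAugmentation :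
    ((H.bar F).obj (joinSection F A)).slice c ⟶ (Functor.const _).obj (A.fib c) where
  app n := (sliceMap ((H.bar F).map ((structuralAction p F).app A)) c).app n ≫
    (sliceMap ((H.foldBar F).app ((precomp (Transpose.proj p) (tail C)
      (forgetDegree (Replacement C))).obj A)) c).app n
  naturality n m a := by
    have h := ((sliceMap ((H.bar F).map ((structuralAction p F).app A)) c) ≫
      sliceMap ((H.foldBar F).app ((precomp (Transpose.proj p) (tail C)
        (forgetDegree (Replacement C))).obj A)) c).naturality a
    refine h.trans (congrArg (_ ≫ ·) ?_)
    -- The slice of the constant simplicial presection has transition maps `A(𝟙 c)`, which must be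
    -- turned into identities before it is a constant object.
    exact Subtype.ext (A.functor.map_id c)

theorem joinι_sliceAugmentation (n : SimplexCategoryᵒᵖ) (j : CommaObj F (n, c)) :
    (H.joinι A n j ≫ (H.sliceAugmentation F A c).app n).1 =
      A.functor.map ((toC F).app ⟨(n, c), j⟩) := by
  have := H.hasCoproduct
  have h := Sect.ι_coprodFibMap (J := comma F) (k := forgetDegree (Replacement C) ⋙ tail C)
    ((structuralAction p F).app A) (n, c) j
  have h' := Sect.ι_foldMap (J := comma F) ((precomp (Transpose.proj p) (tail C)
    (forgetDegree (Replacement C))).obj A) (n, c) j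
  refine (Category.assoc _ _ _).symm.trans ?_
  refine (congrArg (· ≫ _) h).trans ?_
  refine (Category.assoc _ _ _).trans ?_
  refine (congrArg (A.functor.map ((toC F).app ⟨(n, c), j⟩) ≫ ·) h').trans ?_
  exact Category.comp_id _

theorem totalSlice_sliceAugmentation :
    H.totalSlice F A c ≫ H.sliceAugmentation F A c =
      Functor.whiskerLeft (chainsIn fun _ : CostructuredArrow F c.first => True)
        (totalAugmentation (commaAugmentation F A c)) := by
  refine NatTrans.ext (funext fun n => ?_)
  refine total_hom_ext (B := commaDiagram F A c) fun i => ?_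
  refine (Category.assoc _ _ _).symm.trans ?_
  refine (congrArg (· ≫ _) (H.totalι_totalIso F A c n i)).trans ?_
  refine Eq.trans ?_ (totalι_augmentation (commaAugmentation F A c) _ i).symm
  exact Subtype.ext (H.joinι_sliceAugmentation F A c n (commaSimplex i.1))

/-- The component at `𝐜` of the right map of the counit span is the map induced by an
augmentation. -/
theorem augment_sliceAugmentation :
    ((H.isOver.fiber ((tail C).obj c)).augment (H.sliceAugmentation F A c)).1 =
      ((H.counitRight F).app A).app.app c := by
  have := H.hasCoend
  let Y : Sect (Transpose.proj p) (forgetDegree (Replacement C) ⋙ tail C) :=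
    (precomp (Transpose.proj p) (tail C) (forgetDegree (Replacement C))).obj A
  let σ := (H.bar F).map ((structuralAction p F).app A)
  let ρ := (H.foldBar F).app Y
  refine real_hom_ext H.isOver ((H.bar F).obj (joinSection F A)) c (𝟙 _)
    ((H.isOver.fiber ((tail C).obj c)).augment (H.sliceAugmentation F A c)).2
    (((H.counitRight F).app A).fiberwise c) fun n => ?_
  have h := congrArg Subtype.val
    ((H.isOver.fiber ((tail C).obj c)).realizationι_augment (H.sliceAugmentation F A c) n)
  -- On `Δ^n ⊗ -` the right map applies the structural action, then the folding map, and then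
  -- collapses `Δ^n`; the first two together are the augmentation.
  have h₁ := ι_realizationMap H.isOver σ c n
  have h₂ := ι_realizationMap H.isOver ρ c n
  have h₃ := ι_constMap H.isOver A c n
  refine Eq.trans h (Eq.symm ?_)
  refine (Category.assoc _ _ _).symm.trans ?_
  refine (congrArg (· ≫ _) h₁).trans ?_
  refine (Category.assoc _ _ _).trans ?_
  refine (congrArg (_ ≫ ·) ((Category.assoc _ _ _).symm.trans ((congrArg (· ≫ _) h₂).trans
    ((Category.assoc _ _ _).trans (congrArg (_ ≫ ·) h₃))))).trans ?_
  refine (Category.assoc _ _ _).symm.trans ?_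
  exact congrArg (· ≫ _) ((H.delta.tensor.obj n.unop).map_comp _ _).symm

/-- The cofinality argument `augment_chains` is applied to `F / c₀` and its reflective subcategory
`D(c₀)`, whose nerve is contractible. The result is transported along the identification of the bar
construction at `c` with coproducts over chains. -/
theorem weq_counitRight (hF : IsResolution F) (hA : IsDerivedSection H.W A) :
    H.weq ((H.counitRight F).app A) := by
  intro c
  have := H.cocomplete ((tail C).obj c)
  have := (H.homotopical ((tail C).obj c)).twoOutOfThree
  have h := (H.homotopical ((tail C).obj c)).augment_chains (InFiber F c.first)
    (fun _ _ f hf => H.commaDiagram_map_mem hA f hf)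
    (exists_isReflection_inFiber hF.opfibration)
    (isContractible_subNerve_inFiber (hF.contractible c.first))
    (commaAugmentation F A c) (fun n x hx => H.commaAugmentation_app_mem hA x hx)
  rw [← H.totalSlice_sliceAugmentation, ← DeltaStructure.realizationMap_augment] at h
  -- The comparison of the two simplicial objects is a levelwise isomorphism, so its realisation
  -- cancels by two-out-of-three.
  have h' : H.fiberWeq _ ((H.isOver.fiber ((tail C).obj c)).augment (H.sliceAugmentation F A c)) :=
    (H.fiberWeq _).of_precomp (W' := H.fiberWeq _) _ _
      ((H.homotopical _).realization (H.totalSlice F A c) fun n =>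
        (H.homotopical _).of_isIso (H.totalIso F A c n).hom) h
  have e := H.augment_sliceAugmentation F A c
  exact e ▸ h'

/-- The counit is an isomorphism if both maps of the counit span are weak equivalences. -/
theorem isIso_counit (h : H.weq ((H.counitLeft F).app A)) (h' : H.weq ((H.counitRight F).app A)) :
    IsIso (H.counit F A h) := by
  have : IsIso (H.weq.Q.map ((H.counitRight F).app A)) := H.weq.Q_inverts _ h'
  exact inferInstanceAs (IsIso ((Localization.Construction.wIso _ h).inv ≫
    H.weq.Q.map ((H.counitRight F).app A)))

end HomotopicalDeltaOpfibration

end CounitRight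

end DerSect

/-! ### The counit for a resolution -/

theorem mainTheorem3 {C D : Type w} [SmallCategory C] [SmallCategory D]
    {E : Type u} [Category.{v} E] (p : E ⥤ C) [DerSect.IsOpfibration p]
    (H : DerSect.HomotopicalDeltaOpfibration.{w} p) (F : D ⥤ C) (hF : DerSect.IsResolution F)
    (A : DerSect.PSect p) (hA : DerSect.IsDerivedSection H.W A) :
    H.weq ((H.counitRight F).app A) ∧
      ∃ h : H.weq ((H.counitLeft F).app A), IsIso (H.counit F A h) :=
  ⟨H.weq_counitRight F A hF hA, H.weq_counitLeft F A hA,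
    H.isIso_counit F A _ (H.weq_counitRight F A hF hA)⟩
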